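/- **Conventions.** Manifolds are smooth, finite-dimensional and second countable. A *local Lie groupoid* $G$ over a Hausdorff manifold $M$ consists of a manifold $G$ (possibly non-Hausdorff), submersions $s,t:G\to M$ with Hausdorff fibres, a smooth unit map $u:M\to G$ with $s\circ u=t\circ u=\mathrm{id}$ (we write $x$ for $u(x)$ and regard $M\subset G$), a multiplication $(g,h)\mapsto gh$ that is a submersion $\mathcal U\to G$ on an open neighbourhood $\mathcal U\subset G\times_M G=\{(g,h): s(g)=t(h)\}$ of $(G\times_M M)\cup(M\times_M G)$, and a smooth inversion $g\mapsto g^{-1}$, $\mathcal V\to\mathcal V$, on an open neighbourhood $\mathcal V$ of $M$ with $\mathcal V\times_M\mathcal V\subset\mathcal U$, such that $s(gh)=s(h)$, $t(gh)=t(g)$, $g\,s(g)=t(g)\,g=g$, $s(g^{-1})=t(g)$, $t(g^{-1})=s(g)$, $g^{-1}g=s(g)$, $gg^{-1}=t(g)$, and $(gh)k=g(hk)$ on a neighbourhood of $(M\times_M M\times_M G)\cup(M\times_M G\times_M M)\cup(G\times_M M\times_M M)$ in $G\times_M G\times_M G$. It is called * *3-associative* if $(gh)k=g(hk)$ whenever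 both sides are defined; * *inversional* if every $g\in G$ is a well-defined (bracketed) product of elements of $\mathcal V$; * *bi-regular* if for every $g$, right multiplication by $g$ induces an isomorphism $\ker(ds)_{t(g)}\to\ker(ds)_g$ and left multiplication by $g$ induces an isomorphism $\ker(dt)_{s(g)}\to\ker(dt)_g$. $G$ has *products connected to the axes* if for every $(g,h)\in\mathcal U$ there is a path $\gamma$ in $G$ from $t(h)$ to $g$ with $(\gamma(\tau),h)\in\mathcal U$ for all $\tau$, or a path $\gamma$ from $s(g)$ to $h$ with $(g,\gamma(\tau))\in\mathcal U$ for all $\tau$. An *associator* is an element $g\in G$ with $s(g)=t(g)=x$ for which some word $(w_1,\dots,w_k)$ in $G$ can be evaluated, by two choices of brackets, both to $x$ and to $g$. $\mathrm{Assoc}(G)$ is the set of associators; it is *uniformly discrete* if there is an open neighbourhood $U$ of $M$ in $G$ with $U\cap\mathrm{Assoc}(G)=M$. Let $W(G)=\bigsqcup_{k\ge1}\{(w_1,\dots,w_k)\in G^k: s(w_i)=t(w_{i+1})\}$ be the manifold (with components of various dimensions) of well-formed words. The *associative completion* $\mathcal{AC}(G)=W(G)/{\sim}$ is the quotient by the equivalence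 relation generated by the contractions $(w_1,\dots,w_i,w_{i+1},\dots,w_k)\mapsto(w_1,\dots,w_iw_{i+1},\dots,w_k)$, $(w_i,w_{i+1})\in\mathcal U$. It has source $s(w_k)$, target $t(w_1)$, units $[x]$, and composition by juxtaposition. It is called *smooth* if it carries the structure of a (second countable, not necessarily Hausdorff) manifold for which $W(G)\to\mathcal{AC}(G)$ is a submersion. **Theorem.** Let $G$ be a 3-associative, inversional, bi-regular local Lie groupoid whose products are connected to the axes. Then $\mathcal{AC}(G)$ is smooth if and only if $\mathrm{Assoc}(G)$ is uniformly discrete in $G$. Moreover, for any manifold structure on $\mathcal{AC}(G)$ for which $W(G)\to\mathcal{AC}(G)$ is a submersion, $\mathcal{AC}(G)$ is a Lie groupoid over $M$ (with Hausdorff source and target fibres), and the natural map $G\to\mathcal{AC}(G)$, $g\mapsto[g]$, is a local diffeomorphism. -/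

import Mathlib

open Set Manifold Topology
open scoped ContDiff

/-! ### Smooth maps and submersions on subsets of manifolds

Fibre products such as `G ×_M G` and the spaces of well-formed words are embedded submanifolds of
products of manifolds.  Maps defined on them are treated as maps on subsets of the ambient manifold.
-/

section Subsets

variable {E : Type*} [NormedAddCommGroup E] [NormedSpace ℝ E] {H : Type*} [TopologicalSpace H]
  {E' : Type*} [NormedAddCommGroup E'] [NormedSpace ℝ E'] {H' : Type*} [TopologicalSpace H']
  {X : Type*} [TopologicalSpace X] {Y : Type*} [TopologicalSpace Y]

/-- A map `f` defined on a subset `S` of a manifold `X` is smooth: near every point of `S` it is the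
restriction of a smooth map defined on an open subset of `X`.  For an embedded submanifold `S` this
is smoothness of `f` as a map between manifolds. -/
def IsSmoothOnSubset (I : ModelWithCorners ℝ E H) (J : ModelWithCorners ℝ E' H')
    [ChartedSpace H X] [ChartedSpace H' Y] (S : Set X) (f : S → Y) : Prop :=
  ∀ p : S, ∃ (O : Set X) (F : X → Y), IsOpen O ∧ p.1 ∈ O ∧ ContMDiffOn I J ∞ F O ∧
    ∀ x : S, x.1 ∈ O → F x.1 = f x

/-- A map `f` defined on a subset `S` of a manifold `X` is a submersion: it is smooth (with a local
extension `F` near `p`), and its differential at each `p ∈ S` is onto, i.e. every tangent vector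
`η` of `Y` at `f p` is the velocity of `f ∘ c` for a smooth curve `c` in `S` through `p`. -/
def IsSubmersionOnSubset (I : ModelWithCorners ℝ E H) (J : ModelWithCorners ℝ E' H')
    [ChartedSpace H X] [ChartedSpace H' Y] (S : Set X) (f : S → Y) : Prop :=
  ∀ p : S, ∃ (O : Set X) (F : X → Y), IsOpen O ∧ p.1 ∈ O ∧ ContMDiffOn I J ∞ F O ∧
    (∀ x : S, x.1 ∈ O → F x.1 = f x) ∧
    ∀ η : TangentBundle J Y, η.proj = f p →
      ∃ c : ℝ → X, c 0 = p.1 ∧ ContMDiffAt 𝓘(ℝ, ℝ) I ∞ c 0 ∧ (∀ᶠ τ in 𝓝 (0 : ℝ), c τ ∈ S) ∧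
        tangentMap 𝓘(ℝ, ℝ) J (F ∘ c) ⟨0, (1 : ℝ)⟩ = η

end Subsets

/-! ### Lie groupoids -/

/-- The maps `src`, `tgt`, `unit`, `comp`, `inv` make `H` a Lie groupoid over the manifold `M`.
Arrows go from right to left: `comp (a, b)` is defined when `src a = tgt b`.  The space `H` of
arrows need not be Hausdorff, but the source and target fibres are. -/
structure IsLieGroupoid (p d : ℕ) {M H : Type*}
    [TopologicalSpace M] [ChartedSpace (EuclideanSpace ℝ (Fin p)) M] [IsManifold (𝓡 p) ∞ M]
    [T2Space M] [SecondCountableTopology M]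
    [TopologicalSpace H] [ChartedSpace (EuclideanSpace ℝ (Fin d)) H]
    (src tgt : H → M) (unit : M → H) (comp : {q : H × H | src q.1 = tgt q.2} → H)
    (inv : H → H) : Prop where
  isManifold : IsManifold (𝓡 d) ∞ H
  secondCountable : SecondCountableTopology H
  t2_src : ∀ x, T2Space (src ⁻¹' {x})
  t2_tgt : ∀ x, T2Space (tgt ⁻¹' {x})
  -- smoothness of the structure maps
  src_submersion : IsSubmersion (𝓡 d) (𝓡 p) ∞ src
  tgt_submersion : IsSubmersion (𝓡 d) (𝓡 p) ∞ tgt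
  unit_smooth : ContMDiff (𝓡 p) (𝓡 d) ∞ unit
  comp_smooth : IsSmoothOnSubset ((𝓡 d).prod (𝓡 d)) (𝓡 d) {q : H × H | src q.1 = tgt q.2} comp
  inv_smooth : ContMDiff (𝓡 d) (𝓡 d) ∞ inv
  -- groupoid axioms
  src_unit : ∀ x, src (unit x) = x
  tgt_unit : ∀ x, tgt (unit x) = x
  src_comp : ∀ a b (h : src a = tgt b), src (comp ⟨(a, b), h⟩) = src b
  tgt_comp : ∀ a b (h : src a = tgt b), tgt (comp ⟨(a, b), h⟩) = tgt a
  assoc : ∀ a b c (hab : src a = tgt b) (hbc : src b = tgt c)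
    (h₁ : src (comp ⟨(a, b), hab⟩) = tgt c) (h₂ : src a = tgt (comp ⟨(b, c), hbc⟩)),
    comp ⟨(comp ⟨(a, b), hab⟩, c), h₁⟩ = comp ⟨(a, comp ⟨(b, c), hbc⟩), h₂⟩
  comp_unit : ∀ a (h : src a = tgt (unit (src a))), comp ⟨(a, unit (src a)), h⟩ = a
  unit_comp : ∀ a (h : src (unit (tgt a)) = tgt a), comp ⟨(unit (tgt a), a), h⟩ = a
  src_inv : ∀ a, src (inv a) = tgt a
  tgt_inv : ∀ a, tgt (inv a) = src a
  inv_comp : ∀ a (h : src (inv a) = tgt a), comp ⟨(inv a, a), h⟩ = unit (src a)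
  comp_inv : ∀ a (h : src a = tgt (inv a)), comp ⟨(a, inv a), h⟩ = unit (tgt a)

/-! ### Local Lie groupoids -/

/-- A local Lie groupoid with space of arrows `G` (of dimension `n`) over `M` (of dimension `p`).
The partial multiplication and inversion are written as total functions; only their values on the
domains `dom ⊆ G ×_M G` and `invDom ⊆ G` matter.  The manifold `G` need not be Hausdorff, but the
source and target fibres are. -/
structure LocalLieGroupoid (p n : ℕ) (M G : Type*)
    [TopologicalSpace M] [ChartedSpace (EuclideanSpace ℝ (Fin p)) M] [IsManifold (𝓡 p) ∞ M]
    [T2Space M] [SecondCountableTopology M]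
    [TopologicalSpace G] [ChartedSpace (EuclideanSpace ℝ (Fin n)) G] [IsManifold (𝓡 n) ∞ G]
    [SecondCountableTopology G] where
  /-- source -/
  src : G → M
  /-- target -/
  tgt : G → M
  /-- unit map -/
  unit : M → G
  /-- domain of the multiplication -/
  dom : Set (G × G)
  /-- multiplication -/
  mul : G × G → G
  /-- domain of the inversion; its elements are called invertible -/
  invDom : Set G
  /-- inversion -/
  inv : G → G
  t2_src : ∀ x, T2Space (src ⁻¹' {x})
  t2_tgt : ∀ x, T2Space (tgt ⁻¹' {x})
  src_submersion : IsSubmersion (𝓡 n) (𝓡 p) ∞ src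
  tgt_submersion : IsSubmersion (𝓡 n) (𝓡 p) ∞ tgt
  unit_smooth : ContMDiff (𝓡 p) (𝓡 n) ∞ unit
  src_unit : ∀ x, src (unit x) = x
  tgt_unit : ∀ x, tgt (unit x) = x
  -- `dom` is an open neighbourhood of `G ×_M M ∪ M ×_M G` in `G ×_M G`
  dom_composable : ∀ g h, (g, h) ∈ dom → src g = tgt h
  dom_open : ∃ O : Set (G × G), IsOpen O ∧ dom = O ∩ {q | src q.1 = tgt q.2}
  mem_dom_right : ∀ g, (g, unit (src g)) ∈ dom
  mem_dom_left : ∀ g, (unit (tgt g), g) ∈ dom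
  mul_submersion : IsSubmersionOnSubset ((𝓡 n).prod (𝓡 n)) (𝓡 n) dom (fun q => mul q.1)
  invDom_open : IsOpen invDom
  unit_mem_invDom : ∀ x, unit x ∈ invDom
  invDom_dom : ∀ g ∈ invDom, ∀ h ∈ invDom, src g = tgt h → (g, h) ∈ dom
  inv_mem : ∀ g ∈ invDom, inv g ∈ invDom
  inv_smooth : ContMDiffOn (𝓡 n) (𝓡 n) ∞ inv invDom
  src_mul : ∀ g h, (g, h) ∈ dom → src (mul (g, h)) = src h
  tgt_mul : ∀ g h, (g, h) ∈ dom → tgt (mul (g, h)) = tgt g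
  -- local associativity, in a neighbourhood of `M × M × G ∪ M × G × M ∪ G × M × M`
  local_assoc : ∃ O : Set (G × G × G), IsOpen O ∧
    (∀ g, (unit (tgt g), unit (tgt g), g) ∈ O ∧ (unit (tgt g), g, unit (src g)) ∈ O ∧
      (g, unit (src g), unit (src g)) ∈ O) ∧
    ∀ g h k, (g, h, k) ∈ O → src g = tgt h → src h = tgt k →
      (g, h) ∈ dom ∧ (h, k) ∈ dom ∧ (mul (g, h), k) ∈ dom ∧ (g, mul (h, k)) ∈ dom ∧
        mul (mul (g, h), k) = mul (g, mul (h, k))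
  mul_unit : ∀ g, mul (g, unit (src g)) = g
  unit_mul : ∀ g, mul (unit (tgt g), g) = g
  src_inv : ∀ g ∈ invDom, src (inv g) = tgt g
  tgt_inv : ∀ g ∈ invDom, tgt (inv g) = src g
  inv_mul : ∀ g ∈ invDom, mul (inv g, g) = unit (src g)
  mul_inv : ∀ g ∈ invDom, mul (g, inv g) = unit (tgt g)

namespace LocalLieGroupoid

variable {p n : ℕ} {M G : Type*}
  [TopologicalSpace M] [ChartedSpace (EuclideanSpace ℝ (Fin p)) M] [IsManifold (𝓡 p) ∞ M]
  [T2Space M] [SecondCountableTopology M]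
  [TopologicalSpace G] [ChartedSpace (EuclideanSpace ℝ (Fin n)) G] [IsManifold (𝓡 n) ∞ G]
  [SecondCountableTopology G]
  (Γ : LocalLieGroupoid p n M G)

/-- Right-regularity at `g`: right multiplication by `g` induces an isomorphism from `ker ds` at
`t(g)` to `ker ds` at `t(g)g = g`.  (The map `h ↦ hg` is defined on an open part of the source fibre
through the unit `t(g)`; a derivative `D` of it within that set is unique on `ker ds`.) -/
def RightRegularAt (g : G) : Prop :=
  ∃ D, HasMFDerivWithinAt (𝓡 n) (𝓡 n) (fun h => Γ.mul (h, g)) {h | (h, g) ∈ Γ.dom}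
      (Γ.unit (Γ.tgt g)) D ∧
    BijOn D {v | mfderiv (𝓡 n) (𝓡 p) Γ.src (Γ.unit (Γ.tgt g)) v = 0}
      {v | mfderiv (𝓡 n) (𝓡 p) Γ.src (Γ.mul (Γ.unit (Γ.tgt g), g)) v = 0}

/-- Left-regularity at `g`: left multiplication by `g` induces an isomorphism from `ker dt` at
`s(g)` to `ker dt` at `g s(g) = g`. -/
def LeftRegularAt (g : G) : Prop :=
  ∃ D, HasMFDerivWithinAt (𝓡 n) (𝓡 n) (fun h => Γ.mul (g, h)) {h | (g, h) ∈ Γ.dom}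
      (Γ.unit (Γ.src g)) D ∧
    BijOn D {v | mfderiv (𝓡 n) (𝓡 p) Γ.tgt (Γ.unit (Γ.src g)) v = 0}
      {v | mfderiv (𝓡 n) (𝓡 p) Γ.tgt (Γ.mul (g, Γ.unit (Γ.src g))) v = 0}

/-- Bi-regularity: left- and right-regular at every element. -/
def BiRegular : Prop := ∀ g, Γ.LeftRegularAt g ∧ Γ.RightRegularAt g

/-- Products connected to the axes: for every composable `(g, h)`, either `g` can be joined to the
unit `t(h)` by a path of elements that can be multiplied with `h`, or `h` can be joined to the unit
`s(g)` by a path of elements with which `g` can be multiplied. -/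
def ProductsConnectedToAxes : Prop :=
  ∀ g h, (g, h) ∈ Γ.dom →
    (∃ γ : Path (Γ.unit (Γ.tgt h)) g, ∀ τ, (γ τ, h) ∈ Γ.dom) ∨
    (∃ γ : Path (Γ.unit (Γ.src g)) h, ∀ τ, (g, γ τ) ∈ Γ.dom)

/-- `(gh)k = g(hk)` whenever both sides are defined. -/
def ThreeAssociative : Prop :=
  ∀ g h k, (g, h) ∈ Γ.dom → (h, k) ∈ Γ.dom → (Γ.mul (g, h), k) ∈ Γ.dom →
    (g, Γ.mul (h, k)) ∈ Γ.dom → Γ.mul (Γ.mul (g, h), k) = Γ.mul (g, Γ.mul (h, k))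

/-- `Γ.EvaluatesTo w g`: for some way of putting in brackets, all products in the bracketed word `w`
are defined and the result is `g`. -/
inductive EvaluatesTo : List G → G → Prop
  | single (g : G) : EvaluatesTo [g] g
  | mul {w w' : List G} {g h : G} : EvaluatesTo w g → EvaluatesTo w' h → (g, h) ∈ Γ.dom →
      EvaluatesTo (w ++ w') (Γ.mul (g, h))

/-- Every element is a well-defined product of invertible elements. -/
def Inversional : Prop := ∀ g, ∃ w : List G, (∀ a ∈ w, a ∈ Γ.invDom) ∧ Γ.EvaluatesTo w g

/-- The set of associators: elements `g` with equal source and target `x` such that some word can be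
evaluated both to the unit at `x` and to `g`. -/
def Assoc : Set G :=
  {g | ∃ x, Γ.src g = x ∧ Γ.tgt g = x ∧
    ∃ w : List G, Γ.EvaluatesTo w (Γ.unit x) ∧ Γ.EvaluatesTo w g}

/-- The associators are uniformly discrete: some open neighbourhood of the units contains no other
associators. -/
def AssocUniformlyDiscrete : Prop :=
  ∃ O : Set G, IsOpen O ∧ range Γ.unit ⊆ O ∧ O ∩ Γ.Assoc = range Γ.unit

/-! ### The associative completion -/

/-- Well-formed words: non-empty, with `s(wᵢ) = t(wᵢ₊₁)`. -/
def WellFormed (w : List G) : Prop := w ≠ [] ∧ w.IsChain (fun g h => Γ.src g = Γ.tgt h)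

/-- The set `W(G)` of well-formed words. -/
abbrev Word : Type _ := {w : List G // Γ.WellFormed w}

/-- `w'` is obtained from `w` by a contraction. -/
def Contracts (w w' : Γ.Word) : Prop :=
  ∃ (l r : List G) (g h : G), (g, h) ∈ Γ.dom ∧ w.1 = l ++ g :: h :: r ∧
    w'.1 = l ++ Γ.mul (g, h) :: r

/-- The equivalence relation on words generated by contractions and expansions. -/
def wordSetoid : Setoid Γ.Word := Relation.EqvGen.setoid Γ.Contracts

/-- The associative completion `AC(G) = W(G)/∼`. -/
def AC : Type _ := Quotient Γ.wordSetoid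

/-- The class of a word. -/
def cls (w : Γ.Word) : Γ.AC := Quotient.mk Γ.wordSetoid w

/-- The natural map `G → AC(G)`. -/
def toAC (g : G) : Γ.AC := Γ.cls ⟨[g], by simp, by simp⟩

/-- The source of a word is the source of its last letter. -/
def wordSrc (w : Γ.Word) : M := Γ.src (w.1.getLast w.2.1)

/-- The target of a word is the target of its first letter. -/
def wordTgt (w : Γ.Word) : M := Γ.tgt (w.1.head w.2.1)

theorem wordSrc_eq_of_contracts {w w' : Γ.Word} (h : Γ.Contracts w w') :
    Γ.wordSrc w = Γ.wordSrc w' := by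
  obtain ⟨w, hw⟩ := w
  obtain ⟨w', hw'⟩ := w'
  obtain ⟨l, r, a, b, hab, h₁, h₂⟩ := h
  dsimp only at h₁ h₂
  subst h₁ h₂
  cases r with
  | nil => simp [wordSrc, Γ.src_mul a b hab]
  | cons c r => simp [wordSrc]

theorem wordTgt_eq_of_contracts {w w' : Γ.Word} (h : Γ.Contracts w w') :
    Γ.wordTgt w = Γ.wordTgt w' := by
  obtain ⟨w, hw⟩ := w
  obtain ⟨w', hw'⟩ := w'
  obtain ⟨l, r, a, b, hab, h₁, h₂⟩ := h
  dsimp only at h₁ h₂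
  subst h₁ h₂
  cases l with
  | nil => simp [wordTgt, Γ.tgt_mul a b hab]
  | cons c l => simp [wordTgt]

theorem wordSrc_eq_of_rel {w w' : Γ.Word} (h : Relation.EqvGen Γ.Contracts w w') :
    Γ.wordSrc w = Γ.wordSrc w' := by
  induction h with
  | rel _ _ h => exact Γ.wordSrc_eq_of_contracts h
  | refl _ => rfl
  | symm _ _ _ ih => exact ih.symm
  | trans _ _ _ _ _ ih₁ ih₂ => exact ih₁.trans ih₂

theorem wordTgt_eq_of_rel {w w' : Γ.Word} (h : Relation.EqvGen Γ.Contracts w w') :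
    Γ.wordTgt w = Γ.wordTgt w' := by
  induction h with
  | rel _ _ h => exact Γ.wordTgt_eq_of_contracts h
  | refl _ => rfl
  | symm _ _ _ ih => exact ih.symm
  | trans _ _ _ _ _ ih₁ ih₂ => exact ih₁.trans ih₂

/-- The source map of `AC(G)`. -/
def acSrc : Γ.AC → M := Quotient.lift Γ.wordSrc fun _ _ h => Γ.wordSrc_eq_of_rel h

/-- The target map of `AC(G)`. -/
def acTgt : Γ.AC → M := Quotient.lift Γ.wordTgt fun _ _ h => Γ.wordTgt_eq_of_rel h

/-- The unit map of `AC(G)`. -/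
def acUnit (x : M) : Γ.AC := Γ.toAC (Γ.unit x)

/-- Juxtaposition of words. -/
def append (w w' : Γ.Word) (h : Γ.wordSrc w = Γ.wordTgt w') : Γ.Word :=
  ⟨w.1 ++ w'.1, by simp [w.2.1], List.isChain_append.2 ⟨w.2.2, w'.2.2, by
    intro a ha b hb
    have h₁ : a = w.1.getLast w.2.1 := by
      rw [List.getLast?_eq_some_getLast w.2.1] at ha
      exact (Option.some.inj ha).symm
    have h₂ : b = w'.1.head w'.2.1 := by
      rw [List.head?_eq_some_head w'.2.1] at hb
      exact (Option.some.inj hb).symm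
    subst h₁ h₂
    exact h⟩⟩

theorem cls_append_left {w₁ w₂ : Γ.Word} (e : Relation.EqvGen Γ.Contracts w₁ w₂) (w : Γ.Word)
    (h₁ : Γ.wordSrc w₁ = Γ.wordTgt w) (h₂ : Γ.wordSrc w₂ = Γ.wordTgt w) :
    Γ.cls (Γ.append w₁ w h₁) = Γ.cls (Γ.append w₂ w h₂) := by
  induction e with
  | rel w₁ w₂ e =>
    obtain ⟨l, r, a, b, hab, e₁, e₂⟩ := e
    exact Quotient.sound (s := Γ.wordSetoid) (Relation.EqvGen.rel _ _
      ⟨l, r ++ w.1, a, b, hab, by simp [append, e₁], by simp [append, e₂]⟩)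
  | refl _ => rfl
  | symm _ _ _ ih => exact (ih h₂ h₁).symm
  | trans _ y _ e _ ih₁ ih₂ =>
    have hy : Γ.wordSrc y = Γ.wordTgt w := (Γ.wordSrc_eq_of_rel e).symm.trans h₁
    exact (ih₁ h₁ hy).trans (ih₂ hy h₂)

theorem cls_append_right {w₁ w₂ : Γ.Word} (e : Relation.EqvGen Γ.Contracts w₁ w₂) (w : Γ.Word)
    (h₁ : Γ.wordSrc w = Γ.wordTgt w₁) (h₂ : Γ.wordSrc w = Γ.wordTgt w₂) :
    Γ.cls (Γ.append w w₁ h₁) = Γ.cls (Γ.append w w₂ h₂) := by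
  induction e with
  | rel w₁ w₂ e =>
    obtain ⟨l, r, a, b, hab, e₁, e₂⟩ := e
    exact Quotient.sound (s := Γ.wordSetoid) (Relation.EqvGen.rel _ _
      ⟨w.1 ++ l, r, a, b, hab, by simp [append, e₁], by simp [append, e₂]⟩)
  | refl _ => rfl
  | symm _ _ _ ih => exact (ih h₂ h₁).symm
  | trans _ y _ e _ ih₁ ih₂ =>
    have hy : Γ.wordSrc w = Γ.wordTgt y := h₁.trans (Γ.wordTgt_eq_of_rel e)
    exact (ih₁ h₁ hy).trans (ih₂ hy h₂)

theorem cls_out (a : Γ.AC) : Γ.cls (Quotient.out a) = a := Quotient.out_eq a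

/-- The composition of `AC(G)`: juxtaposition of representatives (see `acComp_cls`). -/
noncomputable def acComp (q : {q : Γ.AC × Γ.AC | Γ.acSrc q.1 = Γ.acTgt q.2}) : Γ.AC :=
  Γ.cls (Γ.append (Quotient.out q.1.1) (Quotient.out q.1.2) (by
    have h : Γ.acSrc q.1.1 = Γ.acTgt q.1.2 := q.2
    rw [← Γ.cls_out q.1.1, ← Γ.cls_out q.1.2] at h
    exact h))

theorem acComp_cls (w w' : Γ.Word) (h : Γ.wordSrc w = Γ.wordTgt w') :
    Γ.acComp ⟨(Γ.cls w, Γ.cls w'), h⟩ = Γ.cls (Γ.append w w' h) := by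
  have e : Relation.EqvGen Γ.Contracts (Quotient.out (Γ.cls w)) w :=
    Quotient.mk_out (s := Γ.wordSetoid) w
  have e' : Relation.EqvGen Γ.Contracts (Quotient.out (Γ.cls w')) w' :=
    Quotient.mk_out (s := Γ.wordSetoid) w'
  have h₁ : Γ.wordSrc (Quotient.out (Γ.cls w)) = Γ.wordTgt w' := (Γ.wordSrc_eq_of_rel e).trans h
  exact (Γ.cls_append_right e' _ _ h₁).trans (Γ.cls_append_left e w' h₁ h)

/-! ### Smooth structures on the associative completion -/

/-- The manifold of well-formed words of length `k + 1`, as a subset of `G^(k+1)`. -/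
def words (k : ℕ) : Set (Fin (k + 1) → G) := {w | Γ.WellFormed (List.ofFn w)}

/-- The quotient map `W(G) → AC(G)` on words of length `k + 1`. -/
def wordClass (k : ℕ) (w : Γ.words k) : Γ.AC := Γ.cls ⟨List.ofFn w.1, w.2⟩

/-- A smooth structure on `AC(G)` as a quotient of the manifold `W(G)` (whose components have various
dimensions): the quotient map is a submersion on words of each length. -/
structure IsSmoothQuotient (d : ℕ) [TopologicalSpace Γ.AC]
    [ChartedSpace (EuclideanSpace ℝ (Fin d)) Γ.AC] : Prop where
  isManifold : IsManifold (𝓡 d) ∞ Γ.AC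
  secondCountable : SecondCountableTopology Γ.AC
  submersion : ∀ k, IsSubmersionOnSubset (ModelWithCorners.pi fun _ : Fin (k + 1) => 𝓡 n) (𝓡 d)
    (Γ.words k) (Γ.wordClass k)

/-- `AC(G)` is smooth: it has a smooth structure as a quotient of `W(G)`. -/
def ACIsSmooth : Prop :=
  ∃ (d : ℕ) (_ : TopologicalSpace Γ.AC) (_ : ChartedSpace (EuclideanSpace ℝ (Fin d)) Γ.AC),
    Γ.IsSmoothQuotient d

end LocalLieGroupoid

/-! ### Maps that are smooth near a point -/

/-! Write `[g]` for the class of `g` in `AC(G)`. Everything turns on how far `G → AC(G)` is from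
being injective, and on the fact that local computations in `G` determine `AC(G)` near every point.

Algebra. Two equivalent words are joined by a zigzag of contractions and expansions. An expansion of
`gh` into `(g, h)` can be imitated by inserting words that evaluate to units next to `gh` and then
only contracting (`exists_reduces_pair`). To see this, move along the path that joins the product to
an axis: the property is trivial at the unit, and it is locally constant because a nearby element
differs by an invertible factor near a unit. Hence equivalent words have a common expansion
(`exists_common_expansion`), so `[g] = [h]` exactly when one word evaluates to both `g` and `h`. In
particular the elements identified with units are the associators.

From discreteness to smoothness. Bi-regularity and the inverse function theorem give smooth division
near units (`exists_division`). If `g` and `g'` are close to a unit and `[g] = [g']`, their quotient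
is an associator close to the units; uniform discreteness makes it a unit, so `G → AC(G)` is
injective near units. Contractions and expansions extend to smooth families of words
(`IsFamily.exists_of_equivalent`). Near the class of a word `w`, the space `AC(G)` is therefore
parametrised by classes of `a w(x)`, with `x` the source, `w(x)` a smooth family through `w`, and
`a` near a unit (`exists_plot`). These parametrisations are the charts.

From smoothness to discreteness. For a smooth structure, `G → AC(G)` is a submersion. Its fibres are
countable (`countable_toAC_fibre`): there are countably many pairs of bracketings, and once one
evaluation of a word is fixed, another evaluation is locally constant on a second countable space. A
submersion with countable fibres is a local diffeomorphism, hence locally injective, and associators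
near units are units.

Groupoid. The parametrisations are local diffeomorphisms for any smooth structure, so points of
`AC(G)` are locally represented by smooth families of words, and juxtaposition and inversion of
families are smooth. Hausdorffness of the fibres is translated to a unit and read off in `G`.

Smoothness is phrased on a neighbourhood (`SmoothNear`), since `ContMDiffAt` of order `∞` allows the
neighbourhood to shrink with the order of differentiability. -/

section SmoothNear

open Filter

variable {E : Type*} [NormedAddCommGroup E] [NormedSpace ℝ E] {H : Type*} [TopologicalSpace H]
  {E' : Type*} [NormedAddCommGroup E'] [NormedSpace ℝ E'] {H' : Type*} [TopologicalSpace H']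
  {E'' : Type*} [NormedAddCommGroup E''] [NormedSpace ℝ E''] {H'' : Type*} [TopologicalSpace H'']
  {X : Type*} [TopologicalSpace X] {Y : Type*} [TopologicalSpace Y] {Z : Type*} [TopologicalSpace Z]
  {I : ModelWithCorners ℝ E H} {J : ModelWithCorners ℝ E' H'} {K : ModelWithCorners ℝ E'' H''}
  [ChartedSpace H X] [ChartedSpace H' Y] [ChartedSpace H'' Z]

variable (I J) in
/-- A map is smooth near `x` if it is smooth on a neighbourhood of `x`. -/
def SmoothNear (f : X → Y) (x : X) : Prop :=
  ∀ᶠ x' in 𝓝 x, ContMDiffAt I J ∞ f x'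

namespace SmoothNear

theorem contMDiffAt {f : X → Y} {x : X} (hf : SmoothNear I J f x) : ContMDiffAt I J ∞ f x :=
  Eventually.self_of_nhds hf

theorem continuousAt {f : X → Y} {x : X} (hf : SmoothNear I J f x) : ContinuousAt f x :=
  hf.contMDiffAt.continuousAt

theorem tendsto {f : X → Y} {x : X} {y : Y} (hf : SmoothNear I J f x) (h : f x = y) :
    Tendsto f (𝓝 x) (𝓝 y) := h ▸ hf.continuousAt

theorem mdifferentiableAt {f : X → Y} {x : X} (hf : SmoothNear I J f x) :
    MDifferentiableAt I J f x :=
  hf.contMDiffAt.mdifferentiableAt (by simp)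

theorem eventually {f : X → Y} {x : X} (hf : SmoothNear I J f x) :
    ∀ᶠ x' in 𝓝 x, SmoothNear I J f x' :=
  eventually_eventually_nhds.2 hf

theorem congr {f g : X → Y} {x : X} (hf : SmoothNear I J f x) (h : ∀ᶠ x' in 𝓝 x, g x' = f x') :
    SmoothNear I J g x := by
  filter_upwards [hf, eventually_eventually_nhds.2 h] with x' h₁ h₂
  exact h₁.congr_of_eventuallyEq h₂

theorem of_contMDiff {f : X → Y} (hf : ContMDiff I J ∞ f) (x : X) : SmoothNear I J f x :=
  Eventually.of_forall fun x' => hf x'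

theorem of_contMDiffOn {f : X → Y} {O : Set X} {x : X} (hf : ContMDiffOn I J ∞ f O) (hO : IsOpen O)
    (hx : x ∈ O) : SmoothNear I J f x := by
  filter_upwards [hO.mem_nhds hx] with x' h
  exact hf.contMDiffAt (hO.mem_nhds h)

theorem comp {f : X → Y} {g : Y → Z} {x : X} {y : Y} (hg : SmoothNear J K g y)
    (hf : SmoothNear I J f x) (h : f x = y) : SmoothNear I K (fun x' => g (f x')) x := by
  filter_upwards [hf, (hf.tendsto h).eventually hg] with x' h₁ h₂
  exact h₂.comp x' h₁

theorem prodMk {f : X → Y} {g : X → Z} {x : X} (hf : SmoothNear I J f x)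
    (hg : SmoothNear I K g x) : SmoothNear I (J.prod K) (fun x' => (f x', g x')) x := by
  filter_upwards [hf, hg] with x' h₁ h₂
  exact h₁.prodMk h₂

theorem const (y : Y) (x : X) : SmoothNear I J (fun _ : X => y) x := of_contMDiff contMDiff_const x

theorem id (x : X) : SmoothNear I I (fun x' : X => x') x := of_contMDiff contMDiff_id x

theorem fst (q : X × Y) : SmoothNear (I.prod J) I Prod.fst q := of_contMDiff contMDiff_fst q

theorem snd (q : X × Y) : SmoothNear (I.prod J) J Prod.snd q := of_contMDiff contMDiff_snd q

theorem vec {F F' : Type*} [NormedAddCommGroup F] [NormedSpace ℝ F] [NormedAddCommGroup F']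
    [NormedSpace ℝ F'] {f : F → F'} (hf : ContDiff ℝ ∞ f) (x : F) :
    SmoothNear 𝓘(ℝ, F) 𝓘(ℝ, F') f x :=
  of_contMDiff hf.contMDiff x

theorem extChartAt [IsManifold I ∞ X] (x : X) : SmoothNear I 𝓘(ℝ, E) (extChartAt I x) x := by
  refine of_contMDiffOn (O := (chartAt H x).source) ?_ (chartAt H x).open_source
    (mem_chart_source H x)
  exact contMDiffOn_extChartAt

theorem extChartAt_symm [I.Boundaryless] [IsManifold I ∞ X] (x : X) :
    SmoothNear 𝓘(ℝ, E) I (_root_.extChartAt I x).symm (_root_.extChartAt I x x) :=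
  of_contMDiffOn (contMDiffOn_extChartAt_symm x) (isOpen_extChartAt_target x)
    (mem_extChartAt_target x)

end SmoothNear

variable {ι : Type} [Fintype ι]

/-- In the product chart at `w` and the chart at `w i`, the projection becomes the linear coordinate
projection on the target of the product chart. -/
theorem contMDiff_pi_apply (i : ι) :
    ContMDiff (ModelWithCorners.pi fun _ : ι => I) I ∞ (fun w : ι → X => w i) := by
  intro w
  rw [contMDiffAt_iff]
  refine ⟨continuousAt_apply i w, ?_⟩
  have hc : ContDiffWithinAt ℝ ∞ (fun z : ι → E => z i)
      (range (ModelWithCorners.pi fun _ : ι => I))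
      (extChartAt (ModelWithCorners.pi fun _ : ι => I) w w) :=
    (contDiff_apply ℝ E i).contDiffWithinAt
  refine hc.congr_of_eventuallyEq_of_mem ?_ (mem_range_self _)
  filter_upwards [extChartAt_target_mem_nhdsWithin w] with z hz
  have hz' : z i ∈ (extChartAt I (w i)).target := by
    have : z ∈ (extChartAt (ModelWithCorners.pi fun _ : ι => I) w).target := hz
    simp only [extChartAt, OpenPartialHomeomorph.extend, PartialEquiv.trans_target,
      ModelWithCorners.target_eq, ModelWithCorners.toPartialEquiv_coe_symm, mem_inter_iff,
      mem_preimage] at this ⊢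
    obtain ⟨⟨z', rfl⟩, h₂⟩ := this
    refine ⟨⟨z' i, rfl⟩, ?_⟩
    exact h₂ i (mem_univ i)
  exact (extChartAt I (w i)).right_inv hz'

theorem contMDiffAt_pi {f : X → ι → Y} {x : X} (hf : ∀ i, ContMDiffAt I J ∞ (fun x => f x i) x) :
    ContMDiffAt I (ModelWithCorners.pi fun _ : ι => J) ∞ f x := by
  rw [contMDiffAt_iff]
  refine ⟨continuousAt_pi.2 fun i => (hf i).continuousAt, ?_⟩
  have h : ∀ i, ContDiffWithinAt ℝ ∞ (extChartAt J (f x i) ∘ (fun x => f x i) ∘ (extChartAt I x).symm)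
      (range I) (extChartAt I x x) := fun i => (contMDiffAt_iff.1 (hf i)).2
  exact contDiffWithinAt_pi.2 h

namespace SmoothNear

theorem apply (w : ι → X) (i : ι) :
    SmoothNear (ModelWithCorners.pi fun _ : ι => I) I (fun w : ι → X => w i) w :=
  of_contMDiff (contMDiff_pi_apply i) w

theorem pi {f : X → ι → Y} {x : X} (hf : ∀ i, SmoothNear I J (fun x => f x i) x) :
    SmoothNear I (ModelWithCorners.pi fun _ : ι => J) f x := by
  filter_upwards [eventually_all.2 hf] with x' h
  exact contMDiffAt_pi h

end SmoothNear

end SmoothNear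

/-! ### The inverse function theorem -/

section InverseFunction

open Filter

variable {E : Type*} [NormedAddCommGroup E] [NormedSpace ℝ E]
  {E' : Type*} [NormedAddCommGroup E'] [NormedSpace ℝ E']

theorem exists_local_inverse_vec [FiniteDimensional ℝ E] {f : E → E'} {x : E}
    (hf : ∀ᶠ z in 𝓝 x, ContDiffAt ℝ ∞ f z) (hbij : Function.Bijective (fderiv ℝ f x)) :
    ∃ g : E' → E, (∀ᶠ y in 𝓝 (f x), ContDiffAt ℝ ∞ g y) ∧ g (f x) = x ∧
      (∀ᶠ z in 𝓝 x, g (f z) = z) ∧ ∀ᶠ y in 𝓝 (f x), f (g y) = y := by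
  have : CompleteSpace E := FiniteDimensional.complete ℝ E
  have hx := hf.self_of_nhds
  let e : E ≃L[ℝ] E' := (LinearEquiv.ofBijective (fderiv ℝ f x : E →ₗ[ℝ] E') hbij).toContinuousLinearEquiv
  have he : (e : E →L[ℝ] E') = fderiv ℝ f x := by ext v; rfl
  have hd : HasFDerivAt f (e : E →L[ℝ] E') x := by
    rw [he]; exact (hx.differentiableAt (by simp)).hasFDerivAt
  let φ := hx.toOpenPartialHomeomorph f hd (by simp)
  have hφ : ⇑φ = f := rfl
  have hxs : x ∈ φ.source := hx.mem_toOpenPartialHomeomorph_source hd (by simp)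
  have hφx : f x ∈ φ.target := hx.image_mem_toOpenPartialHomeomorph_target hd (by simp)
  have hsx : φ.symm (f x) = x := φ.left_inv hxs
  have hcont : ContinuousAt φ.symm (f x) := φ.continuousAt_symm hφx
  -- Invertible derivatives form an open set, so the inverse is smooth near `f x` and not only at
  -- it.
  have hinv : ∀ᶠ z in 𝓝 x, ∃ e' : E ≃L[ℝ] E', (e' : E →L[ℝ] E') = fderiv ℝ f z := by
    have h1 : ContinuousAt (fderiv ℝ f) x :=
      (hx.fderiv_right (m := ∞) (by simp)).continuousAt
    have h2 : range ((↑) : (E ≃L[ℝ] E') → E →L[ℝ] E') ∈ 𝓝 (fderiv ℝ f x) :=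
      he ▸ ContinuousLinearEquiv.nhds e
    exact h1.eventually h2
  refine ⟨φ.symm, ?_, hsx, ?_, ?_⟩
  · have h1 := hcont.tendsto
    rw [hsx] at h1
    filter_upwards [h1.eventually hinv, h1.eventually hf, φ.open_target.mem_nhds hφx]
      with y ⟨e', he'⟩ h3 h4
    refine φ.contDiffAt_symm (f₀' := e') h4 ?_ h3
    rw [he', hφ]
    exact (h3.differentiableAt (by simp)).hasFDerivAt
  · filter_upwards [φ.open_source.mem_nhds hxs] with z hz using φ.left_inv hz
  · filter_upwards [φ.open_target.mem_nhds hφx] with z hz using φ.right_inv hz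

variable {H : Type*} [TopologicalSpace H] {H' : Type*} [TopologicalSpace H']
  {X : Type*} [TopologicalSpace X] {Y : Type*} [TopologicalSpace Y]
  {I : ModelWithCorners ℝ E H} {J : ModelWithCorners ℝ E' H'}
  [ChartedSpace H X] [ChartedSpace H' Y]

variable (I J) in
/-- A map has a smooth local inverse at `x`. -/
def HasSmoothLocalInverseAt (f : X → Y) (x : X) : Prop :=
  ∃ g : Y → X, SmoothNear J I g (f x) ∧ g (f x) = x ∧
      (∀ᶠ z in 𝓝 x, g (f z) = z) ∧ ∀ᶠ y in 𝓝 (f x), f (g y) = y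

theorem smoothNear_iff_contDiffAt {f : E → E'} {x : E} :
    SmoothNear 𝓘(ℝ, E) 𝓘(ℝ, E') f x ↔ ∀ᶠ z in 𝓝 x, ContDiffAt ℝ ∞ f z := by
  simp only [SmoothNear, contMDiffAt_iff_contDiffAt]

/-- The expression of a map in charts, with its smoothness and derivative. -/
theorem SmoothNear.written [I.Boundaryless] [IsManifold I ∞ X] [IsManifold J ∞ Y] {f : X → Y}
    {x : X} (hf : SmoothNear I J f x) :
    SmoothNear 𝓘(ℝ, E) 𝓘(ℝ, E') (fun z => _root_.extChartAt J (f x) (f ((_root_.extChartAt I x).symm z)))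
      (_root_.extChartAt I x x) ∧
    fderiv ℝ (fun z => _root_.extChartAt J (f x) (f ((_root_.extChartAt I x).symm z))) (_root_.extChartAt I x x) =
      mfderiv I J f x := by
  have h0 : (_root_.extChartAt I x).symm (_root_.extChartAt I x x) = x := extChartAt_to_inv x
  constructor
  · exact (SmoothNear.extChartAt (I := J) (f x)).comp
      (hf.comp (SmoothNear.extChartAt_symm (I := I) x) h0) (by rw [h0])
  · let D : E →L[ℝ] E' := mfderiv I J f x
    have h : HasFDerivWithinAt (writtenInExtChartAt I J x f) D (range I)
      (_root_.extChartAt I x x) := hf.mdifferentiableAt.hasMFDerivAt.2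
    rw [I.range_eq_univ] at h
    exact h.hasFDerivAt_of_univ.fderiv

theorem SmoothNear.hasSmoothLocalInverseAt [FiniteDimensional ℝ E] [I.Boundaryless] [J.Boundaryless]
    [IsManifold I ∞ X] [IsManifold J ∞ Y] {f : X → Y} {x : X} (hf : SmoothNear I J f x)
    (hbij : Function.Bijective (mfderiv I J f x)) : HasSmoothLocalInverseAt I J f x := by
  obtain ⟨h1, h2⟩ := hf.written
  have h0 : (_root_.extChartAt I x).symm (_root_.extChartAt I x x) = x := extChartAt_to_inv x
  have h0' : (_root_.extChartAt J (f x)).symm (_root_.extChartAt J (f x) (f x)) = f x :=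
    extChartAt_to_inv (f x)
  obtain ⟨g, g1, g2, g3, g4⟩ := exists_local_inverse_vec (smoothNear_iff_contDiffAt.1 h1)
    (by rw [h2]; exact hbij)
  simp only [h0] at g1 g2 g3 g4
  have hcx := (SmoothNear.extChartAt (I := I) x).continuousAt
  have hcy := (SmoothNear.extChartAt (I := J) (f x)).continuousAt
  have hgs := smoothNear_iff_contDiffAt.2 g1
  have hG : SmoothNear J I (fun y => (_root_.extChartAt I x).symm (g (_root_.extChartAt J (f x) y))) (f x) :=
    (SmoothNear.extChartAt_symm (I := I) x).comp
      (hgs.comp (SmoothNear.extChartAt (I := J) (f x)) rfl) g2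
  have hGx : (_root_.extChartAt I x).symm (g (_root_.extChartAt J (f x) (f x))) = x := by rw [g2, h0]
  refine ⟨_, hG, hGx, ?_, ?_⟩
  · filter_upwards [hcx.eventually g3, extChartAt_source_mem_nhds (I := I) x] with z hz hz'
    rw [(_root_.extChartAt I x).left_inv hz'] at hz
    rw [hz, (_root_.extChartAt I x).left_inv hz']
  · have hfG : Tendsto (fun y => f ((_root_.extChartAt I x).symm (g (_root_.extChartAt J (f x) y))))
        (𝓝 (f x)) (𝓝 (f x)) := hf.continuousAt.tendsto.comp (hG.tendsto hGx)
    filter_upwards [hcy.eventually g4, hfG.eventually (extChartAt_source_mem_nhds (I := J) (f x)),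
      extChartAt_source_mem_nhds (I := J) (f x)] with y h3 h4 h5
    exact (_root_.extChartAt J (f x)).injOn h4 h5 h3

/-- A smooth map with a smooth local inverse is given near the point by a partial diffeomorphism. -/
theorem HasSmoothLocalInverseAt.exists_openPartialHomeomorph {f : X → Y} {x : X}
    (h : HasSmoothLocalInverseAt I J f x) (hf : SmoothNear I J f x) :
    ∃ φ : OpenPartialHomeomorph X Y, ⇑φ = f ∧ x ∈ φ.source ∧ ContMDiffOn I J ∞ φ φ.source ∧
      ContMDiffOn J I ∞ φ.symm φ.target := by
  obtain ⟨g, g1, g2, g3, g4⟩ := h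
  obtain ⟨O, hO, oO, xO⟩ := eventually_nhds_iff.1 (hf.and g3)
  obtain ⟨V, hV, oV, xV⟩ := eventually_nhds_iff.1 (g1.and g4)
  have cf : ContinuousOn f O := fun z hz => (hO z hz).1.continuousAt.continuousWithinAt
  have cg : ContinuousOn g V := fun z hz => (hV z hz).1.continuousAt.continuousWithinAt
  refine ⟨{ toFun := f, invFun := g, source := O ∩ f ⁻¹' V, target := V ∩ g ⁻¹' O,
            map_source' := ?_, map_target' := ?_, left_inv' := ?_, right_inv' := ?_,
            open_source := cf.isOpen_inter_preimage oO oV,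
            open_target := cg.isOpen_inter_preimage oV oO,
            continuousOn_toFun := cf.mono inter_subset_left,
            continuousOn_invFun := cg.mono inter_subset_left }, rfl, ⟨xO, xV⟩, ?_, ?_⟩
  · intro z hz
    exact ⟨hz.2, by simpa [(hO z hz.1).2] using hz.1⟩
  · intro z hz
    exact ⟨hz.2, by simpa [(hV z hz.1).2] using hz.1⟩
  · exact fun z hz => (hO z hz.1).2
  · exact fun z hz => (hV z hz.1).2
  · exact fun z hz => (hO z hz.1).1.contMDiffWithinAt
  · exact fun z hz => (hV z hz.1).1.contMDiffWithinAt

theorem HasSmoothLocalInverseAt.isLocalDiffeomorphAt {f : X → Y} {x : X}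
    (h : HasSmoothLocalInverseAt I J f x) (hf : SmoothNear I J f x) :
    IsLocalDiffeomorphAt I J ∞ f x := by
  obtain ⟨φ, h1, h2, h3, h4⟩ := h.exists_openPartialHomeomorph hf
  exact ⟨⟨φ.toPartialEquiv, φ.open_source, φ.open_target, h3, h4⟩, h2, fun z _ => by
    rw [← h1]; rfl⟩

end InverseFunction

/-! ### Local trivialisations of submersions, and division -/

section Submersions

open Filter

variable {E : Type*} [NormedAddCommGroup E] [NormedSpace ℝ E]
  {E₀ : Type*} [NormedAddCommGroup E₀] [NormedSpace ℝ E₀]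
  {F : Type*} [NormedAddCommGroup F] [NormedSpace ℝ F]
  {G : Type*} [TopologicalSpace G] [ChartedSpace E G]
  {M : Type*} [TopologicalSpace M] [ChartedSpace E₀ M]

variable (E E₀) in
/-- A local trivialisation `(A, v)` of a map `s` near `g`. -/
structure IsLocalTrivialisation (s : G → M) (g : G) (A : M × F → G) (v : G → F) : Prop where
  smooth_fst : SmoothNear 𝓘(ℝ, E) 𝓘(ℝ, E₀) s g
  smooth_snd : SmoothNear 𝓘(ℝ, E) 𝓘(ℝ, F) v g
  smooth_inv : SmoothNear (𝓘(ℝ, E₀).prod 𝓘(ℝ, F)) 𝓘(ℝ, E) A (s g, v g)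
  left_inv : ∀ᶠ g' in 𝓝 g, A (s g', v g') = g'
  right_inv : ∀ᶠ q in 𝓝 (s g, v g), s (A q) = q.1 ∧ v (A q) = q.2

/-- In the charts of the normal form, `s` is the first component of `h.equiv`. The second component
serves as the fibre coordinate `v`, and `A` reassembles a point from its image and its fibre
coordinate. -/
theorem Manifold.IsSubmersionAtOfComplement.exists_isLocalTrivialisation
    [IsManifold 𝓘(ℝ, E) ∞ G] [IsManifold 𝓘(ℝ, E₀) ∞ M] {s : G → M} {g : G}
    (h : IsSubmersionAtOfComplement F 𝓘(ℝ, E) 𝓘(ℝ, E₀) ∞ s g) :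
    ∃ (A : M × F → G) (v : G → F), IsLocalTrivialisation E E₀ s g A v := by
  have hw : ∀ z ∈ h.domChart.target, h.codChart (s (h.domChart.symm z)) = (h.equiv z).1 := by
    intro z hz
    have := h.writtenInCharts (show z ∈ (h.domChart.extend 𝓘(ℝ, E)).target by simpa using hz)
    simpa using this
  have hw' : ∀ g' ∈ h.domChart.source, h.codChart (s g') = (h.equiv (h.domChart g')).1 := by
    intro g' hg'
    have := hw _ (h.domChart.map_source hg')
    rwa [h.domChart.left_inv hg'] at this
  have hg := h.mem_domChart_source
  have hsg := h.mem_codChart_source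
  have hφ : SmoothNear 𝓘(ℝ, E) 𝓘(ℝ, E) h.domChart g :=
    .of_contMDiffOn (contMDiffOn_of_mem_maximalAtlas h.domChart_mem_maximalAtlas)
      h.domChart.open_source hg
  have hφi : SmoothNear 𝓘(ℝ, E) 𝓘(ℝ, E) h.domChart.symm (h.domChart g) :=
    .of_contMDiffOn (contMDiffOn_symm_of_mem_maximalAtlas h.domChart_mem_maximalAtlas)
      h.domChart.open_target (h.domChart.map_source hg)
  have hψ : SmoothNear 𝓘(ℝ, E₀) 𝓘(ℝ, E₀) h.codChart (s g) :=
    .of_contMDiffOn (contMDiffOn_of_mem_maximalAtlas h.codChart_mem_maximalAtlas)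
      h.codChart.open_source hsg
  have hs : SmoothNear 𝓘(ℝ, E) 𝓘(ℝ, E₀) s g :=
    .of_contMDiffOn h.contMDiffOn h.domChart.open_source hg
  let v : G → F := fun g' => (h.equiv (h.domChart g')).2
  let A₀ : M × F → E := fun q => h.equiv.symm (h.codChart q.1, q.2)
  have hA₀g : A₀ (s g, v g) = h.domChart g := by
    simp only [A₀, v, hw' g hg, Prod.mk.eta, ContinuousLinearEquiv.symm_apply_apply]
  have hA₀ : SmoothNear (𝓘(ℝ, E₀).prod 𝓘(ℝ, F)) 𝓘(ℝ, E) A₀ (s g, v g) := by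
    have h1 : SmoothNear (𝓘(ℝ, E₀).prod 𝓘(ℝ, F)) 𝓘(ℝ, E₀ × F)
        (fun q : M × F => (h.codChart q.1, q.2)) (s g, v g) := by
      rw [modelWithCornersSelf_prod, ← chartedSpaceSelf_prod]
      exact (hψ.comp (.fst _) rfl).prodMk (.snd _)
    exact (SmoothNear.vec h.equiv.symm.contDiff _).comp h1 rfl
  refine ⟨fun q => h.domChart.symm (A₀ q), v, hs, ?_, hφi.comp hA₀ hA₀g, ?_, ?_⟩
  · exact (SmoothNear.vec (contDiff_snd.comp h.equiv.contDiff) _).comp hφ rfl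
  · filter_upwards [h.domChart.open_source.mem_nhds hg] with g' hg'
    simp only [A₀, v, hw' g' hg', Prod.mk.eta, ContinuousLinearEquiv.symm_apply_apply,
      h.domChart.left_inv hg']
  · have h1 : Tendsto A₀ (𝓝 (s g, v g)) (𝓝 (h.domChart g)) := hA₀.tendsto hA₀g
    have h2 := h1.eventually (h.domChart.open_target.mem_nhds (h.domChart.map_source hg))
    have h3 : ∀ᶠ q : M × F in 𝓝 (s g, v g), q.1 ∈ h.codChart.source :=
      continuousAt_fst.eventually (h.codChart.open_source.mem_nhds hsg)
    filter_upwards [h2, h3] with q h2 h3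
    constructor
    · have h4 := h.source_subset_preimage_source (h.domChart.map_target h2)
      refine h.codChart.injOn h4 h3 ?_
      rw [hw _ h2]
      simp [A₀]
    · simp only [v, h.domChart.right_inv h2]
      simp [A₀]

namespace IsLocalTrivialisation

variable {s : G → M} {g : G} {A : M × F → G} {v : G → F}

theorem apply_self (h : IsLocalTrivialisation E E₀ s g A v) : A (s g, v g) = g :=
  h.left_inv.self_of_nhds

/-- Local sections of a submersion, depending smoothly on the point through which they pass. -/
theorem exists_section (h : IsLocalTrivialisation E E₀ s g A v) :
    ∃ S : G × M → G, SmoothNear (𝓘(ℝ, E).prod 𝓘(ℝ, E₀)) 𝓘(ℝ, E) S (g, s g) ∧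
      (∀ᶠ g' in 𝓝 g, S (g', s g') = g') ∧ ∀ᶠ q in 𝓝 (g, s g), s (S q) = q.2 := by
  have h1 : SmoothNear (𝓘(ℝ, E).prod 𝓘(ℝ, E₀)) (𝓘(ℝ, E₀).prod 𝓘(ℝ, F))
      (fun q : G × M => (q.2, v q.1)) (g, s g) :=
    (SmoothNear.snd _).prodMk (h.smooth_snd.comp (.fst _) rfl)
  refine ⟨fun q => A (q.2, v q.1), h.smooth_inv.comp h1 rfl, h.left_inv, ?_⟩
  filter_upwards [h1.continuousAt.eventually h.right_inv] with q hq using hq.1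

/-- The kernel of the differential of a submersion in a local trivialisation. -/
theorem exists_hasMFDerivAt (h : IsLocalTrivialisation E E₀ s g A v) :
    ∃ B : F →L[ℝ] E, HasMFDerivAt 𝓘(ℝ, F) 𝓘(ℝ, E) (fun ν => A (s g, ν)) (v g) B ∧
      (∀ ν, mfderiv 𝓘(ℝ, E) 𝓘(ℝ, E₀) s g (B ν) = 0) ∧
      (∀ ν, mfderiv 𝓘(ℝ, E) 𝓘(ℝ, F) v g (B ν) = ν) ∧
      ∀ ξ : E, mfderiv 𝓘(ℝ, E) 𝓘(ℝ, E₀) s g ξ = 0 → B (mfderiv 𝓘(ℝ, E) 𝓘(ℝ, F) v g ξ) = ξ := by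
  have hA : HasMFDerivAt (𝓘(ℝ, E₀).prod 𝓘(ℝ, F)) 𝓘(ℝ, E) A (s g, v g) _ :=
    h.smooth_inv.mdifferentiableAt.hasMFDerivAt
  have hs := h.smooth_fst.mdifferentiableAt.hasMFDerivAt
  have hv := h.smooth_snd.mdifferentiableAt.hasMFDerivAt
  have hi : HasMFDerivAt 𝓘(ℝ, F) (𝓘(ℝ, E₀).prod 𝓘(ℝ, F)) (fun ν : F => (s g, ν)) (v g)
      (ContinuousLinearMap.inr ℝ E₀ F) := by
    have h1 : HasMFDerivAt 𝓘(ℝ, F) 𝓘(ℝ, E₀) (fun _ : F => s g) (v g) (0 : F →L[ℝ] E₀) :=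
      hasMFDerivAt_const _ _
    exact h1.prodMk (hasMFDerivAt_id _)
  let A' : E₀ × F →L[ℝ] E := mfderiv (𝓘(ℝ, E₀).prod 𝓘(ℝ, F)) 𝓘(ℝ, E) A (s g, v g)
  let s' : E →L[ℝ] E₀ := mfderiv 𝓘(ℝ, E) 𝓘(ℝ, E₀) s g
  let v' : E →L[ℝ] F := mfderiv 𝓘(ℝ, E) 𝓘(ℝ, F) v g
  have hB : HasMFDerivAt 𝓘(ℝ, F) 𝓘(ℝ, E) (fun ν => A (s g, ν)) (v g)
    (A'.comp (ContinuousLinearMap.inr ℝ E₀ F)) := HasMFDerivAt.comp (v g) hA hi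
  have hs1 : HasMFDerivAt 𝓘(ℝ, E) 𝓘(ℝ, E₀) s (A (s g, v g)) s' := by
    rw [h.apply_self]; exact hs
  have hv1 : HasMFDerivAt 𝓘(ℝ, E) 𝓘(ℝ, F) v (A (s g, v g)) v' := by
    rw [h.apply_self]; exact hv
  have key : ∀ᶠ ν in 𝓝 (v g), s (A (s g, ν)) = s g ∧ v (A (s g, ν)) = ν := by
    have : Tendsto (fun ν : F => (s g, ν)) (𝓝 (v g)) (𝓝 (s g, v g)) :=
      (continuous_const.prodMk continuous_id).continuousAt
    exact this.eventually h.right_inv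
  refine ⟨A'.comp (ContinuousLinearMap.inr ℝ E₀ F), hB, fun ν => ?_, fun ν => ?_, fun ξ hξ => ?_⟩
  · have h1 : HasMFDerivAt 𝓘(ℝ, F) 𝓘(ℝ, E₀) (fun ν => s (A (s g, ν))) (v g)
      (s'.comp (A'.comp (ContinuousLinearMap.inr ℝ E₀ F))) := HasMFDerivAt.comp (v g) hs1 hB
    have h2 : HasMFDerivAt 𝓘(ℝ, F) 𝓘(ℝ, E₀) (fun ν => s (A (s g, ν))) (v g) (0 : F →L[ℝ] E₀) :=
      (hasMFDerivAt_const (s g) (v g)).congr_of_eventuallyEq (key.mono fun ν h => h.1)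
    exact DFunLike.congr_fun (hasMFDerivAt_unique h1 h2) ν
  · have h1 : HasMFDerivAt 𝓘(ℝ, F) 𝓘(ℝ, F) (fun ν => v (A (s g, ν))) (v g)
      (v'.comp (A'.comp (ContinuousLinearMap.inr ℝ E₀ F))) := HasMFDerivAt.comp (v g) hv1 hB
    have h2 : HasMFDerivAt 𝓘(ℝ, F) 𝓘(ℝ, F) (fun ν => v (A (s g, ν))) (v g)
        (ContinuousLinearMap.id ℝ F) :=
      (hasMFDerivAt_id (v g)).congr_of_eventuallyEq (key.mono fun ν h => h.2)
    exact DFunLike.congr_fun (hasMFDerivAt_unique h1 h2) ν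
  · have h1 : HasMFDerivAt 𝓘(ℝ, E) 𝓘(ℝ, E) (fun g' => A (s g', v g')) g (A'.comp (s'.prod v')) :=
      HasMFDerivAt.comp g hA (hs.prodMk hv)
    have h2 : HasMFDerivAt 𝓘(ℝ, E) 𝓘(ℝ, E) (fun g' => A (s g', v g')) g
        (ContinuousLinearMap.id ℝ E) :=
      (hasMFDerivAt_id g).congr_of_eventuallyEq h.left_inv
    have h3 : A' (s' ξ, v' ξ) = ξ := DFunLike.congr_fun (hasMFDerivAt_unique h1 h2) ξ
    have h4 : s' ξ = 0 := hξ
    rw [h4] at h3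
    exact h3

end IsLocalTrivialisation

/-- The map is block triangular, with the identity and an invertible map on the diagonal. -/
theorem bijective_prodMk_of_comp_inr {L : E × F →L[ℝ] F}
    (hL : Function.Bijective fun ν : F => L (0, ν)) :
    Function.Bijective fun q : E × F => (q.1, L q) := by
  have hadd : ∀ ξ ν, L (ξ, ν) = L (ξ, 0) + L (0, ν) := fun ξ ν => by
    rw [← map_add]; simp
  constructor
  · rintro ⟨ξ, ν⟩ ⟨ξ', ν'⟩ h
    obtain ⟨h1, h2⟩ := Prod.mk.inj h
    dsimp only at h1 h2
    subst h1
    rw [hadd ξ ν, hadd ξ ν'] at h2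
    rw [hL.1 (add_left_cancel h2)]
  · rintro ⟨ξ, c⟩
    obtain ⟨ν, hν⟩ := hL.2 (c - L (ξ, 0))
    refine ⟨(ξ, ν), ?_⟩
    dsimp only at hν ⊢
    rw [hadd ξ ν, hν]
    simp

/-- Division by a partially defined smooth multiplication `m` with `m (u, g₀) = g₀`: the equation
`m (a, k) = g` has a unique solution `a = δ (g, k)` near `u`, provided that the multiplication
induces an isomorphism of the kernels of the differentials. -/
theorem exists_division [FiniteDimensional ℝ E] [FiniteDimensional ℝ F] [IsManifold 𝓘(ℝ, E) ∞ G]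
    [IsManifold 𝓘(ℝ, E₀) ∞ M] {s t : G → M} {m : G × G → G} {u g₀ : G}
    (hs : IsSubmersionOfComplement F 𝓘(ℝ, E) 𝓘(ℝ, E₀) ∞ s)
    (ht : SmoothNear 𝓘(ℝ, E) 𝓘(ℝ, E₀) t g₀)
    (hm : SmoothNear (𝓘(ℝ, E).prod 𝓘(ℝ, E)) 𝓘(ℝ, E) m (u, g₀)) (hu : s u = t g₀)
    (hm₀ : m (u, g₀) = g₀) (hsm : ∀ᶠ q in 𝓝 (u, g₀), s q.1 = t q.2 → s (m q) = s q.2)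
    (hreg : ∃ (D : E →L[ℝ] E) (S : Set G),
      HasMFDerivWithinAt 𝓘(ℝ, E) 𝓘(ℝ, E) (fun h => m (h, g₀)) S u D ∧
      (∀ᶠ h in 𝓝 u, s h = t g₀ → h ∈ S) ∧
      BijOn D {v : E | mfderiv 𝓘(ℝ, E) 𝓘(ℝ, E₀) s u v = 0}
        {v : E | mfderiv 𝓘(ℝ, E) 𝓘(ℝ, E₀) s g₀ v = 0}) :
    ∃ δ : G × G → G, SmoothNear (𝓘(ℝ, E).prod 𝓘(ℝ, E)) 𝓘(ℝ, E) δ (g₀, g₀) ∧ δ (g₀, g₀) = u ∧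
      (∀ᶠ q in 𝓝 (g₀, g₀), s q.1 = s q.2 → s (δ q) = t q.2 ∧ m (δ q, q.2) = q.1) ∧
      ∀ᶠ q in 𝓝 (u, g₀), s q.1 = t q.2 → δ (m q, q.2) = q.1 := by
  obtain ⟨A, v, hA⟩ := (hs u).exists_isLocalTrivialisation
  obtain ⟨A', w, hA'⟩ := (hs g₀).exists_isLocalTrivialisation
  obtain ⟨B, hB, hB1, hB2, hB3⟩ := hA.exists_hasMFDerivAt
  obtain ⟨B', -, hB1', hB2', hB3'⟩ := hA'.exists_hasMFDerivAt
  obtain ⟨D, S, hD, hS, hbij⟩ := hreg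
  -- the multiplication in coordinates
  have hsu : (t g₀, v u) = (s u, v u) := by rw [hu]
  have ha₁ : SmoothNear (𝓘(ℝ, E).prod 𝓘(ℝ, F)) (𝓘(ℝ, E₀).prod 𝓘(ℝ, F))
      (fun q : G × F => (t q.1, q.2)) (g₀, v u) := (ht.comp (.fst _) rfl).prodMk (.snd _)
  have ha : SmoothNear (𝓘(ℝ, E).prod 𝓘(ℝ, F)) 𝓘(ℝ, E) (fun q : G × F => A (t q.1, q.2))
      (g₀, v u) := hA.smooth_inv.comp ha₁ hsu
  have ha0 : A (t g₀, v u) = u := by rw [hsu, hA.apply_self]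
  have hak : SmoothNear (𝓘(ℝ, E).prod 𝓘(ℝ, F)) (𝓘(ℝ, E).prod 𝓘(ℝ, E))
      (fun q : G × F => (A (t q.1, q.2), q.1)) (g₀, v u) := ha.prodMk (.fst _)
  have hak0 : (A (t g₀, v u), g₀) = (u, g₀) := by rw [ha0]
  have hma := hm.comp hak hak0
  have hma0 : m (A (t g₀, v u), g₀) = g₀ := by rw [ha0, hm₀]
  -- `Q (k, ν)` is the fibre coordinate of `m (a, k)`, where `a` has source `t k` and fibre
  -- coordinate `ν`. The source of the product is already known to be `s k`, so solving `m (a, k) =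
  -- g` amounts to solving `Q (k, ν) = w g`, that is, to inverting `Θ`.
  let Q : G × F → F := fun q => w (m (A (t q.1, q.2), q.1))
  have hQ : SmoothNear (𝓘(ℝ, E).prod 𝓘(ℝ, F)) 𝓘(ℝ, F) Q (g₀, v u) := hA'.smooth_snd.comp hma hma0
  have hQ0 : Q (g₀, v u) = w g₀ := congrArg w hma0
  let Θ : G × F → G × F := fun q => (q.1, Q q)
  have hΘ : SmoothNear (𝓘(ℝ, E).prod 𝓘(ℝ, F)) (𝓘(ℝ, E).prod 𝓘(ℝ, F)) Θ (g₀, v u) :=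
    (SmoothNear.fst _).prodMk hQ
  -- its partial derivative
  let Q' : E × F →L[ℝ] F := mfderiv (𝓘(ℝ, E).prod 𝓘(ℝ, F)) 𝓘(ℝ, F) Q (g₀, v u)
  let w' : E →L[ℝ] F := mfderiv 𝓘(ℝ, E) 𝓘(ℝ, F) w g₀
  have hi : HasMFDerivAt 𝓘(ℝ, F) (𝓘(ℝ, E).prod 𝓘(ℝ, F)) (fun ν : F => (g₀, ν)) (v u)
      (ContinuousLinearMap.inr ℝ E F) := by
    have h1 : HasMFDerivAt 𝓘(ℝ, F) 𝓘(ℝ, E) (fun _ : F => g₀) (v u) (0 : F →L[ℝ] E) :=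
      hasMFDerivAt_const _ _
    exact h1.prodMk (hasMFDerivAt_id _)
  have hd1 : HasMFDerivAt 𝓘(ℝ, F) 𝓘(ℝ, F) (fun ν : F => Q (g₀, ν)) (v u)
      (Q'.comp (ContinuousLinearMap.inr ℝ E F)) :=
    HasMFDerivAt.comp (f := fun ν : F => (g₀, ν)) (g := Q) (v u)
      hQ.mdifferentiableAt.hasMFDerivAt hi
  -- `D` is a derivative only within `S`; the parametrised source fibre stays in `S`, so along it
  -- `D` is a genuine derivative.
  have hS' : (fun ν => A (s u, ν)) ⁻¹' S ∈ 𝓝 (v u) := by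
    have h1 : Tendsto (fun ν : F => (s u, ν)) (𝓝 (v u)) (𝓝 (s u, v u)) :=
      (continuous_const.prodMk continuous_id).continuousAt
    have h2 : Tendsto (fun ν : F => A (s u, ν)) (𝓝 (v u)) (𝓝 u) :=
      (hA.smooth_inv.tendsto hA.apply_self).comp h1
    filter_upwards [h1.eventually hA.right_inv, h2.eventually hS] with ν h3 h4
    exact h4 (h3.1.trans hu)
  have hd2 : HasMFDerivAt 𝓘(ℝ, F) 𝓘(ℝ, E) (fun ν : F => m (A (s u, ν), g₀)) (v u) (D.comp B) := by
    have hD' : HasMFDerivWithinAt 𝓘(ℝ, E) 𝓘(ℝ, E) (fun h => m (h, g₀)) S (A (s u, v u)) D := by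
      rw [hA.apply_self]; exact hD
    exact (HasMFDerivWithinAt.comp (v u) hD' hB.hasMFDerivWithinAt subset_rfl).hasMFDerivAt hS'
  have hd3 : HasMFDerivAt 𝓘(ℝ, F) 𝓘(ℝ, F) (fun ν : F => Q (g₀, ν)) (v u) (w'.comp (D.comp B)) := by
    have hw : HasMFDerivAt 𝓘(ℝ, E) 𝓘(ℝ, F) w (m (A (s u, v u), g₀)) w' := by
      rw [hu, hma0]; exact hA'.smooth_snd.mdifferentiableAt.hasMFDerivAt
    have h1 := HasMFDerivAt.comp (v u) hw hd2
    rw [hu] at h1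
    exact h1
  have hQ'B : ∀ ν : F, Q' (0, ν) = w' (D (B ν)) := fun ν =>
    DFunLike.congr_fun (hasMFDerivAt_unique hd1 hd3) ν
  -- `B` identifies `F` with the kernel at `u`, regularity makes `D` a bijection from it to the
  -- kernel at `g₀`, and `w'` identifies that kernel with `F`, with inverse `B'`.
  have hbijQ : Function.Bijective fun ν : F => Q' (0, ν) := by
    constructor
    · refine (injective_iff_map_eq_zero (Q'.comp (ContinuousLinearMap.inr ℝ E F))).2 fun ν hν => ?_
      have h1 : w' (D (B ν)) = 0 := (hQ'B ν).symm.trans hν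
      have h2 := hB3' (D (B ν)) (hbij.mapsTo (hB1 ν))
      have h3 : D (B ν) = 0 := by
        rw [← h2]
        exact (congrArg B' h1).trans (map_zero B')
      have h4 : B ν = 0 := by
        refine hbij.injOn (hB1 ν) ?_ (h3.trans (map_zero D).symm)
        exact map_zero (mfderiv 𝓘(ℝ, E) 𝓘(ℝ, E₀) s u)
      have h5 := hB2 ν
      rw [h4] at h5
      exact h5.symm.trans (map_zero (mfderiv 𝓘(ℝ, E) 𝓘(ℝ, F) v u))
    · intro c
      obtain ⟨ξ, hξ, hξ'⟩ := hbij.surjOn (hB1' c)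
      refine ⟨mfderiv 𝓘(ℝ, E) 𝓘(ℝ, F) v u ξ, (hQ'B _).trans ?_⟩
      rw [hB3 ξ hξ, hξ']
      exact hB2' c
  have hΘbij : Function.Bijective
      (mfderiv (𝓘(ℝ, E).prod 𝓘(ℝ, F)) (𝓘(ℝ, E).prod 𝓘(ℝ, F)) Θ (g₀, v u)) := by
    have h1 : HasMFDerivAt (𝓘(ℝ, E).prod 𝓘(ℝ, F)) (𝓘(ℝ, E).prod 𝓘(ℝ, F)) Θ (g₀, v u)
        ((ContinuousLinearMap.fst ℝ E F).prod Q') :=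
      HasMFDerivAt.prodMk (hasMFDerivAt_fst (g₀, v u)) hQ.mdifferentiableAt.hasMFDerivAt
    rw [h1.mfderiv]
    exact bijective_prodMk_of_comp_inr hbijQ
  obtain ⟨Ψ, hΨ, hΨ0, hΨ1, hΨ2⟩ := hΘ.hasSmoothLocalInverseAt hΘbij
  have hΘ0 : Θ (g₀, v u) = (g₀, w g₀) := Prod.ext rfl hQ0
  rw [hΘ0] at hΨ hΨ0 hΨ2
  -- the division map
  have hgw : SmoothNear (𝓘(ℝ, E).prod 𝓘(ℝ, E)) (𝓘(ℝ, E).prod 𝓘(ℝ, F))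
      (fun q : G × G => (q.2, w q.1)) (g₀, g₀) :=
    (SmoothNear.snd _).prodMk (hA'.smooth_snd.comp (.fst _) rfl)
  have hR := hΨ.comp hgw rfl
  have hν : SmoothNear (𝓘(ℝ, E).prod 𝓘(ℝ, E)) (𝓘(ℝ, E).prod 𝓘(ℝ, F))
      (fun q : G × G => (q.2, (Ψ (q.2, w q.1)).2)) (g₀, g₀) :=
    (SmoothNear.snd _).prodMk ((SmoothNear.snd _).comp hR rfl)
  have hν0 : (g₀, (Ψ (g₀, w g₀)).2) = (g₀, v u) := by rw [hΨ0]
  have hδ := ha.comp hν hν0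
  have hδ0 : A (t g₀, (Ψ (g₀, w g₀)).2) = u := by rw [hΨ0]; exact ha0
  refine ⟨fun q => A (t q.2, (Ψ (q.2, w q.1)).2), hδ, hδ0, ?_, ?_⟩
  · have h1 : ∀ᶠ q : G × G in 𝓝 (g₀, g₀), Θ (Ψ (q.2, w q.1)) = (q.2, w q.1) :=
      hgw.continuousAt.eventually hΨ2
    have h2 : ∀ᶠ q : G × G in 𝓝 (g₀, g₀),
        s (A (t q.2, (Ψ (q.2, w q.1)).2)) = t q.2 := by
      have : Tendsto (fun q : G × G => (t q.2, (Ψ (q.2, w q.1)).2)) (𝓝 (g₀, g₀)) (𝓝 (s u, v u)) :=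
        (ha₁.tendsto hsu).comp (hν.tendsto hν0)
      filter_upwards [this.eventually hA.right_inv] with q hq using hq.1
    have h3 : Tendsto (fun q : G × G => (A (t q.2, (Ψ (q.2, w q.1)).2), q.2)) (𝓝 (g₀, g₀))
        (𝓝 (u, g₀)) := by
      refine ((hδ.tendsto hδ0).prodMk_nhds continuousAt_snd)
    have h4 : Tendsto (fun q : G × G => m (A (t q.2, (Ψ (q.2, w q.1)).2), q.2)) (𝓝 (g₀, g₀))
        (𝓝 g₀) := (hm.tendsto hm₀).comp h3
    have h5 : ∀ᶠ q : G × G in 𝓝 (g₀, g₀), A' (s q.1, w q.1) = q.1 :=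
      hA'.left_inv.prod_inl_nhds _
    filter_upwards [h1, h2, h3.eventually hsm, h4.eventually hA'.left_inv, h5]
      with q h1 h2 h3 h4 h5 hq
    refine ⟨h2, ?_⟩
    obtain ⟨h6, h7⟩ := Prod.mk.inj h1
    have h8 : w (m (A (t q.2, (Ψ (q.2, w q.1)).2), q.2)) = w q.1 := by
      refine Eq.trans ?_ h7
      simp only [Q, h6]
    rw [← h4, h3 h2, h8, ← hq, h5]
  · have h1 : ∀ᶠ q : G × G in 𝓝 (u, g₀), A (s q.1, v q.1) = q.1 :=
      hA.left_inv.prod_inl_nhds _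
    have h2 : ∀ᶠ q : G × G in 𝓝 (u, g₀), Ψ (Θ (q.2, v q.1)) = (q.2, v q.1) := by
      have : Tendsto (fun q : G × G => (q.2, v q.1)) (𝓝 (u, g₀)) (𝓝 (g₀, v u)) :=
        continuousAt_snd.prodMk_nhds
          (hA.smooth_snd.continuousAt.tendsto.comp (continuousAt_fst (p := (u, g₀))))
      exact this.eventually hΨ1
    filter_upwards [h1, h2] with q h1 h2 hq
    have h3 : Θ (q.2, v q.1) = (q.2, w (m q)) := by
      simp only [Θ, Q, ← hq, h1]
    rw [h3] at h2
    rw [h2, ← hq, h1]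

end Submersions

/-! ### Submersions and curves -/

section Curves

open Filter

variable {E : Type*} [NormedAddCommGroup E] [NormedSpace ℝ E] {H : Type*} [TopologicalSpace H]
  {E' : Type*} [NormedAddCommGroup E'] [NormedSpace ℝ E'] {H' : Type*} [TopologicalSpace H']
  {X : Type*} [TopologicalSpace X] {Y : Type*} [TopologicalSpace Y]
  {I : ModelWithCorners ℝ E H} {J : ModelWithCorners ℝ E' H'}
  [ChartedSpace H X] [ChartedSpace H' Y]

theorem not_eventually_of_countable {P : ℝ → Prop} (h : {r | P r}.Countable) :
    ¬ ∀ᶠ r in 𝓝 (0 : ℝ), P r := by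
  intro h0
  obtain ⟨r, hr, hr'⟩ := (h.dense_compl ℝ).inter_nhds_nonempty h0
  exact hr hr'

/-- A nonzero kernel vector spans a line which the inverse of the implicit function chart maps
injectively into the fibre near `x`; this would put uncountably many points in it. -/
theorem injective_fderiv_of_countable_fibre [FiniteDimensional ℝ E] [FiniteDimensional ℝ E']
    {f : E → E'} {x : E} (hf : ContDiffAt ℝ ∞ f x) (hsurj : Function.Surjective (fderiv ℝ f x))
    {O : Set E} (hO : O ∈ 𝓝 x) (hc : {z ∈ O | f z = f x}.Countable) :
    Function.Injective (fderiv ℝ f x) := by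
  have : CompleteSpace E := FiniteDimensional.complete ℝ E
  have : CompleteSpace E' := FiniteDimensional.complete ℝ E'
  have hst : HasStrictFDerivAt f (fderiv ℝ f x) x := hf.hasStrictFDerivAt (by simp)
  have hr : (fderiv ℝ f x).range = ⊤ := LinearMap.range_eq_top.2 hsurj
  let φ := hst.implicitToOpenPartialHomeomorph f _ hr
  have hx : x ∈ φ.source := hst.mem_implicitToOpenPartialHomeomorph_source hr
  have hφx : φ x = (f x, 0) := hst.implicitToOpenPartialHomeomorph_self hr
  refine (injective_iff_map_eq_zero _).2 fun k hk => ?_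
  by_contra hk0
  let k' : (fderiv ℝ f x).ker := ⟨k, hk⟩
  have hk' : k' ≠ 0 := fun h => hk0 (congrArg Subtype.val h)
  let c : ℝ → E' × (fderiv ℝ f x).ker := fun r => (f x, r • k')
  have hcont : Continuous c := by fun_prop
  have hc0 : c 0 = φ x := by rw [hφx]; simp [c]
  have hct : Tendsto c (𝓝 0) (𝓝 (φ x)) := hc0 ▸ hcont.continuousAt
  have hcx : Tendsto (fun r => φ.symm (c r)) (𝓝 0) (𝓝 x) := by
    have := (φ.continuousAt_symm (φ.map_source hx)).tendsto
    rw [φ.left_inv hx] at this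
    exact this.comp hct
  have hcinj : Function.Injective c := by
    intro r r' h
    exact smul_left_injective ℝ hk' (Prod.mk.inj h).2
  refine not_eventually_of_countable (P := fun r => c r ∈ φ.target ∧ φ.symm (c r) ∈ O) ?_ ?_
  · refine MapsTo.countable_of_injOn (f := fun r => φ.symm (c r)) ?_ ?_ hc
    · intro r hr
      refine ⟨hr.2, ?_⟩
      have h1 : φ (φ.symm (c r)) = c r := φ.right_inv hr.1
      exact congrArg Prod.fst h1
    · intro r hr r' hr' h
      exact hcinj (φ.symm.injOn hr.1 hr'.1 h)
  · exact (hct.eventually (φ.open_target.mem_nhds (φ.map_source hx))).and (hcx.eventually hO)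

/-- A submersion with countable fibres has bijective differential. -/
theorem SmoothNear.bijective_mfderiv_of_countable_fibre [FiniteDimensional ℝ E]
    [FiniteDimensional ℝ E'] [I.Boundaryless] [IsManifold I ∞ X] [IsManifold J ∞ Y] {f : X → Y}
    {x : X} (hf : SmoothNear I J f x) (hsurj : Function.Surjective (mfderiv I J f x)) {O : Set X}
    (hO : O ∈ 𝓝 x) (hc : {z ∈ O | f z = f x}.Countable) :
    Function.Bijective (mfderiv I J f x) := by
  refine ⟨?_, hsurj⟩
  obtain ⟨h1, h2⟩ := hf.written
  have h0 : (_root_.extChartAt I x).symm (_root_.extChartAt I x x) = x := extChartAt_to_inv x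
  have hs : Tendsto (_root_.extChartAt I x).symm (𝓝 (_root_.extChartAt I x x)) (𝓝 x) :=
    (SmoothNear.extChartAt_symm (I := I) x).tendsto h0
  have hfs : Tendsto (fun z => f ((_root_.extChartAt I x).symm z)) (𝓝 (_root_.extChartAt I x x))
    (𝓝 (f x)) := hf.continuousAt.tendsto.comp hs
  let φ : E → E' := fun z => _root_.extChartAt J (f x) (f ((_root_.extChartAt I x).symm z))
  have hsurj' : Function.Surjective (fderiv ℝ φ (_root_.extChartAt I x x)) := by
    intro η
    obtain ⟨ξ, hξ⟩ := hsurj η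
    exact ⟨ξ, (DFunLike.congr_fun h2 ξ).trans hξ⟩
  suffices h : Function.Injective (fderiv ℝ φ (_root_.extChartAt I x x)) by
    intro ξ ξ' hξ
    exact h ((DFunLike.congr_fun h2 ξ).trans (hξ.trans (DFunLike.congr_fun h2 ξ').symm))
  refine injective_fderiv_of_countable_fibre (smoothNear_iff_contDiffAt.1 h1).self_of_nhds hsurj'
    (O := (_root_.extChartAt I x).target ∩ ((_root_.extChartAt I x).symm ⁻¹' O ∩
      {z | f ((_root_.extChartAt I x).symm z) ∈ (_root_.extChartAt J (f x)).source}))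
    (inter_mem (extChartAt_target_mem_nhds x) (inter_mem (hs hO)
      (hfs (extChartAt_source_mem_nhds (f x))))) ?_
  refine MapsTo.countable_of_injOn (f := (_root_.extChartAt I x).symm) ?_ ?_ hc
  · rintro z ⟨⟨hz1, hz2, hz3⟩, hz4⟩
    refine ⟨hz2, ?_⟩
    simp only [φ, h0] at hz4
    exact (_root_.extChartAt J (f x)).injOn hz3 (mem_extChartAt_source (f x)) hz4
  · intro z hz z' hz' h
    exact (_root_.extChartAt I x).symm.injOn hz.1.1 hz'.1.1 h

theorem tangentBundle_mk_congr {y y' : Y} (h : y = y') (v : E') :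
    (⟨y, v⟩ : TangentBundle J Y) = ⟨y', v⟩ := by subst h; rfl

/-- Every tangent vector is the velocity of a curve. -/
theorem exists_curve [J.Boundaryless] [IsManifold J ∞ Y] (η : TangentBundle J Y) :
    ∃ c : ℝ → Y, SmoothNear 𝓘(ℝ, ℝ) J c 0 ∧ c 0 = η.proj ∧
      tangentMap 𝓘(ℝ, ℝ) J c ⟨0, (1 : ℝ)⟩ = η := by
  obtain ⟨y, η⟩ := η
  let v : E' := η
  let l : ℝ → E' := fun r => _root_.extChartAt J y y + r • v
  have hl0 : l 0 = _root_.extChartAt J y y := by simp [l]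
  have hl : SmoothNear 𝓘(ℝ, ℝ) 𝓘(ℝ, E') l 0 := .vec (by fun_prop) _
  let c : ℝ → Y := fun r => (_root_.extChartAt J y).symm (l r)
  have hc : SmoothNear 𝓘(ℝ, ℝ) J c 0 := (SmoothNear.extChartAt_symm (I := J) y).comp hl hl0
  have hc0 : c 0 = y := by simp only [c, hl0]; exact extChartAt_to_inv y
  refine ⟨c, hc, hc0, ?_⟩
  have hd : HasFDerivAt l (ContinuousLinearMap.toSpanSingleton ℝ v) 0 := by
    have : HasFDerivAt (fun r : ℝ => r • v) (ContinuousLinearMap.toSpanSingleton ℝ v) 0 :=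
      (ContinuousLinearMap.toSpanSingleton ℝ v).hasFDerivAt
    exact this.const_add _
  have hm : HasMFDerivAt 𝓘(ℝ, ℝ) J c 0 (ContinuousLinearMap.toSpanSingleton ℝ v) := by
    refine ⟨hc.continuousAt, ?_⟩
    have h1 : HasFDerivAt (writtenInExtChartAt 𝓘(ℝ, ℝ) J 0 c)
        (ContinuousLinearMap.toSpanSingleton ℝ v) 0 := by
      refine hd.congr_of_eventuallyEq ?_
      have h2 : Tendsto l (𝓝 0) (𝓝 (_root_.extChartAt J y y)) := hl.tendsto hl0
      filter_upwards [h2.eventually (extChartAt_target_mem_nhds y)] with r hr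
      have h3 : writtenInExtChartAt 𝓘(ℝ, ℝ) J 0 c r = _root_.extChartAt J (c 0) (c r) := rfl
      rw [h3, hc0]
      exact (_root_.extChartAt J y).right_inv hr
    exact h1.hasFDerivWithinAt
  have h3 : mfderiv 𝓘(ℝ, ℝ) J c 0 (1 : ℝ) = v := by
    rw [hm.mfderiv]
    exact one_smul ℝ v
  calc tangentMap 𝓘(ℝ, ℝ) J c ⟨0, (1 : ℝ)⟩ = ⟨c 0, mfderiv 𝓘(ℝ, ℝ) J c 0 (1 : ℝ)⟩ := rfl
    _ = ⟨c 0, v⟩ := by rw [h3]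
    _ = _ := tangentBundle_mk_congr hc0 v

theorem surjective_mfderiv_of_curves {f : X → Y} {x : X} {y : Y} (hy : f x = y)
    (hf : SmoothNear I J f x)
    (h : ∀ η : TangentBundle J Y, η.proj = y → ∃ c : ℝ → X, c 0 = x ∧ MDifferentiableAt 𝓘(ℝ, ℝ) I c 0 ∧
      tangentMap 𝓘(ℝ, ℝ) J (fun r => f (c r)) ⟨0, (1 : ℝ)⟩ = η) :
    Function.Surjective (mfderiv I J f x) := by
  subst hy
  intro η
  obtain ⟨c, hc0, hc, hη⟩ := h ⟨f x, η⟩ rfl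
  subst hc0
  have h1 : HasMFDerivAt 𝓘(ℝ, ℝ) J (fun r => f (c r)) 0
      ((mfderiv I J f (c 0)).comp (mfderiv 𝓘(ℝ, ℝ) I c 0)) :=
    HasMFDerivAt.comp 0 hf.mdifferentiableAt.hasMFDerivAt hc.hasMFDerivAt
  refine ⟨mfderiv 𝓘(ℝ, ℝ) I c 0 (1 : ℝ), ?_⟩
  have h2 : tangentMap 𝓘(ℝ, ℝ) J (fun r => f (c r)) ⟨0, (1 : ℝ)⟩ =
      ⟨f (c 0), mfderiv I J f (c 0) (mfderiv 𝓘(ℝ, ℝ) I c 0 (1 : ℝ))⟩ := by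
    simp only [tangentMap, h1.mfderiv]
    rfl
  rw [h2] at hη
  exact eq_of_heq (Bundle.TotalSpace.mk.inj hη).2

/-- A curve in `Y` with the prescribed velocity, pushed into `S` by the local section `σ`, is the
required curve. -/
theorem isSubmersionOnSubset_of_sections [J.Boundaryless] [IsManifold J ∞ Y] {S : Set X} {f : S → Y}
    (h : ∀ p : S, ∃ F : X → Y, SmoothNear I J F p.1 ∧
      (∀ᶠ x in 𝓝 p.1, ∀ hx : x ∈ S, F x = f ⟨x, hx⟩) ∧
      ∃ σ : Y → X, SmoothNear J I σ (f p) ∧ σ (f p) = p ∧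
        ∀ᶠ y in 𝓝 (f p), ∃ hy : σ y ∈ S, f ⟨σ y, hy⟩ = y) :
    IsSubmersionOnSubset I J S f := by
  intro p
  obtain ⟨F, hF, hFf, σ, hσ, hσp, hs⟩ := h p
  obtain ⟨O, hO, oO, pO⟩ := eventually_nhds_iff.1 (hF.and hFf)
  refine ⟨O, F, oO, pO, fun x hx => (hO x hx).1.contMDiffWithinAt,
    fun x hx => (hO x hx).2 x.2, fun η hη => ?_⟩
  obtain ⟨γ, hγ, hγ0, hγη⟩ := exists_curve (J := J) η
  have hγ1 : Tendsto γ (𝓝 0) (𝓝 (f p)) := hγ.tendsto (hγ0.trans hη)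
  have hc := hσ.comp hγ (hγ0.trans hη)
  have hc0 : σ (γ 0) = p := by rw [hγ0, hη, hσp]
  refine ⟨fun r => σ (γ r), hc0, hc.contMDiffAt, ?_, ?_⟩
  · filter_upwards [hγ1.eventually hs] with r hr using hr.1
  · have h1 : F ∘ (fun r => σ (γ r)) =ᶠ[𝓝 0] γ := by
      filter_upwards [hγ1.eventually hs, (hc.tendsto hc0).eventually hFf] with r ⟨h1, h2⟩ h3
      exact (h3 h1).trans h2
    have h2 : mfderiv 𝓘(ℝ, ℝ) J (F ∘ fun r => σ (γ r)) 0 = mfderiv 𝓘(ℝ, ℝ) J γ 0 := h1.mfderiv_eq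
    rw [← hγη]
    simp only [tangentMap]
    rw [h2]
    exact tangentBundle_mk_congr h1.self_of_nhds _

end Curves

/-! ### Submersions recognised in a parametrisation -/

section NormalForm

open Filter

variable {E : Type*} [NormedAddCommGroup E] [NormedSpace ℝ E]
  {E' : Type*} [NormedAddCommGroup E'] [NormedSpace ℝ E']
  {E₀ : Type*} [NormedAddCommGroup E₀] [NormedSpace ℝ E₀]
  {F : Type*} [NormedAddCommGroup F] [NormedSpace ℝ F]
  {X : Type*} [TopologicalSpace X] [ChartedSpace E X]
  {M : Type*} [TopologicalSpace M] [ChartedSpace E₀ M]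

theorem mem_maximalAtlas_of_contMDiffOn [IsManifold 𝓘(ℝ, E) ∞ X] {φ : OpenPartialHomeomorph X E}
    (h₁ : ContMDiffOn 𝓘(ℝ, E) 𝓘(ℝ, E) ∞ φ φ.source)
    (h₂ : ContMDiffOn 𝓘(ℝ, E) 𝓘(ℝ, E) ∞ φ.symm φ.target) :
    φ ∈ IsManifold.maximalAtlas 𝓘(ℝ, E) ∞ X := by
  have key : ∀ e : OpenPartialHomeomorph E E, ContMDiffOn 𝓘(ℝ, E) 𝓘(ℝ, E) ∞ e e.source →
      ContMDiffOn 𝓘(ℝ, E) 𝓘(ℝ, E) ∞ e.symm e.target → e ∈ contDiffGroupoid ∞ 𝓘(ℝ, E) := by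
    intro e he he'
    rw [contMDiffOn_iff_contDiffOn] at he he'
    rw [contDiffGroupoid, mem_groupoid_of_pregroupoid]
    simp only [contDiffPregroupoid, mfld_simps]
    simpa using ⟨he, he'⟩
  rw [IsManifold.mem_maximalAtlas_iff]
  intro e he
  have he' := IsManifold.subset_maximalAtlas (I := 𝓘(ℝ, E)) (n := ∞) he
  have e1 := contMDiffOn_of_mem_maximalAtlas he'
  have e2 := contMDiffOn_symm_of_mem_maximalAtlas he'
  constructor
  · refine key _ ?_ ?_
    · exact e1.comp' h₂ |>.mono (by intro z hz; simpa using hz)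
    · exact h₁.comp' e2 |>.mono (by intro z hz; simpa using hz)
  · refine key _ ?_ ?_
    · exact h₁.comp' e2 |>.mono (by intro z hz; simpa using hz)
    · exact e1.comp' h₂ |>.mono (by intro z hz; simpa using hz)

/-- A map that is a linear projection in a parametrisation is a submersion. -/
theorem HasSmoothLocalInverseAt.isSubmersionAtOfComplement [IsManifold 𝓘(ℝ, E) ∞ X]
    [IsManifold 𝓘(ℝ, E₀) ∞ M] {Φ : E → X} {z₀ : E}
    (h : HasSmoothLocalInverseAt 𝓘(ℝ, E) 𝓘(ℝ, E) Φ z₀)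
    (hΦ : SmoothNear 𝓘(ℝ, E) 𝓘(ℝ, E) Φ z₀) {f : X → M} (e : E ≃L[ℝ] E₀ × F)
    (κ : OpenPartialHomeomorph M E₀) (hκ : κ ∈ IsManifold.maximalAtlas 𝓘(ℝ, E₀) ∞ M)
    (hf : ContinuousAt f (Φ z₀)) (hf₀ : f (Φ z₀) ∈ κ.source)
    (hfΦ : ∀ᶠ z in 𝓝 z₀, κ (f (Φ z)) = (e z).1) :
    IsSubmersionAtOfComplement F 𝓘(ℝ, E) 𝓘(ℝ, E₀) ∞ f (Φ z₀) := by
  obtain ⟨φ, h1, h2, h3, h4⟩ := h.exists_openPartialHomeomorph hΦ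
  obtain ⟨U, hU, oU, zU⟩ := eventually_nhds_iff.1 hfΦ
  let φ' := φ.restr U
  have hz' : z₀ ∈ φ'.source := by
    rw [φ.restr_source' U oU]; exact ⟨h2, zU⟩
  have hφ' : ⇑φ' = Φ := h1
  refine IsSubmersionAtOfComplement.mk_of_continuousAt hf e φ'.symm κ ?_ hf₀ ?_ hκ ?_
  · rw [← hφ']; exact φ'.map_source hz'
  · refine mem_maximalAtlas_of_contMDiffOn ?_ ?_
    · exact h4.mono (by intro z hz; exact hz.1)
    · exact h3.mono (by intro z hz; exact hz.1)
  · intro z hz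
    have hz2 : z ∈ φ'.source := by simpa using hz
    rw [φ.restr_source' U oU] at hz2
    have := hU z hz2.2
    simpa [φ', h1] using this

end NormalForm

namespace LocalLieGroupoid

open Filter

variable {p n : ℕ} {M G : Type*}
  [TopologicalSpace M] [ChartedSpace (EuclideanSpace ℝ (Fin p)) M] [IsManifold (𝓡 p) ∞ M]
  [T2Space M] [SecondCountableTopology M]
  [TopologicalSpace G] [ChartedSpace (EuclideanSpace ℝ (Fin n)) G] [IsManifold (𝓡 n) ∞ G]
  [SecondCountableTopology G]
  (Γ : LocalLieGroupoid p n M G)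

/-! ### Local properties of the multiplication -/

theorem smoothNear_src (g : G) : SmoothNear (𝓡 n) (𝓡 p) Γ.src g :=
  .of_contMDiff Γ.src_submersion.contMDiff g

theorem smoothNear_tgt (g : G) : SmoothNear (𝓡 n) (𝓡 p) Γ.tgt g :=
  .of_contMDiff Γ.tgt_submersion.contMDiff g

theorem smoothNear_unit (x : M) : SmoothNear (𝓡 p) (𝓡 n) Γ.unit x :=
  .of_contMDiff Γ.unit_smooth x

theorem continuous_src : Continuous Γ.src := Γ.src_submersion.contMDiff.continuous

theorem continuous_unit : Continuous Γ.unit := Γ.unit_smooth.continuous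

theorem eventually_mem_dom {q : G × G} (hq : q ∈ Γ.dom) :
    ∀ᶠ q' in 𝓝 q, Γ.src q'.1 = Γ.tgt q'.2 → q' ∈ Γ.dom := by
  obtain ⟨O, hO, hdom⟩ := Γ.dom_open
  rw [hdom] at hq ⊢
  filter_upwards [hO.mem_nhds hq.1] with q' h1 h2 using ⟨h1, h2⟩

theorem exists_mul_extension {q : G × G} (hq : q ∈ Γ.dom) :
    ∃ F : G × G → G, SmoothNear ((𝓡 n).prod (𝓡 n)) (𝓡 n) F q ∧ F q = Γ.mul q ∧
      ∀ᶠ q' in 𝓝 q, Γ.src q'.1 = Γ.tgt q'.2 → q' ∈ Γ.dom ∧ F q' = Γ.mul q' := by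
  obtain ⟨O, F, oO, hO, hF, hFm, -⟩ := Γ.mul_submersion ⟨q, hq⟩
  refine ⟨F, .of_contMDiffOn hF oO hO, hFm ⟨q, hq⟩ hO, ?_⟩
  filter_upwards [Γ.eventually_mem_dom hq, oO.mem_nhds hO] with q' h1 h2 h3
  exact ⟨h1 h3, hFm ⟨q', h1 h3⟩ h2⟩

variable {Γ}

theorem eventually_dom {α : Type*} {l : Filter α} {a b : α → G} {g h : G} (hgh : (g, h) ∈ Γ.dom)
    (ha : Tendsto a l (𝓝 g)) (hb : Tendsto b l (𝓝 h)) (hab : ∀ᶠ i in l, Γ.src (a i) = Γ.tgt (b i)) :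
    ∀ᶠ i in l, (a i, b i) ∈ Γ.dom := by
  filter_upwards [(ha.prodMk_nhds hb).eventually (Γ.eventually_mem_dom hgh), hab] with i h1 h2
  exact h1 h2

theorem tendsto_mul {α : Type*} {l : Filter α} {a b : α → G} {g h : G} (hgh : (g, h) ∈ Γ.dom)
    (ha : Tendsto a l (𝓝 g)) (hb : Tendsto b l (𝓝 h)) (hab : ∀ᶠ i in l, Γ.src (a i) = Γ.tgt (b i)) :
    Tendsto (fun i => Γ.mul (a i, b i)) l (𝓝 (Γ.mul (g, h))) := by
  obtain ⟨F, hF, hF0, hFm⟩ := Γ.exists_mul_extension hgh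
  have h1 := (hF.tendsto hF0).comp (ha.prodMk_nhds hb)
  refine h1.congr' ?_
  filter_upwards [(ha.prodMk_nhds hb).eventually hFm, hab] with i h2 h3
  exact (h2 h3).2

theorem smoothNear_mul {E : Type*} [NormedAddCommGroup E] [NormedSpace ℝ E] {H : Type*}
    [TopologicalSpace H] {I : ModelWithCorners ℝ E H} {X : Type*} [TopologicalSpace X]
    [ChartedSpace H X] {a b : X → G} {x : X} (hx : (a x, b x) ∈ Γ.dom)
    (ha : SmoothNear I (𝓡 n) a x) (hb : SmoothNear I (𝓡 n) b x)
    (hab : ∀ᶠ x' in 𝓝 x, Γ.src (a x') = Γ.tgt (b x')) :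
    SmoothNear I (𝓡 n) (fun x' => Γ.mul (a x', b x')) x := by
  obtain ⟨F, hF, hF0, hFm⟩ := Γ.exists_mul_extension hx
  refine (hF.comp (ha.prodMk hb) rfl).congr ?_
  filter_upwards [(ha.prodMk hb).continuousAt.eventually hFm, hab] with i h2 h3
  exact (h2 h3).2.symm

variable (Γ)

theorem exists_section (g : G) :
    ∃ S : G × M → G, SmoothNear ((𝓡 n).prod (𝓡 p)) (𝓡 n) S (g, Γ.src g) ∧
      (∀ᶠ g' in 𝓝 g, S (g', Γ.src g') = g') ∧ ∀ᶠ q in 𝓝 (g, Γ.src g), Γ.src (S q) = q.2 := by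
  obtain ⟨A, v, h⟩ := (Γ.src_submersion.isSubmersionAt
    g).isSubmersionAtOfComplement_complement.exists_isLocalTrivialisation
  exact h.exists_section

theorem finiteDimensional_complement {E E₀ F : Type*} [NormedAddCommGroup E] [NormedSpace ℝ E]
    [NormedAddCommGroup E₀] [NormedSpace ℝ E₀] [NormedAddCommGroup F] [NormedSpace ℝ F]
    [FiniteDimensional ℝ E] (e : E ≃L[ℝ] E₀ × F) : FiniteDimensional ℝ F :=
  FiniteDimensional.of_surjective ((LinearMap.snd ℝ E₀ F).comp (e : E →ₗ[ℝ] E₀ × F))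
    (Prod.snd_surjective.comp e.surjective)

variable {Γ}

/-- Right division by elements near `g₀`. -/
theorem RightRegularAt.exists_division {g₀ : G} (hreg : Γ.RightRegularAt g₀) :
    ∃ δ : G × G → G, SmoothNear ((𝓡 n).prod (𝓡 n)) (𝓡 n) δ (g₀, g₀) ∧
      δ (g₀, g₀) = Γ.unit (Γ.tgt g₀) ∧
      (∀ᶠ q in 𝓝 (g₀, g₀), Γ.src q.1 = Γ.src q.2 → (δ q, q.2) ∈ Γ.dom ∧ Γ.mul (δ q, q.2) = q.1) ∧
      ∀ᶠ q in 𝓝 (Γ.unit (Γ.tgt g₀), g₀), q ∈ Γ.dom → δ (Γ.mul q, q.2) = q.1 := by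
  obtain ⟨F, _, _, hsub⟩ := Γ.src_submersion
  have := finiteDimensional_complement (hsub g₀).equiv
  have hdom := Γ.mem_dom_left g₀
  obtain ⟨m, hm, hm0, hmd⟩ := Γ.exists_mul_extension hdom
  rw [Γ.unit_mul] at hm0
  obtain ⟨D, hD, hbij⟩ := hreg
  have hinl : Tendsto (fun h => (h, g₀)) (𝓝 (Γ.unit (Γ.tgt g₀))) (𝓝 (Γ.unit (Γ.tgt g₀), g₀)) :=
    (continuous_id.prodMk continuous_const).continuousAt
  let D' : EuclideanSpace ℝ (Fin n) →L[ℝ] EuclideanSpace ℝ (Fin n) := D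
  have hbij' : BijOn D'
      {v : EuclideanSpace ℝ (Fin n) | mfderiv (𝓡 n) (𝓡 p) Γ.src (Γ.unit (Γ.tgt g₀)) v = 0}
      {v : EuclideanSpace ℝ (Fin n) | mfderiv (𝓡 n) (𝓡 p) Γ.src (Γ.mul (Γ.unit (Γ.tgt g₀), g₀)) v = 0} :=
    hbij
  have hker : {v : EuclideanSpace ℝ (Fin n) |
        mfderiv (𝓡 n) (𝓡 p) Γ.src (Γ.mul (Γ.unit (Γ.tgt g₀), g₀)) v = 0} =
      {v : EuclideanSpace ℝ (Fin n) | mfderiv (𝓡 n) (𝓡 p) Γ.src g₀ v = 0} := by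
    rw [Γ.unit_mul]
  rw [hker] at hbij'
  have hD' : HasMFDerivWithinAt (𝓡 n) (𝓡 n) (fun h => m (h, g₀)) {h | (h, g₀) ∈ Γ.dom}
      (Γ.unit (Γ.tgt g₀)) D' := by
    refine hD.congr_of_eventuallyEq ?_ (by simp only [hm0, Γ.unit_mul])
    filter_upwards [nhdsWithin_le_nhds (hinl.eventually hmd), self_mem_nhdsWithin] with h h1 h2
    exact (h1 (Γ.dom_composable _ _ h2)).2
  obtain ⟨δ, h1, h2, h3, h4⟩ := _root_.exists_division (s := Γ.src) (t := Γ.tgt) (m := m) hsub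
    (Γ.smoothNear_tgt g₀) hm (Γ.src_unit _) hm0 (by
      filter_upwards [hmd] with q h1 h2
      rw [(h1 h2).2, Γ.src_mul _ _ (h1 h2).1]) ⟨D', _, hD', by
      filter_upwards [hinl.eventually hmd] with h h1 h2
      exact (h1 h2).1, hbij'⟩
  refine ⟨δ, h1, h2, ?_, ?_⟩
  · have h5 : Tendsto (fun q : G × G => (δ q, q.2)) (𝓝 (g₀, g₀)) (𝓝 (Γ.unit (Γ.tgt g₀), g₀)) :=
      (h1.tendsto h2).prodMk_nhds continuousAt_snd
    filter_upwards [h3, h5.eventually hmd] with q h6 h7 h8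
    obtain ⟨h9, h10⟩ := h6 h8
    exact ⟨(h7 h9).1, (h7 h9).2.symm.trans h10⟩
  · filter_upwards [h4, hmd] with q h5 h6 h7
    have h8 := Γ.dom_composable _ _ h7
    rw [← (h6 h8).2]
    exact h5 h8

/-- Left division by elements near `g₀`. -/
theorem LeftRegularAt.exists_division {g₀ : G} (hreg : Γ.LeftRegularAt g₀) :
    ∃ δ : G × G → G, SmoothNear ((𝓡 n).prod (𝓡 n)) (𝓡 n) δ (g₀, g₀) ∧
      δ (g₀, g₀) = Γ.unit (Γ.src g₀) ∧
      (∀ᶠ q in 𝓝 (g₀, g₀), Γ.tgt q.1 = Γ.tgt q.2 →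
        (q.2, δ q) ∈ Γ.dom ∧ Γ.mul (q.2, δ q) = q.1) := by
  obtain ⟨F, _, _, hsub⟩ := Γ.tgt_submersion
  have := finiteDimensional_complement (hsub g₀).equiv
  have hdom := Γ.mem_dom_right g₀
  obtain ⟨m, hm, hm0, hmd⟩ := Γ.exists_mul_extension hdom
  rw [Γ.mul_unit] at hm0
  obtain ⟨D, hD, hbij⟩ := hreg
  have hinl : Tendsto (fun h => (g₀, h)) (𝓝 (Γ.unit (Γ.src g₀))) (𝓝 (g₀, Γ.unit (Γ.src g₀))) :=
    (continuous_const.prodMk continuous_id).continuousAt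
  have hswap : Tendsto (fun q : G × G => (q.2, q.1)) (𝓝 (Γ.unit (Γ.src g₀), g₀))
      (𝓝 (g₀, Γ.unit (Γ.src g₀))) :=
    (continuous_snd.prodMk continuous_fst).continuousAt
  let D' : EuclideanSpace ℝ (Fin n) →L[ℝ] EuclideanSpace ℝ (Fin n) := D
  have hbij' : BijOn D'
      {v : EuclideanSpace ℝ (Fin n) | mfderiv (𝓡 n) (𝓡 p) Γ.tgt (Γ.unit (Γ.src g₀)) v = 0}
      {v : EuclideanSpace ℝ (Fin n) | mfderiv (𝓡 n) (𝓡 p) Γ.tgt (Γ.mul (g₀, Γ.unit (Γ.src g₀))) v = 0} :=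
    hbij
  have hker : {v : EuclideanSpace ℝ (Fin n) |
        mfderiv (𝓡 n) (𝓡 p) Γ.tgt (Γ.mul (g₀, Γ.unit (Γ.src g₀))) v = 0} =
      {v : EuclideanSpace ℝ (Fin n) | mfderiv (𝓡 n) (𝓡 p) Γ.tgt g₀ v = 0} := by
    rw [Γ.mul_unit]
  rw [hker] at hbij'
  have hD' : HasMFDerivWithinAt (𝓡 n) (𝓡 n) (fun h => m (g₀, h)) {h | (g₀, h) ∈ Γ.dom}
      (Γ.unit (Γ.src g₀)) D' := by
    refine hD.congr_of_eventuallyEq ?_ (by simp only [hm0, Γ.mul_unit])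
    filter_upwards [nhdsWithin_le_nhds (hinl.eventually hmd), self_mem_nhdsWithin] with h h1 h2
    exact (h1 (Γ.dom_composable _ _ h2)).2
  have hms : SmoothNear ((𝓡 n).prod (𝓡 n)) (𝓡 n) (fun q : G × G => m (q.2, q.1))
      (Γ.unit (Γ.src g₀), g₀) := hm.comp ((SmoothNear.snd _).prodMk (.fst _)) rfl
  -- Left division is right division for the opposite multiplication, with source and target
  -- exchanged.
  obtain ⟨δ, h1, h2, h3, -⟩ := _root_.exists_division (s := Γ.tgt) (t := Γ.src)
    (m := fun q => m (q.2, q.1)) hsub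
    (Γ.smoothNear_src g₀) hms (Γ.tgt_unit _) hm0 (by
      filter_upwards [hswap.eventually hmd] with q h1 h2
      rw [(h1 h2.symm).2, Γ.tgt_mul _ _ (h1 h2.symm).1]) ⟨D', _, hD', by
      filter_upwards [hinl.eventually hmd] with h h1 h2
      exact (h1 h2.symm).1, hbij'⟩
  refine ⟨δ, h1, h2, ?_⟩
  have h5 : Tendsto (fun q : G × G => (q.2, δ q)) (𝓝 (g₀, g₀)) (𝓝 (g₀, Γ.unit (Γ.src g₀))) :=
    continuousAt_snd.tendsto.prodMk_nhds (h1.tendsto h2)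
  filter_upwards [h3, h5.eventually hmd] with q h6 h7 h8
  obtain ⟨h9, h10⟩ := h6 h8
  exact ⟨(h7 h9.symm).1, (h7 h9.symm).2.symm.trans h10⟩

end LocalLieGroupoid

namespace LocalLieGroupoid

open Filter

variable {p n : ℕ} {M G : Type*}
  [TopologicalSpace M] [ChartedSpace (EuclideanSpace ℝ (Fin p)) M] [IsManifold (𝓡 p) ∞ M]
  [T2Space M] [SecondCountableTopology M]
  [TopologicalSpace G] [ChartedSpace (EuclideanSpace ℝ (Fin n)) G] [IsManifold (𝓡 n) ∞ G]
  [SecondCountableTopology G]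
  (Γ : LocalLieGroupoid p n M G)

/-! ### Associators and equivalence of words -/

/-- `Γ.Reduces u w`: the word `u` can be cut into pieces that evaluate to the letters of `w`. -/
inductive Reduces : List G → List G → Prop
  | nil : Reduces [] []
  | cons {u v w : List G} {g : G} : Γ.EvaluatesTo u g → Reduces v w → Reduces (u ++ v) (g :: w)

variable {Γ}

theorem EvaluatesTo.reduces {u : List G} {g : G} (h : Γ.EvaluatesTo u g) : Γ.Reduces u [g] := by
  simpa using Reduces.cons h Reduces.nil

namespace Reduces

theorem refl (w : List G) : Γ.Reduces w w := by
  induction w with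
  | nil => exact nil
  | cons g w ih => exact cons (.single g) ih

theorem append {u w u' w' : List G} (h : Γ.Reduces u w) (h' : Γ.Reduces u' w') :
    Γ.Reduces (u ++ u') (w ++ w') := by
  induction h with
  | nil => exact h'
  | cons h1 _ ih => rw [List.append_assoc, List.cons_append]; exact cons h1 ih

theorem exists_append {u w w' : List G} (h : Γ.Reduces u (w ++ w')) :
    ∃ v v', u = v ++ v' ∧ Γ.Reduces v w ∧ Γ.Reduces v' w' := by
  induction w generalizing u with
  | nil => exact ⟨[], u, rfl, nil, h⟩
  | cons g w ih =>
    rw [List.cons_append] at h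
    cases h with
    | @cons u₁ u₂ _ _ h1 h2 =>
      obtain ⟨v, v', rfl, h3, h4⟩ := ih h2
      exact ⟨u₁ ++ v, v', by simp, cons h1 h3, h4⟩

theorem evaluatesTo_single {u : List G} {g : G} (h : Γ.Reduces u [g]) : Γ.EvaluatesTo u g := by
  cases h with
  | cons h1 h2 => cases h2; simpa using h1

theorem evaluatesTo {u w : List G} {g : G} (h : Γ.Reduces u w) (hw : Γ.EvaluatesTo w g) :
    Γ.EvaluatesTo u g := by
  induction hw generalizing u with
  | single g => exact h.evaluatesTo_single
  | mul _ _ hd ih ih' =>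
    obtain ⟨v, v', rfl, h1, h2⟩ := h.exists_append
    exact .mul (ih h1) (ih' h2) hd

theorem trans {u v w : List G} (h : Γ.Reduces u v) (h' : Γ.Reduces v w) : Γ.Reduces u w := by
  induction h' generalizing u with
  | nil => exact h
  | cons h1 _ ih =>
    obtain ⟨u₁, u₂, rfl, h3, h4⟩ := h.exists_append
    exact cons (h3.evaluatesTo h1) (ih h4)

theorem contract (l r : List G) {g h : G} (hgh : (g, h) ∈ Γ.dom) :
    Γ.Reduces (l ++ g :: h :: r) (l ++ Γ.mul (g, h) :: r) :=
  (refl l).append (cons (EvaluatesTo.mul (.single g) (.single h) hgh) (refl r))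

end Reduces

theorem EvaluatesTo.exists_cons {u : List G} {g : G} (h : Γ.EvaluatesTo u g) :
    ∃ a v, u = a :: v ∧ Γ.tgt a = Γ.tgt g := by
  induction h with
  | single g => exact ⟨g, [], rfl, rfl⟩
  | mul _ _ hd ih _ =>
    obtain ⟨a, v, rfl, ha⟩ := ih
    exact ⟨a, _, rfl, by rw [ha, Γ.tgt_mul _ _ hd]⟩

theorem EvaluatesTo.exists_concat {u : List G} {g : G} (h : Γ.EvaluatesTo u g) :
    ∃ v a, u = v ++ [a] ∧ Γ.src a = Γ.src g := by
  induction h with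
  | single g => exact ⟨[], g, rfl, rfl⟩
  | mul _ _ hd _ ih =>
    obtain ⟨v, a, rfl, ha⟩ := ih
    exact ⟨_ ++ v, a, (List.append_assoc _ _ _).symm, by rw [ha, Γ.src_mul _ _ hd]⟩

theorem EvaluatesTo.unit_cons_reduces {u : List G} {g : G} (h : Γ.EvaluatesTo u g) :
    Γ.Reduces (Γ.unit (Γ.tgt g) :: u) u := by
  obtain ⟨a, v, rfl, ha⟩ := h.exists_cons
  rw [← ha]
  have := Reduces.contract [] v (Γ.mem_dom_left a)
  rwa [Γ.unit_mul] at this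

theorem EvaluatesTo.concat_unit_reduces {u : List G} {g : G} (h : Γ.EvaluatesTo u g) :
    Γ.Reduces (u ++ [Γ.unit (Γ.src g)]) u := by
  obtain ⟨v, a, rfl, ha⟩ := h.exists_concat
  rw [← ha]
  have := Reduces.contract v [] (Γ.mem_dom_right a)
  rw [Γ.mul_unit] at this
  simpa using this

/-- The pair `(g, k)` can be recovered from `gk` by inserting on the right a word that evaluates to
a unit. -/
def RightRecoverable (Γ : LocalLieGroupoid p n M G) (g k : G) : Prop :=
  ∃ r, Γ.EvaluatesTo r (Γ.unit (Γ.src k)) ∧ Γ.Reduces (Γ.mul (g, k) :: r) [g, k]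

/-- The pair `(k, h)` can be recovered from `kh` by inserting on the left a word that evaluates to
a unit. -/
def LeftRecoverable (Γ : LocalLieGroupoid p n M G) (k h : G) : Prop :=
  ∃ r, Γ.EvaluatesTo r (Γ.unit (Γ.tgt k)) ∧ Γ.Reduces (r ++ [Γ.mul (k, h)]) [k, h]

/-- Here `c` acts as the inverse of `b`. If `r` works for `k`, then `c r b` works for `kb`: it
evaluates to `(c 1) b = 1`, and `(g(kb)) c r b` contracts to `(gk) r b`, then to `g k b`, then to `g
(kb)`. -/
theorem RightRecoverable.mul {g k b c : G} (h : Γ.RightRecoverable g k)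
    (h1 : (k, b) ∈ Γ.dom) (h2 : (Γ.mul (g, Γ.mul (k, b)), c) ∈ Γ.dom)
    (h3 : Γ.mul (Γ.mul (g, Γ.mul (k, b)), c) = Γ.mul (g, k)) (h4 : (c, b) ∈ Γ.dom)
    (h5 : Γ.mul (c, b) = Γ.unit (Γ.src b)) :
    Γ.RightRecoverable g (Γ.mul (k, b)) := by
  obtain ⟨r, hr, hr'⟩ := h
  have hc : Γ.src k = Γ.src c := by rw [Γ.dom_composable _ _ h1, Γ.dom_composable _ _ h4]
  rw [hc] at hr
  refine ⟨(c :: r) ++ [b], ?_, ?_⟩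
  · have h6 : Γ.EvaluatesTo (c :: r) (Γ.mul (c, Γ.unit (Γ.src c))) :=
      .mul (.single c) hr (Γ.mem_dom_right c)
    rw [Γ.mul_unit] at h6
    have h7 := EvaluatesTo.mul h6 (.single b) h4
    rwa [h5, ← Γ.src_mul _ _ h1] at h7
  · have h6 : Γ.Reduces (Γ.mul (g, Γ.mul (k, b)) :: (c :: r ++ [b])) (Γ.mul (g, k) :: (r ++ [b])) := by
      have := Reduces.contract [] (r ++ [b]) h2
      rwa [h3] at this
    refine h6.trans ((hr'.append (.refl [b])).trans ?_)
    exact Reduces.contract [g] [] h1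

/-- The mirror image: the inserted word is `b r c`. -/
theorem LeftRecoverable.mul {k h b c : G} (hk : Γ.LeftRecoverable k h)
    (h1 : (b, k) ∈ Γ.dom) (h2 : (c, Γ.mul (Γ.mul (b, k), h)) ∈ Γ.dom)
    (h3 : Γ.mul (c, Γ.mul (Γ.mul (b, k), h)) = Γ.mul (k, h)) (h4 : (b, c) ∈ Γ.dom)
    (h5 : Γ.mul (b, c) = Γ.unit (Γ.tgt b)) :
    Γ.LeftRecoverable (Γ.mul (b, k)) h := by
  obtain ⟨r, hr, hr'⟩ := hk
  have hc : Γ.tgt k = Γ.tgt c := by rw [← Γ.dom_composable _ _ h1, Γ.dom_composable _ _ h4]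
  rw [hc] at hr
  refine ⟨b :: (r ++ [c]), ?_, ?_⟩
  · have h6 : Γ.EvaluatesTo (r ++ [c]) (Γ.mul (Γ.unit (Γ.tgt c), c)) :=
      .mul hr (.single c) (Γ.mem_dom_left c)
    rw [Γ.unit_mul] at h6
    have h7 := EvaluatesTo.mul (.single b) h6 h4
    rwa [h5, ← Γ.tgt_mul _ _ h1] at h7
  · have h6 : Γ.Reduces (b :: (r ++ [c]) ++ [Γ.mul (Γ.mul (b, k), h)]) ((b :: r) ++ [Γ.mul (k, h)]) := by
      have := Reduces.contract (b :: r) [] h2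
      rw [h3] at this
      simpa using this
    refine h6.trans (Reduces.trans (v := b :: [k, h]) ?_ ?_)
    · exact (Reduces.refl [b]).append hr'
    · exact Reduces.contract [] [h] h1

/-- Left division writes a nearby `k` as `k₀ b` with `b` close to a unit, hence invertible. All
products needed are then defined by continuity, and 3-associativity supplies the identities for
`RightRecoverable.mul`. Passing from `k₀` to `k` uses `b`, and passing back uses its inverse. -/
theorem eventually_rightRecoverable_iff (hassoc : Γ.ThreeAssociative) {g k₀ : G}
    (hreg : Γ.LeftRegularAt k₀) (h₀ : (g, k₀) ∈ Γ.dom) :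
    ∀ᶠ k in 𝓝 k₀, (g, k) ∈ Γ.dom → (Γ.RightRecoverable g k ↔ Γ.RightRecoverable g k₀) := by
  obtain ⟨δ, hδ, hδ0, hδ1⟩ := hreg.exists_division
  -- Only those `k` matter that `g` can multiply; they all have the target of `k₀`, so division by
  -- `k₀` applies.
  let l : Filter G := 𝓝 k₀ ⊓ 𝓟 {k | (g, k) ∈ Γ.dom}
  have hl : ∀ᶠ k in l, (g, k) ∈ Γ.dom := mem_inf_of_right (mem_principal_self _)
  have hid : Tendsto (fun k : G => k) l (𝓝 k₀) := inf_le_left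
  have hgk₀ := Γ.dom_composable _ _ h₀
  have ht : ∀ᶠ k in l, Γ.tgt k = Γ.tgt k₀ := by
    filter_upwards [hl] with k hk
    rw [← hgk₀, Γ.dom_composable _ _ hk]
  let b : G → G := fun k => δ (k, k₀)
  have hpair : Tendsto (fun k : G => (k, k₀)) l (𝓝 (k₀, k₀)) := hid.prodMk_nhds tendsto_const_nhds
  have hb : Tendsto b l (𝓝 (Γ.unit (Γ.src k₀))) := (hδ.tendsto hδ0).comp hpair
  have hkb : ∀ᶠ k in l, (k₀, b k) ∈ Γ.dom ∧ Γ.mul (k₀, b k) = k := by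
    filter_upwards [hpair.eventually hδ1, ht] with k h1 h2 using h1 h2
  have hbi : ∀ᶠ k in l, b k ∈ Γ.invDom :=
    hb.eventually (Γ.invDom_open.mem_nhds (Γ.unit_mem_invDom _))
  have hbc : Tendsto (fun k => Γ.inv (b k)) l (𝓝 (Γ.inv (Γ.unit (Γ.src k₀)))) :=
    ((Γ.inv_smooth.continuousOn.continuousAt
      (Γ.invDom_open.mem_nhds (Γ.unit_mem_invDom _))).tendsto).comp hb
  have hinvu : Γ.inv (Γ.unit (Γ.src k₀)) = Γ.unit (Γ.src k₀) := by
    have hu := Γ.unit_mem_invDom (Γ.src k₀)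
    have h1 := Γ.inv_mul _ hu
    rw [Γ.src_unit] at h1
    have h2 := Γ.mul_unit (Γ.inv (Γ.unit (Γ.src k₀)))
    rw [Γ.src_inv _ hu, Γ.tgt_unit] at h2
    rw [← h2, h1]
  rw [hinvu] at hbc
  have hmk : (Γ.mul (g, k₀), Γ.unit (Γ.src k₀)) ∈ Γ.dom := by
    rw [← Γ.src_mul _ _ h₀]; exact Γ.mem_dom_right _
  -- `(g k₀) b = g k`
  have e1 : ∀ᶠ k in l, (Γ.mul (g, k₀), b k) ∈ Γ.dom := by
    refine eventually_dom hmk tendsto_const_nhds hb ?_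
    filter_upwards [hkb] with k h1
    rw [Γ.src_mul _ _ h₀, Γ.dom_composable _ _ h1.1]
  have hgk : Tendsto (fun k => Γ.mul (g, k)) l (𝓝 (Γ.mul (g, k₀))) :=
    tendsto_mul h₀ tendsto_const_nhds hid (hl.mono fun k h => Γ.dom_composable _ _ h)
  have e2 : ∀ᶠ k in l, (Γ.mul (g, k), Γ.inv (b k)) ∈ Γ.dom := by
    refine eventually_dom hmk hgk hbc ?_
    filter_upwards [hkb, hbi, hl] with k h1 h2 h3
    rw [Γ.src_mul _ _ h3, Γ.tgt_inv _ h2]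
    conv_lhs => rw [← h1.2, Γ.src_mul _ _ h1.1]
  have e3 : ∀ᶠ k in l, (k, Γ.inv (b k)) ∈ Γ.dom := by
    refine eventually_dom (Γ.mem_dom_right k₀) hid hbc ?_
    filter_upwards [hkb, hbi] with k h1 h2
    rw [Γ.tgt_inv _ h2]
    conv_lhs => rw [← h1.2, Γ.src_mul _ _ h1.1]
  have key : ∀ᶠ k in l, (Γ.RightRecoverable g k ↔ Γ.RightRecoverable g k₀) := by
    filter_upwards [hkb, hbi, hl, e1, e2, e3] with k ⟨h1, h1'⟩ h2 h3 h4 h5 h6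
    have h2' := Γ.inv_mem _ h2
    have hbb : (b k, Γ.inv (b k)) ∈ Γ.dom := Γ.invDom_dom _ h2 _ h2' (Γ.tgt_inv _ h2).symm
    have hbb' : (Γ.inv (b k), b k) ∈ Γ.dom := Γ.invDom_dom _ h2' _ h2 (Γ.src_inv _ h2)
    have hk₀b : Γ.src k₀ = Γ.tgt (b k) := Γ.dom_composable _ _ h1
    have h7 : Γ.mul (Γ.mul (g, k₀), b k) = Γ.mul (g, k) := by
      rw [hassoc _ _ _ h₀ h1 h4 (by rwa [h1']), h1']
    have h8 : Γ.mul (k, Γ.inv (b k)) = k₀ := by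
      have := hassoc k₀ (b k) (Γ.inv (b k)) h1 hbb (by rwa [h1'])
        (by rw [Γ.mul_inv _ h2, ← hk₀b]; exact Γ.mem_dom_right _)
      rwa [h1', Γ.mul_inv _ h2, ← hk₀b, Γ.mul_unit] at this
    have h9 : Γ.mul (Γ.mul (g, k), Γ.inv (b k)) = Γ.mul (g, k₀) := by
      have := hassoc g k (Γ.inv (b k)) h3 h6 h5 (by rwa [h8])
      rwa [h8] at this
    constructor
    · intro h
      have := h.mul (b := Γ.inv (b k)) (c := b k) h6 (by rwa [h8]) (by rw [h8]; exact h7) hbb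
        (by rw [Γ.mul_inv _ h2, Γ.src_inv _ h2])
      rwa [h8] at this
    · intro h
      have := h.mul (b := b k) (c := Γ.inv (b k)) h1 (by rwa [h1']) (by rw [h1']; exact h9) hbb'
        (Γ.inv_mul _ h2)
      rwa [h1'] at this
  exact eventually_inf_principal.1 key

theorem eventually_leftRecoverable_iff (hassoc : Γ.ThreeAssociative) {k₀ h : G}
    (hreg : Γ.RightRegularAt k₀) (h₀ : (k₀, h) ∈ Γ.dom) :
    ∀ᶠ k in 𝓝 k₀, (k, h) ∈ Γ.dom → (Γ.LeftRecoverable k h ↔ Γ.LeftRecoverable k₀ h) := by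
  obtain ⟨δ, hδ, hδ0, hδ1, -⟩ := hreg.exists_division
  let l : Filter G := 𝓝 k₀ ⊓ 𝓟 {k | (k, h) ∈ Γ.dom}
  have hl : ∀ᶠ k in l, (k, h) ∈ Γ.dom := mem_inf_of_right (mem_principal_self _)
  have hid : Tendsto (fun k : G => k) l (𝓝 k₀) := inf_le_left
  have hgk₀ := Γ.dom_composable _ _ h₀
  have ht : ∀ᶠ k in l, Γ.src k = Γ.src k₀ := by
    filter_upwards [hl] with k hk
    rw [hgk₀, Γ.dom_composable _ _ hk]
  let b : G → G := fun k => δ (k, k₀)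
  have hpair : Tendsto (fun k : G => (k, k₀)) l (𝓝 (k₀, k₀)) := hid.prodMk_nhds tendsto_const_nhds
  have hb : Tendsto b l (𝓝 (Γ.unit (Γ.tgt k₀))) := (hδ.tendsto hδ0).comp hpair
  have hkb : ∀ᶠ k in l, (b k, k₀) ∈ Γ.dom ∧ Γ.mul (b k, k₀) = k := by
    filter_upwards [hpair.eventually hδ1, ht] with k h1 h2 using h1 h2
  have hbi : ∀ᶠ k in l, b k ∈ Γ.invDom :=
    hb.eventually (Γ.invDom_open.mem_nhds (Γ.unit_mem_invDom _))
  have hbc : Tendsto (fun k => Γ.inv (b k)) l (𝓝 (Γ.inv (Γ.unit (Γ.tgt k₀)))) :=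
    ((Γ.inv_smooth.continuousOn.continuousAt
      (Γ.invDom_open.mem_nhds (Γ.unit_mem_invDom _))).tendsto).comp hb
  have hinvu : Γ.inv (Γ.unit (Γ.tgt k₀)) = Γ.unit (Γ.tgt k₀) := by
    have hu := Γ.unit_mem_invDom (Γ.tgt k₀)
    have h1 := Γ.inv_mul _ hu
    rw [Γ.src_unit] at h1
    have h2 := Γ.mul_unit (Γ.inv (Γ.unit (Γ.tgt k₀)))
    rw [Γ.src_inv _ hu, Γ.tgt_unit] at h2
    rw [← h2, h1]
  rw [hinvu] at hbc
  have hmk : (Γ.unit (Γ.tgt k₀), Γ.mul (k₀, h)) ∈ Γ.dom := by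
    rw [← Γ.tgt_mul _ _ h₀]; exact Γ.mem_dom_left _
  have e1 : ∀ᶠ k in l, (b k, Γ.mul (k₀, h)) ∈ Γ.dom := by
    refine eventually_dom hmk hb tendsto_const_nhds ?_
    filter_upwards [hkb] with k h1
    rw [Γ.tgt_mul _ _ h₀, Γ.dom_composable _ _ h1.1]
  have hgk : Tendsto (fun k => Γ.mul (k, h)) l (𝓝 (Γ.mul (k₀, h))) :=
    tendsto_mul h₀ hid tendsto_const_nhds (hl.mono fun k h => Γ.dom_composable _ _ h)
  have e2 : ∀ᶠ k in l, (Γ.inv (b k), Γ.mul (k, h)) ∈ Γ.dom := by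
    refine eventually_dom hmk hbc hgk ?_
    filter_upwards [hkb, hbi, hl] with k h1 h2 h3
    rw [Γ.tgt_mul _ _ h3, Γ.src_inv _ h2]
    conv_rhs => rw [← h1.2, Γ.tgt_mul _ _ h1.1]
  have e3 : ∀ᶠ k in l, (Γ.inv (b k), k) ∈ Γ.dom := by
    refine eventually_dom (Γ.mem_dom_left k₀) hbc hid ?_
    filter_upwards [hkb, hbi] with k h1 h2
    rw [Γ.src_inv _ h2]
    conv_rhs => rw [← h1.2, Γ.tgt_mul _ _ h1.1]
  have key : ∀ᶠ k in l, (Γ.LeftRecoverable k h ↔ Γ.LeftRecoverable k₀ h) := by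
    filter_upwards [hkb, hbi, hl, e1, e2, e3] with k ⟨h1, h1'⟩ h2 h3 h4 h5 h6
    have h2' := Γ.inv_mem _ h2
    have hbb : (b k, Γ.inv (b k)) ∈ Γ.dom := Γ.invDom_dom _ h2 _ h2' (Γ.tgt_inv _ h2).symm
    have hbb' : (Γ.inv (b k), b k) ∈ Γ.dom := Γ.invDom_dom _ h2' _ h2 (Γ.src_inv _ h2)
    have hk₀b : Γ.src (b k) = Γ.tgt k₀ := Γ.dom_composable _ _ h1
    have h7 : Γ.mul (b k, Γ.mul (k₀, h)) = Γ.mul (k, h) := by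
      rw [← hassoc _ _ _ h1 h₀ (by rwa [h1']) h4, h1']
    have h8 : Γ.mul (Γ.inv (b k), k) = k₀ := by
      have := hassoc (Γ.inv (b k)) (b k) k₀ hbb' h1
        (by rw [Γ.inv_mul _ h2, hk₀b]; exact Γ.mem_dom_left _) (by rwa [h1'])
      rw [h1', Γ.inv_mul _ h2, hk₀b, Γ.unit_mul] at this
      exact this.symm
    have h9 : Γ.mul (Γ.inv (b k), Γ.mul (k, h)) = Γ.mul (k₀, h) := by
      have := hassoc (Γ.inv (b k)) k h h6 h3 (by rwa [h8]) h5
      rw [h8] at this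
      exact this.symm
    constructor
    · intro h
      have := h.mul (b := Γ.inv (b k)) (c := b k) h6 (by rwa [h8]) (by rw [h8]; exact h7) hbb'
        (by rw [Γ.inv_mul _ h2, Γ.tgt_inv _ h2])
      rwa [h8] at this
    · intro h
      have := h.mul (b := b k) (c := Γ.inv (b k)) h1 (by rwa [h1']) (by rw [h1']; exact h9) hbb
        (Γ.mul_inv _ h2)
      rwa [h1'] at this
  exact eventually_inf_principal.1 key

/-- Such a predicate is locally constant, and the interval is connected. -/
theorem path_induction {P : unitInterval → Prop} (h : ∀ τ, ∀ᶠ τ' in 𝓝 τ, (P τ' ↔ P τ)) (h0 : P 0) :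
    P 1 := by
  have hc : IsLocallyConstant P := by
    refine (IsLocallyConstant.iff_eventually_eq P).2 fun τ => ?_
    filter_upwards [h τ] with τ' h1 using propext h1
  rw [hc.apply_eq_of_preconnectedSpace 1 0]
  exact h0

/-- This trades an expansion for contractions, at the price of inserting words that evaluate to
units. It is the only use of the paths to the axes: recoverability is locally constant along the
path and trivial at its unit end. One of `r`, `r'` comes from the path and the other is a single
unit. -/
theorem exists_reduces_pair (hassoc : Γ.ThreeAssociative) (hreg : Γ.BiRegular)
    (haxes : Γ.ProductsConnectedToAxes) {g h : G} (hgh : (g, h) ∈ Γ.dom) :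
    ∃ r r', Γ.EvaluatesTo r (Γ.unit (Γ.tgt g)) ∧ Γ.EvaluatesTo r' (Γ.unit (Γ.src h)) ∧
      Γ.Reduces (r ++ Γ.mul (g, h) :: r') [g, h] := by
  obtain ⟨γ, hγ⟩ | ⟨γ, hγ⟩ := haxes g h hgh
  · obtain ⟨r, hr, hr'⟩ : Γ.LeftRecoverable g h := by
      have := path_induction (P := fun τ => Γ.LeftRecoverable (γ τ) h) (fun τ => by
        filter_upwards [γ.continuous.continuousAt.eventually
          (eventually_leftRecoverable_iff hassoc (hreg (γ τ)).2 (hγ τ))] with τ' h1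
        exact h1 (hγ τ')) (by
        simp only [γ.source]
        refine ⟨[Γ.unit (Γ.tgt h)], by rw [Γ.tgt_unit]; exact .single _, ?_⟩
        rw [Γ.unit_mul]
        exact .refl _)
      simpa using this
    refine ⟨r, [Γ.unit (Γ.src h)], hr, .single _, ?_⟩
    have h1 : Γ.Reduces ([Γ.mul (g, h)] ++ [Γ.unit (Γ.src h)]) [Γ.mul (g, h)] := by
      have := EvaluatesTo.concat_unit_reduces (Γ := Γ) (.single (Γ.mul (g, h)))
      rwa [Γ.src_mul _ _ hgh] at this
    exact ((Reduces.refl r).append h1).trans hr'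
  · obtain ⟨r, hr, hr'⟩ : Γ.RightRecoverable g h := by
      have := path_induction (P := fun τ => Γ.RightRecoverable g (γ τ)) (fun τ => by
        filter_upwards [γ.continuous.continuousAt.eventually
          (eventually_rightRecoverable_iff hassoc (hreg (γ τ)).1 (hγ τ))] with τ' h1
        exact h1 (hγ τ')) (by
        simp only [γ.source]
        refine ⟨[Γ.unit (Γ.src g)], by rw [Γ.src_unit]; exact .single _, ?_⟩
        rw [Γ.mul_unit]
        exact .refl _)
      simpa using this
    refine ⟨[Γ.unit (Γ.tgt g)], r, .single _, hr, ?_⟩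
    have h1 : Γ.Reduces ([Γ.unit (Γ.tgt g)] ++ [Γ.mul (g, h)]) [Γ.mul (g, h)] := by
      have := EvaluatesTo.unit_cons_reduces (Γ := Γ) (.single (Γ.mul (g, h)))
      rwa [Γ.tgt_mul _ _ hgh] at this
    have h2 := (h1.append (.refl r)).trans hr'
    simpa using h2

variable (hassoc : Γ.ThreeAssociative) (hreg : Γ.BiRegular) (haxes : Γ.ProductsConnectedToAxes)
include hassoc hreg haxes

/-- Induction on the first evaluation. If its last product is `ab`, then `r u' r'` contracts to
`u'`, since `r` and `r'` evaluate to units. It also contracts through `r (ab) r'` to `a b`, so it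
splits into a part evaluating to `a` and a part evaluating to `b`. The induction hypotheses compare
these parts with the two halves of the first word. -/
theorem EvaluatesTo.exists_common_expansion {u u' : List G} {g : G} (h : Γ.EvaluatesTo u g)
    (h' : Γ.EvaluatesTo u' g) : ∃ v, Γ.Reduces v u ∧ Γ.Reduces v u' := by
  induction h generalizing u' with
  | single g => exact ⟨u', h'.reduces, .refl _⟩
  | @mul w w' a b h1 h2 hd ih1 ih2 =>
    obtain ⟨r, r', hr, hr', hred⟩ := exists_reduces_pair hassoc hreg haxes hd
    have h3 : Γ.Reduces (r ++ (u' ++ r')) ([a] ++ [b]) :=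
      ((Reduces.refl r).append (h'.reduces.append (.refl r'))).trans hred
    have h4 : Γ.Reduces (r ++ (u' ++ r')) u' := by
      have h5 : Γ.Reduces (u' ++ r') u' := by
        rw [← Γ.src_mul _ _ hd] at hr'
        exact ((Reduces.refl u').append hr'.reduces).trans h'.concat_unit_reduces
      rw [← Γ.tgt_mul _ _ hd] at hr
      exact (hr.reduces.append h5).trans h'.unit_cons_reduces
    obtain ⟨v, v', hv, h5, h6⟩ := h3.exists_append
    obtain ⟨z, hz1, hz2⟩ := ih1 h5.evaluatesTo_single
    obtain ⟨z', hz1', hz2'⟩ := ih2 h6.evaluatesTo_single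
    refine ⟨z ++ z', hz1.append hz1', (hz2.append hz2').trans ?_⟩
    rwa [← hv]

theorem Reduces.exists_common_expansion {u u' w : List G} (h : Γ.Reduces u w)
    (h' : Γ.Reduces u' w) : ∃ v, Γ.Reduces v u ∧ Γ.Reduces v u' := by
  induction h generalizing u' with
  | nil => cases h'; exact ⟨[], .nil, .nil⟩
  | cons h1 _ ih =>
    cases h' with
    | cons h2 h3 =>
      obtain ⟨v, hv, hv'⟩ := h1.exists_common_expansion hassoc hreg haxes h2
      obtain ⟨z, hz, hz'⟩ := ih h3
      exact ⟨v ++ z, hv.append hz, hv'.append hz'⟩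

/-- Two expansions of one word have a common expansion themselves, so a zigzag can be straightened:
at each transitivity step the two expansions of the middle word are joined. -/
theorem exists_common_expansion {w w' : Γ.Word} (h : Relation.EqvGen Γ.Contracts w w') :
    ∃ v, Γ.Reduces v w.1 ∧ Γ.Reduces v w'.1 := by
  induction h with
  | rel w w' h =>
    obtain ⟨l, r, g, h, hd, e, e'⟩ := h
    exact ⟨w.1, .refl _, by rw [e, e']; exact .contract l r hd⟩
  | refl w => exact ⟨w.1, .refl _, .refl _⟩
  | symm _ _ _ ih => obtain ⟨v, h1, h2⟩ := ih; exact ⟨v, h2, h1⟩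
  | trans _ _ _ _ _ ih ih' =>
    obtain ⟨v, h1, h2⟩ := ih
    obtain ⟨v', h1', h2'⟩ := ih'
    obtain ⟨z, hz, hz'⟩ := h2.exists_common_expansion hassoc hreg haxes h1'
    exact ⟨z, hz.trans h1, hz'.trans h2'⟩

theorem exists_evaluatesTo_of_toAC_eq {g h : G} (e : Γ.toAC g = Γ.toAC h) :
    ∃ w, Γ.EvaluatesTo w g ∧ Γ.EvaluatesTo w h := by
  obtain ⟨v, h1, h2⟩ := exists_common_expansion hassoc hreg haxes
    (Quotient.exact (s := Γ.wordSetoid) e)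
  exact ⟨v, h1.evaluatesTo_single, h2.evaluatesTo_single⟩

/-- With the converse `toAC_eq_unit_of_mem_assoc`, this says that associators are exactly the
elements identified with units in the completion. -/
theorem mem_assoc_of_toAC_eq {g : G} {x : M} (e : Γ.toAC g = Γ.toAC (Γ.unit x)) : g ∈ Γ.Assoc := by
  have hs : Γ.src g = x := (congrArg Γ.acSrc e).trans (Γ.src_unit x)
  have ht : Γ.tgt g = x := (congrArg Γ.acTgt e).trans (Γ.tgt_unit x)
  obtain ⟨w, h1, h2⟩ := exists_evaluatesTo_of_toAC_eq hassoc hreg haxes e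
  exact ⟨x, hs, ht, w, h2, h1⟩

end LocalLieGroupoid

namespace LocalLieGroupoid

open Filter

variable {p n : ℕ} {M G : Type*}
  [TopologicalSpace M] [ChartedSpace (EuclideanSpace ℝ (Fin p)) M] [IsManifold (𝓡 p) ∞ M]
  [T2Space M] [SecondCountableTopology M]
  [TopologicalSpace G] [ChartedSpace (EuclideanSpace ℝ (Fin n)) G] [IsManifold (𝓡 n) ∞ G]
  [SecondCountableTopology G]
  (Γ : LocalLieGroupoid p n M G)

/-! ### Words with given source and target -/

/-- `Γ.IsWord w y x`: the (possibly empty) word `w` is well-formed with target `y` and source `x`. -/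
def IsWord : List G → M → M → Prop
  | [], y, x => y = x
  | g :: w, y, x => Γ.tgt g = y ∧ IsWord w (Γ.src g) x

variable {Γ}

@[simp]
theorem isWord_nil {y x : M} : Γ.IsWord [] y x ↔ y = x := Iff.rfl

@[simp]
theorem isWord_cons {g : G} {w : List G} {y x : M} :
    Γ.IsWord (g :: w) y x ↔ Γ.tgt g = y ∧ Γ.IsWord w (Γ.src g) x := Iff.rfl

theorem isWord_append {u v : List G} {y x : M} :
    Γ.IsWord (u ++ v) y x ↔ ∃ z, Γ.IsWord u y z ∧ Γ.IsWord v z x := by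
  induction u generalizing y with
  | nil => simp
  | cons g u ih =>
    simp only [List.cons_append, isWord_cons, ih]
    exact ⟨fun ⟨h1, z, h2, h3⟩ => ⟨z, ⟨h1, h2⟩, h3⟩, fun ⟨z, ⟨h1, h2⟩, h3⟩ => ⟨h1, z, h2, h3⟩⟩

theorem IsWord.append {u v : List G} {y z x : M} (hu : Γ.IsWord u y z) (hv : Γ.IsWord v z x) :
    Γ.IsWord (u ++ v) y x := isWord_append.2 ⟨z, hu, hv⟩

theorem IsWord.tgt_unique {u : List G} {y x y' x' : M} (h : Γ.IsWord u y x) (h' : Γ.IsWord u y' x')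
    (hu : u ≠ []) : y = y' := by
  cases u with
  | nil => exact absurd rfl hu
  | cons g u => exact h.1.symm.trans h'.1

theorem IsWord.src_unique {u : List G} {y x x' : M} (h : Γ.IsWord u y x) (h' : Γ.IsWord u y x') :
    x = x' := by
  induction u generalizing y with
  | nil => exact h.symm.trans h'
  | cons g u ih => exact ih h.2 h'.2

theorem wellFormed_iff {w : List G} :
    Γ.WellFormed w ↔ w ≠ [] ∧ ∃ y x, Γ.IsWord w y x := by
  refine and_congr_right fun _ => ?_
  induction w with
  | nil => cases isEmpty_or_nonempty M <;> simp_all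
  | cons g w ih =>
    cases w with
    | nil => simp
    | cons h w =>
      rw [List.isChain_cons_cons, ih (by simp)]
      simp only [isWord_cons, exists_and_left, exists_eq_left']
      exact ⟨fun ⟨h1, h2⟩ => ⟨h1.symm, h2⟩, fun ⟨h1, h2⟩ => ⟨h1.symm, h2⟩⟩

theorem IsWord.wellFormed {w : List G} {y x : M} (h : Γ.IsWord w y x) (hw : w ≠ []) :
    Γ.WellFormed w := wellFormed_iff.2 ⟨hw, y, x, h⟩

theorem isWord_word (w : Γ.Word) : Γ.IsWord w.1 (Γ.wordTgt w) (Γ.wordSrc w) := by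
  obtain ⟨w, hw⟩ := w
  obtain ⟨h1, y, x, h2⟩ := wellFormed_iff.1 hw
  have hy : Γ.tgt (w.head h1) = y := by
    cases w with
    | nil => exact absurd rfl h1
    | cons g w => exact h2.1
  have hx : ∀ (w : List G) (h : w ≠ []) (y : M), Γ.IsWord w y x → Γ.src (w.getLast h) = x := by
    intro w
    induction w with
    | nil => exact fun h => absurd rfl h
    | cons g w ih =>
      intro _ y h
      cases w with
      | nil => exact h.2
      | cons g' w => exact ih (by simp) _ h.2
  have hx' := hx w h1 y h2
  simp only [wordTgt, wordSrc]
  rwa [hy, hx']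

variable (Γ) in
/-- Equivalence of lists of letters. -/
def Equivalent (u v : List G) : Prop :=
  ∃ (hu : Γ.WellFormed u) (hv : Γ.WellFormed v),
    Relation.EqvGen Γ.Contracts ⟨u, hu⟩ ⟨v, hv⟩

namespace Equivalent

theorem cls_eq {u v : List G} (h : Γ.Equivalent u v) :
    Γ.cls ⟨u, h.1⟩ = Γ.cls ⟨v, h.2.1⟩ :=
  Quotient.sound (s := Γ.wordSetoid) h.2.2

theorem of_cls_eq {u v : Γ.Word} (h : Γ.cls u = Γ.cls v) : Γ.Equivalent u.1 v.1 :=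
  ⟨u.2, v.2, Quotient.exact (s := Γ.wordSetoid) h⟩

theorem refl {u : List G} (hu : Γ.WellFormed u) : Γ.Equivalent u u := ⟨hu, hu, .refl _⟩

theorem symm {u v : List G} (h : Γ.Equivalent u v) : Γ.Equivalent v u := ⟨h.2.1, h.1, .symm _ _ h.2.2⟩

theorem trans {u v w : List G} (h : Γ.Equivalent u v) (h' : Γ.Equivalent v w) :
    Γ.Equivalent u w := ⟨h.1, h'.2.1, .trans _ _ _ h.2.2 h'.2.2⟩

theorem isWord {u v : List G} {y x : M} (h : Γ.Equivalent u v) (hu : Γ.IsWord u y x) :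
    Γ.IsWord v y x := by
  have h1 := isWord_word ⟨u, h.1⟩
  have h2 := isWord_word ⟨v, h.2.1⟩
  obtain rfl := hu.tgt_unique h1 h.1.1
  obtain rfl := hu.src_unique h1
  rwa [Γ.wordTgt_eq_of_rel h.2.2, Γ.wordSrc_eq_of_rel h.2.2]

theorem append {u u' v v' : List G} {y z x : M} (h : Γ.Equivalent u u') (h' : Γ.Equivalent v v')
    (hu : Γ.IsWord u y z) (hv : Γ.IsWord v z x) : Γ.Equivalent (u ++ v) (u' ++ v') := by
  have e1 : Γ.wordSrc ⟨u, h.1⟩ = Γ.wordTgt ⟨v, h'.1⟩ := by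
    have h1 := isWord_word ⟨u, h.1⟩
    have h2 := isWord_word ⟨v, h'.1⟩
    obtain rfl := hu.tgt_unique h1 h.1.1
    rw [← hu.src_unique h1]
    exact hv.tgt_unique h2 h'.1.1
  have e2 : Γ.wordSrc ⟨u', h.2.1⟩ = Γ.wordTgt ⟨v, h'.1⟩ := (Γ.wordSrc_eq_of_rel h.2.2).symm.trans e1
  have e3 : Γ.wordSrc ⟨u', h.2.1⟩ = Γ.wordTgt ⟨v', h'.2.1⟩ := e2.trans (Γ.wordTgt_eq_of_rel h'.2.2)
  exact of_cls_eq ((Γ.cls_append_left h.2.2 ⟨v, h'.1⟩ e1 e2).trans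
    (Γ.cls_append_right h'.2.2 ⟨u', h.2.1⟩ e2 e3))

end Equivalent

theorem isWord_contract_iff {l r : List G} {g h : G} (hgh : (g, h) ∈ Γ.dom) {y x : M} :
    Γ.IsWord (l ++ g :: h :: r) y x ↔ Γ.IsWord (l ++ Γ.mul (g, h) :: r) y x := by
  have hc := Γ.dom_composable _ _ hgh
  simp only [isWord_append, isWord_cons, Γ.tgt_mul _ _ hgh, Γ.src_mul _ _ hgh]
  exact ⟨fun ⟨z, h1, h2, _, h3⟩ => ⟨z, h1, h2, h3⟩, fun ⟨z, h1, h2, h3⟩ => ⟨z, h1, h2, hc.symm, h3⟩⟩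

theorem Equivalent.contract {l r : List G} {g h : G} (hgh : (g, h) ∈ Γ.dom)
    (hw : Γ.WellFormed (l ++ Γ.mul (g, h) :: r)) :
    Γ.Equivalent (l ++ g :: h :: r) (l ++ Γ.mul (g, h) :: r) := by
  obtain ⟨-, y, x, h1⟩ := wellFormed_iff.1 hw
  have h2 : Γ.WellFormed (l ++ g :: h :: r) :=
    ((isWord_contract_iff hgh).2 h1).wellFormed (by simp)
  exact ⟨h2, hw, .rel _ _ ⟨l, r, g, h, hgh, rfl, rfl⟩⟩

theorem Equivalent.unit_cons {w : List G} {y x : M} (hw : Γ.IsWord w y x) (hne : w ≠ []) :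
    Γ.Equivalent (Γ.unit y :: w) w := by
  cases w with
  | nil => exact absurd rfl hne
  | cons g w =>
    obtain ⟨rfl, h⟩ := hw
    have := Equivalent.contract (l := []) (r := w) (Γ.mem_dom_left g) (by
      rw [Γ.unit_mul]; exact IsWord.wellFormed (y := Γ.tgt g) (x := x) ⟨rfl, h⟩ (by simp))
    rwa [Γ.unit_mul] at this

theorem Equivalent.concat_unit {w : List G} {y x : M} (hw : Γ.IsWord w y x) (hne : w ≠ []) :
    Γ.Equivalent (w ++ [Γ.unit x]) w := by
  obtain ⟨w', g, rfl⟩ := List.eq_nil_or_concat' w |>.resolve_left hne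
  obtain ⟨z, h1, rfl, rfl⟩ := isWord_append.1 hw
  have := Equivalent.contract (l := w') (r := []) (Γ.mem_dom_right g) (by
    rw [Γ.mul_unit]; exact hw.wellFormed hne)
  rw [Γ.mul_unit] at this
  simpa using this

theorem EvaluatesTo.equivalent {u : List G} {g : G} (h : Γ.EvaluatesTo u g) :
    Γ.Equivalent u [g] := by
  induction h with
  | single g => exact .refl ⟨by simp, by simp⟩
  | @mul w w' g h _ _ hd ih ih' =>
    have hc := Γ.dom_composable _ _ hd
    have h1 : Γ.IsWord w (Γ.tgt g) (Γ.src g) := ih.symm.isWord ⟨rfl, rfl⟩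
    have h2 : Γ.IsWord w' (Γ.src g) (Γ.src h) := ih'.symm.isWord ⟨hc.symm, rfl⟩
    exact (ih.append ih' h1 h2).trans (Equivalent.contract (l := []) (r := []) hd ⟨by simp, by simp⟩)

theorem toAC_eq_iff {g h : G} : Γ.toAC g = Γ.toAC h ↔ Γ.Equivalent [g] [h] :=
  ⟨fun h => Equivalent.of_cls_eq h, fun h => h.cls_eq⟩

theorem toAC_eq_unit_of_mem_assoc {g : G} (h : g ∈ Γ.Assoc) : Γ.toAC g = Γ.toAC (Γ.unit (Γ.src g)) := by
  obtain ⟨x, rfl, -, w, h1, h2⟩ := h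
  exact toAC_eq_iff.2 (h2.equivalent.symm.trans h1.equivalent)

/-- The formal inverse of a word of invertible elements. -/
def invWord (Γ : LocalLieGroupoid p n M G) (w : List G) : List G := (w.map Γ.inv).reverse

theorem invWord_spec {w : List G} (hw : ∀ g ∈ w, g ∈ Γ.invDom) {y x : M} (h : Γ.IsWord w y x)
    (hne : w ≠ []) :
    Γ.IsWord (Γ.invWord w) x y ∧ Γ.Equivalent (w ++ Γ.invWord w) [Γ.unit y] ∧
      Γ.Equivalent (Γ.invWord w ++ w) [Γ.unit x] := by
  induction w generalizing y with
  | nil => exact absurd rfl hne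
  | cons g w ih =>
    obtain ⟨rfl, h⟩ := h
    have hg : g ∈ Γ.invDom := hw g (by simp)
    have hg' := Γ.inv_mem _ hg
    have e : Γ.invWord (g :: w) = Γ.invWord w ++ [Γ.inv g] := by simp [invWord]
    have hgi : Γ.IsWord [Γ.inv g] (Γ.src g) (Γ.tgt g) := ⟨Γ.tgt_inv _ hg, Γ.src_inv _ hg⟩
    have hgw : Γ.IsWord [g] (Γ.tgt g) (Γ.src g) := ⟨rfl, rfl⟩
    have hd : (g, Γ.inv g) ∈ Γ.dom := Γ.invDom_dom _ hg _ hg' (Γ.tgt_inv _ hg).symm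
    have hd' : (Γ.inv g, g) ∈ Γ.dom := Γ.invDom_dom _ hg' _ hg (Γ.src_inv _ hg)
    have e1 : Γ.Equivalent ([g] ++ [Γ.inv g]) [Γ.unit (Γ.tgt g)] := by
      have := Equivalent.contract (l := []) (r := []) hd ⟨by simp, by simp⟩
      rwa [Γ.mul_inv _ hg] at this
    have e2 : Γ.Equivalent ([Γ.inv g] ++ [g]) [Γ.unit (Γ.src g)] := by
      have := Equivalent.contract (l := []) (r := []) hd' ⟨by simp, by simp⟩
      rwa [Γ.inv_mul _ hg] at this
    rw [e]
    by_cases hw0 : w = []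
    · subst hw0
      obtain rfl : Γ.src g = x := h
      exact ⟨hgi, e1, e2⟩
    · obtain ⟨h1, h2, h3⟩ := ih (fun g' hg' => hw g' (by simp [hg'])) h hw0
      have r1 := Equivalent.refl (hgw.wellFormed (by simp))
      have r2 := Equivalent.refl (hgi.wellFormed (by simp))
      have hww := h.append h1
      refine ⟨h1.append hgi, ?_, ?_⟩
      · have h4 : Γ.Equivalent ([g] ++ ((w ++ Γ.invWord w) ++ [Γ.inv g]))
            ([g] ++ ([Γ.unit (Γ.src g)] ++ [Γ.inv g])) :=
          r1.append (h2.append r2 hww hgi) hgw (hww.append hgi)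
        have h5 : Γ.Equivalent ([g] ++ ([Γ.unit (Γ.src g)] ++ [Γ.inv g])) ([g] ++ [Γ.inv g]) :=
          r1.append (Equivalent.unit_cons hgi (by simp)) hgw
            ((h2.isWord hww).append hgi)
        have h6 := (h4.trans h5).trans e1
        simpa using h6
      · have rw' := Equivalent.refl (h.wellFormed hw0)
        have hnw : Γ.WellFormed (Γ.invWord w) := h1.wellFormed (by simpa [invWord] using hw0)
        have rn := Equivalent.refl hnw
        have h4 : Γ.Equivalent (Γ.invWord w ++ (([Γ.inv g] ++ [g]) ++ w))
            (Γ.invWord w ++ ([Γ.unit (Γ.src g)] ++ w)) :=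
          rn.append (e2.append rw' (hgi.append hgw) h) h1 ((hgi.append hgw).append h)
        have h5 : Γ.Equivalent (Γ.invWord w ++ ([Γ.unit (Γ.src g)] ++ w)) (Γ.invWord w ++ w) :=
          rn.append (Equivalent.unit_cons h hw0) h1 ((e2.isWord (hgi.append hgw)).append h)
        have h6 := (h4.trans h5).trans h3
        simpa using h6

theorem Inversional.exists_equivalent (hinv : Γ.Inversional) {w : List G} {y x : M}
    (hw : Γ.IsWord w y x) (hne : w ≠ []) :
    ∃ v, (∀ g ∈ v, g ∈ Γ.invDom) ∧ Γ.Equivalent w v := by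
  induction w generalizing y with
  | nil => exact absurd rfl hne
  | cons g w ih =>
    obtain ⟨v, hv, hvg⟩ := hinv g
    by_cases hw0 : w = []
    · subst hw0; exact ⟨v, hv, hvg.equivalent.symm⟩
    · obtain ⟨v', hv', e⟩ := ih hw.2 hw0
      refine ⟨v ++ v', fun a ha => ?_, ?_⟩
      · exact (List.mem_append.1 ha).elim (hv a) (hv' a)
      · exact hvg.equivalent.symm.append e (z := Γ.src g) (y := y) (x := x) ⟨hw.1, rfl⟩ hw.2

/-- Inversionality replaces `w` by an equivalent word of invertible letters, whose letterwise
inverses in reverse order form an inverse. -/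
theorem Inversional.exists_inverse (hinv : Γ.Inversional) {w : List G} {y x : M}
    (hw : Γ.IsWord w y x) (hne : w ≠ []) :
    ∃ v, v ≠ [] ∧ Γ.IsWord v x y ∧ Γ.Equivalent (w ++ v) [Γ.unit y] ∧
      Γ.Equivalent (v ++ w) [Γ.unit x] := by
  obtain ⟨u, hu, e⟩ := hinv.exists_equivalent hw hne
  have hu' := e.isWord hw
  obtain ⟨h1, h2, h3⟩ := invWord_spec hu hu' e.2.1.1
  have hne' : Γ.invWord u ≠ [] := by simpa [invWord] using e.2.1.1
  have r := Equivalent.refl (h1.wellFormed hne')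
  exact ⟨Γ.invWord u, hne', h1, (e.append r hw h1).trans h2, (r.append e h1 hw).trans h3⟩

theorem Inversional.cancel_right (hinv : Γ.Inversional) {u u' w : List G} {z x : M}
    (hw : Γ.IsWord w z x) (hne : w ≠ []) {y : M} (hu : Γ.IsWord u y z) (hu0 : u ≠ [])
    (hu' : Γ.IsWord u' y z) (hu0' : u' ≠ [])
    (h : Γ.Equivalent (u ++ w) (u' ++ w)) : Γ.Equivalent u u' := by
  obtain ⟨v, hv, hvw, e1, e2⟩ := hinv.exists_inverse hw hne
  have key : ∀ u : List G, Γ.IsWord u y z → u ≠ [] → Γ.Equivalent ((u ++ w) ++ v) u := by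
    intro u hu hu0
    have h1 := (Equivalent.refl (hu.wellFormed hu0)).append e1 hu (hw.append hvw)
    have h2 := h1.trans (Equivalent.concat_unit hu hu0)
    simpa using h2
  have h1 := h.append (.refl (hvw.wellFormed hv)) (hu.append hw) hvw
  exact ((key u hu hu0).symm.trans h1).trans (key u' hu' hu0')

end LocalLieGroupoid

namespace LocalLieGroupoid

open Filter

/-! ### Smooth families of words -/

section

variable {G P : Type*}

/-- The value at `q` of a family of words. -/
def evalWord (ws : List (P → G)) (q : P) : List G := ws.map fun g => g q

@[simp] theorem evalWord_nil (q : P) : evalWord ([] : List (P → G)) q = [] := rfl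

@[simp] theorem evalWord_cons (g : P → G) (ws : List (P → G)) (q : P) :
    evalWord (g :: ws) q = g q :: evalWord ws q := rfl

@[simp] theorem evalWord_append (ws ws' : List (P → G)) (q : P) :
    evalWord (ws ++ ws') q = evalWord ws q ++ evalWord ws' q := List.map_append

@[simp] theorem evalWord_eq_nil {ws : List (P → G)} {q : P} : evalWord ws q = [] ↔ ws = [] :=
  List.map_eq_nil_iff

theorem evalWord_map {Q : Type*} (ws : List (P → G)) (φ : Q → P) (q : Q) :
    evalWord (ws.map fun f q => f (φ q)) q = evalWord ws (φ q) := by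
  simp [evalWord]

end

variable {p n : ℕ} {M G : Type*}
  [TopologicalSpace M] [ChartedSpace (EuclideanSpace ℝ (Fin p)) M] [IsManifold (𝓡 p) ∞ M]
  [T2Space M] [SecondCountableTopology M]
  [TopologicalSpace G] [ChartedSpace (EuclideanSpace ℝ (Fin n)) G] [IsManifold (𝓡 n) ∞ G]
  [SecondCountableTopology G]
  {Γ : LocalLieGroupoid p n M G}
  {E : Type*} [NormedAddCommGroup E] [NormedSpace ℝ E] {H : Type*} [TopologicalSpace H]
  {I : ModelWithCorners ℝ E H} {P : Type*} [TopologicalSpace P] [ChartedSpace H P] {p₀ : P}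

variable (I n p₀) in
/-- A list of maps all of which are smooth near a point. -/
def SmoothList (ws : List (P → G)) : Prop := ∀ g ∈ ws, SmoothNear I (𝓡 n) g p₀

omit [SecondCountableTopology G] [IsManifold (𝓡 n) ∞ G] in
theorem SmoothList.append {ws ws' : List (P → G)} (h : SmoothList n I p₀ ws)
    (h' : SmoothList n I p₀ ws') : SmoothList n I p₀ (ws ++ ws') := fun g hg =>
  (List.mem_append.1 hg).elim (h g) (h' g)

omit [SecondCountableTopology G] [IsManifold (𝓡 n) ∞ G] in
theorem SmoothList.cons {g : P → G} {ws : List (P → G)} (h : SmoothNear I (𝓡 n) g p₀)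
    (h' : SmoothList n I p₀ ws) : SmoothList n I p₀ (g :: ws) := fun f hf =>
  (List.mem_cons.1 hf).elim (fun e => e ▸ h) (h' f)

variable (I p₀) in
/-- `Γ.IsFamily I p₀ w ws y x`: the list `ws` is a smooth family of words near `p₀`, with value `w`
at `p₀`, and with target and source given by `y` and `x`. -/
structure IsFamily (Γ : LocalLieGroupoid p n M G) (w : List G) (ws : List (P → G)) (y x : P → M) :
    Prop where
  smooth : SmoothList n I p₀ ws
  eval_eq : evalWord ws p₀ = w
  isWord : ∀ᶠ q in 𝓝 p₀, Γ.IsWord (evalWord ws q) (y q) (x q)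

theorem exists_lift_src (g : G) {x : P → M} (hx : SmoothNear I (𝓡 p) x p₀) (h : x p₀ = Γ.src g) :
    ∃ a : P → G, SmoothNear I (𝓡 n) a p₀ ∧ a p₀ = g ∧ ∀ᶠ q in 𝓝 p₀, Γ.src (a q) = x q := by
  obtain ⟨S, hS, hS1, hS2⟩ := Γ.exists_section g
  have hgx : SmoothNear I ((𝓡 n).prod (𝓡 p)) (fun q => (g, x q)) p₀ := (SmoothNear.const g _).prodMk hx
  have hgx0 : (g, x p₀) = (g, Γ.src g) := by rw [h]
  exact ⟨fun q => S (g, x q), hS.comp hgx hgx0, by simp only [h, hS1.self_of_nhds],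
    (hgx.tendsto hgx0).eventually hS2⟩

/-- Choose `b` through `h` with the source of `c`, then `a` through `g` composable with `b`. The
product `ab` has the right source but agrees with `c` only at `p₀`. Right division gives `d` with
`d(ab) = c` and `d p₀` a unit, so replacing `a` by `da` corrects the product without changing its
value at `p₀`. -/
theorem exists_smooth_expansion (hassoc : Γ.ThreeAssociative) (hreg : Γ.BiRegular) {c : P → G}
    (hc : SmoothNear I (𝓡 n) c p₀) {g h : G} (hgh : (g, h) ∈ Γ.dom) (hc₀ : c p₀ = Γ.mul (g, h)) :
    ∃ a b : P → G, SmoothNear I (𝓡 n) a p₀ ∧ SmoothNear I (𝓡 n) b p₀ ∧ a p₀ = g ∧ b p₀ = h ∧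
      ∀ᶠ q in 𝓝 p₀, (a q, b q) ∈ Γ.dom ∧ Γ.mul (a q, b q) = c q := by
  have hcomp := Γ.dom_composable _ _ hgh
  obtain ⟨δ, hδ, hδ0, hδ1, -⟩ := (hreg (Γ.mul (g, h))).2.exists_division
  have hsc : SmoothNear I (𝓡 p) (fun q => Γ.src (c q)) p₀ := (Γ.smoothNear_src _).comp hc rfl
  have hsc0 : Γ.src (c p₀) = Γ.src h := by rw [hc₀, Γ.src_mul _ _ hgh]
  obtain ⟨b, hb, hb0, hbs⟩ := exists_lift_src h hsc hsc0
  obtain ⟨a, ha, ha0, has⟩ := exists_lift_src (Γ := Γ) g ((Γ.smoothNear_tgt _).comp hb rfl)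
    (by rw [hb0, hcomp])
  have hab0 : (a p₀, b p₀) ∈ Γ.dom := by rwa [ha0, hb0]
  have hab := eventually_dom hgh (ha.tendsto ha0) (hb.tendsto hb0) has
  have hk := smoothNear_mul hab0 ha hb has
  have hk0 : Γ.mul (a p₀, b p₀) = Γ.mul (g, h) := by rw [ha0, hb0]
  -- the correction
  have hpair := hc.prodMk hk
  have hpair0 : (c p₀, Γ.mul (a p₀, b p₀)) = (Γ.mul (g, h), Γ.mul (g, h)) := by rw [hc₀, hk0]
  have hd := hδ.comp hpair hpair0
  have hd0 : δ (c p₀, Γ.mul (a p₀, b p₀)) = Γ.unit (Γ.tgt g) := by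
    rw [hpair0, hδ0, Γ.tgt_mul _ _ hgh]
  have hdk : ∀ᶠ q in 𝓝 p₀, (δ (c q, Γ.mul (a q, b q)), Γ.mul (a q, b q)) ∈ Γ.dom ∧
      Γ.mul (δ (c q, Γ.mul (a q, b q)), Γ.mul (a q, b q)) = c q := by
    filter_upwards [(hpair.tendsto hpair0).eventually hδ1, hbs, hab] with q h1 h2 h3
    exact h1 (by rw [Γ.src_mul _ _ h3, h2])
  generalize hddef : (fun q => δ (c q, Γ.mul (a q, b q))) = d at hd
  simp only [funext_iff] at hddef
  simp only [hddef] at hd0 hdk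
  have hda_comp : ∀ᶠ q in 𝓝 p₀, Γ.src (d q) = Γ.tgt (a q) := by
    filter_upwards [hdk, hab] with q h1 h2
    rw [Γ.dom_composable _ _ h1.1, Γ.tgt_mul _ _ h2]
  have hda := eventually_dom (Γ.mem_dom_left g) (hd.tendsto hd0) (ha.tendsto ha0) hda_comp
  have hda0 : (d p₀, a p₀) ∈ Γ.dom := hda.self_of_nhds
  have hm := smoothNear_mul hda0 hd ha hda_comp
  have hm0 : Γ.mul (d p₀, a p₀) = g := by rw [hd0, ha0, Γ.unit_mul]
  have hmb := eventually_dom hgh (hm.tendsto hm0) (hb.tendsto hb0) (by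
    filter_upwards [hda, has] with q h1 h2
    rw [Γ.src_mul _ _ h1, h2])
  refine ⟨_, b, hm, hb, hm0, hb0, ?_⟩
  filter_upwards [hmb, hda, hab, hdk] with q h1 h2 h3 h4
  exact ⟨h1, by rw [hassoc _ _ _ h2 h3 h1 h4.1, h4.2]⟩

/-- Equivalences of words extend to smooth families. -/
theorem IsFamily.exists_of_equivalent (hassoc : Γ.ThreeAssociative) (hreg : Γ.BiRegular)
    {w w' : List G} (e : Γ.Equivalent w w') {ws : List (P → G)} {y x : P → M}
    (h : Γ.IsFamily I p₀ w ws y x) :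
    ∃ ws', Γ.IsFamily I p₀ w' ws' y x ∧ ∀ᶠ q in 𝓝 p₀, Γ.Equivalent (evalWord ws q) (evalWord ws' q) := by
  -- Transport of families is proved in both directions at once, so that the symmetric closure needs
  -- no argument.
  let T : List G → List G → Prop := fun w w' => ∀ ws : List (P → G), Γ.IsFamily I p₀ w ws y x →
    ∃ ws', Γ.IsFamily I p₀ w' ws' y x ∧ ∀ᶠ q in 𝓝 p₀, Γ.Equivalent (evalWord ws q) (evalWord ws' q)
  suffices hT : ∀ w w' : Γ.Word, Relation.EqvGen Γ.Contracts w w' → T w.1 w'.1 ∧ T w'.1 w.1 from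
    (hT _ _ e.2.2).1 ws h
  clear! w ws
  intro w w' e
  induction e with
  | rel w w' e =>
    obtain ⟨l, r, g, h, hgh, e1, e2⟩ := e
    constructor
    · intro ws hws
      have h1 := hws.eval_eq.trans e1
      obtain ⟨L, R', rfl, hL, hR'⟩ := List.map_eq_append_iff.1 h1
      obtain ⟨a, R'', rfl, ha, hR''⟩ := List.map_eq_cons_iff.1 hR'
      obtain ⟨b, R, rfl, hb, hR⟩ := List.map_eq_cons_iff.1 hR''
      have ha' := hws.smooth a (by simp)
      have hb' := hws.smooth b (by simp)
      have hab : ∀ᶠ q in 𝓝 p₀, Γ.src (a q) = Γ.tgt (b q) := by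
        filter_upwards [hws.isWord] with q hq
        simp only [evalWord_append, evalWord_cons, isWord_append, isWord_cons] at hq
        obtain ⟨z, -, -, h2, -⟩ := hq
        exact h2.symm
      have hd := eventually_dom hgh (ha'.tendsto ha) (hb'.tendsto hb) hab
      have hw : ∀ᶠ q in 𝓝 p₀, Γ.IsWord
          (evalWord (L ++ (fun q => Γ.mul (a q, b q)) :: R) q) (y q) (x q) := by
        filter_upwards [hws.isWord, hd] with q h2 h3
        simp only [evalWord_append, evalWord_cons] at h2 ⊢
        exact (isWord_contract_iff h3).1 h2
      refine ⟨L ++ (fun q => Γ.mul (a q, b q)) :: R, ⟨?_, ?_, hw⟩, ?_⟩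
      · exact SmoothList.append (fun g hg => hws.smooth g (by simp [hg])) (SmoothList.cons
          (smoothNear_mul (by rwa [ha, hb]) ha' hb' hab) (fun g hg => hws.smooth g (by simp [hg])))
      · rw [e2]
        simp [evalWord, hL, hR, ha, hb]
      · filter_upwards [hw, hd] with q h2 h3
        simp only [evalWord_append, evalWord_cons] at h2 ⊢
        exact Equivalent.contract h3 (h2.wellFormed (by simp))
    · intro ws hws
      have h1 := hws.eval_eq.trans e2
      obtain ⟨L, R', rfl, hL, hR'⟩ := List.map_eq_append_iff.1 h1
      obtain ⟨c, R, rfl, hc, hR⟩ := List.map_eq_cons_iff.1 hR'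
      obtain ⟨a, b, ha, hb, ha0, hb0, hd⟩ :=
        exists_smooth_expansion hassoc hreg (hws.smooth c (by simp)) hgh hc
      have hw : ∀ᶠ q in 𝓝 p₀, Γ.IsWord (evalWord (L ++ a :: b :: R) q) (y q) (x q) := by
        filter_upwards [hws.isWord, hd] with q h2 h3
        simp only [evalWord_append, evalWord_cons] at h2 ⊢
        rw [← h3.2] at h2
        exact (isWord_contract_iff h3.1).2 h2
      refine ⟨L ++ a :: b :: R, ⟨?_, ?_, hw⟩, ?_⟩
      · exact SmoothList.append (fun g hg => hws.smooth g (by simp [hg])) (SmoothList.cons ha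
          (SmoothList.cons hb (fun g hg => hws.smooth g (by simp [hg]))))
      · rw [e1]
        simp [evalWord, hL, hR, ha0, hb0]
      · filter_upwards [hws.isWord, hd] with q h2 h3
        simp only [evalWord_append, evalWord_cons] at h2 ⊢
        rw [← h3.2] at h2 ⊢
        exact (Equivalent.contract h3.1 (h2.wellFormed (by simp))).symm
  | refl w =>
    have : T w.1 w.1 := fun ws hws => ⟨ws, hws, by
      filter_upwards [hws.isWord] with q hq
      refine .refl (hq.wellFormed ?_)
      rw [Ne, evalWord_eq_nil, ← evalWord_eq_nil (q := p₀), hws.eval_eq]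
      exact w.2.1⟩
    exact ⟨this, this⟩
  | symm _ _ _ ih => exact ih.symm
  | trans _ _ _ _ _ ih ih' =>
    have key : ∀ {u v w : List G}, T u v → T v w → T u w := by
      intro u v w h1 h2 ws hws
      obtain ⟨ws', h3, h4⟩ := h1 ws hws
      obtain ⟨ws'', h5, h6⟩ := h2 ws' h3
      exact ⟨ws'', h5, by filter_upwards [h4, h6] with q h7 h8 using h7.trans h8⟩
    exact ⟨key ih.1 ih'.1, key ih'.2 ih.2⟩

theorem IsFamily.ne_nil {w : List G} {ws : List (P → G)} {y x : P → M}
    (h : Γ.IsFamily I p₀ w ws y x) (hw : w ≠ []) : ws ≠ [] := by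
  rwa [Ne, ← evalWord_eq_nil (q := p₀), h.eval_eq]

theorem IsFamily.append {w w' : List G} {ws ws' : List (P → G)} {y z x : P → M}
    (h : Γ.IsFamily I p₀ w ws y z) (h' : Γ.IsFamily I p₀ w' ws' z x) :
    Γ.IsFamily I p₀ (w ++ w') (ws ++ ws') y x where
  smooth := h.smooth.append h'.smooth
  eval_eq := by rw [evalWord_append, h.eval_eq, h'.eval_eq]
  isWord := by
    filter_upwards [h.isWord, h'.isWord] with q h1 h2
    rw [evalWord_append]
    exact h1.append h2

theorem smoothList_inv {ws : List (P → G)} (h : SmoothList n I p₀ ws)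
    (hw : ∀ g ∈ ws, g p₀ ∈ Γ.invDom) : SmoothList n I p₀ (ws.map fun g q => Γ.inv (g q)).reverse := by
  intro f hf
  obtain ⟨g, hg, rfl⟩ := List.mem_map.1 (List.mem_reverse.1 hf)
  exact (SmoothNear.of_contMDiffOn Γ.inv_smooth Γ.invDom_open (hw g hg)).comp (h g hg) rfl

/-- Smooth families of words have smooth inverses. -/
theorem IsFamily.exists_inverse (hassoc : Γ.ThreeAssociative) (hinv : Γ.Inversional)
    (hreg : Γ.BiRegular) {w : List G} {ws : List (P → G)} {y x : P → M} (hw : w ≠ [])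
    (h : Γ.IsFamily I p₀ w ws y x) :
    ∃ w' ws', w' ≠ [] ∧ Γ.IsFamily I p₀ w' ws' x y ∧
      ∀ᶠ q in 𝓝 p₀, Γ.Equivalent (evalWord ws q ++ evalWord ws' q) [Γ.unit (y q)] ∧
        Γ.Equivalent (evalWord ws' q ++ evalWord ws q) [Γ.unit (x q)] := by
  have hw0 := h.isWord.self_of_nhds
  rw [h.eval_eq] at hw0
  obtain ⟨v, hv, e⟩ := hinv.exists_equivalent hw0 hw
  obtain ⟨vs, hvs, evs⟩ := h.exists_of_equivalent hassoc hreg e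
  have hvs0 : ∀ g ∈ vs, g p₀ ∈ Γ.invDom := fun g hg => hv _ (by
    rw [← hvs.eval_eq]; exact List.mem_map.2 ⟨g, hg, rfl⟩)
  have hne : ∀ q, evalWord vs q ≠ [] := fun q => by
    rw [Ne, evalWord_eq_nil]; exact hvs.ne_nil e.2.1.1
  have hinvd : ∀ᶠ q in 𝓝 p₀, ∀ g ∈ evalWord vs q, g ∈ Γ.invDom := by
    have : ∀ᶠ q in 𝓝 p₀, ∀ f ∈ vs, f q ∈ Γ.invDom := by
      refine (Filter.eventually_all_finite (List.finite_toSet vs)).2 fun f hf => ?_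
      exact (hvs.smooth f hf).continuousAt.eventually (Γ.invDom_open.mem_nhds (hvs0 f hf))
    filter_upwards [this] with q hq g hg
    obtain ⟨f, hf, rfl⟩ := List.mem_map.1 hg
    exact hq f hf
  have heval : ∀ q, evalWord (vs.map fun g q => Γ.inv (g q)).reverse q = Γ.invWord (evalWord vs q) := by
    intro q
    simp [evalWord, invWord, Function.comp_def]
  refine ⟨Γ.invWord v, (vs.map fun g q => Γ.inv (g q)).reverse, by simpa [invWord] using e.2.1.1,
    ⟨smoothList_inv hvs.smooth hvs0, by rw [heval, hvs.eval_eq], ?_⟩, ?_⟩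
  · filter_upwards [hvs.isWord, hinvd] with q h1 h2
    rw [heval]
    exact (invWord_spec h2 h1 (hne q)).1
  · filter_upwards [hvs.isWord, hinvd, h.isWord, evs] with q h1 h2 h3 h4
    rw [heval]
    obtain ⟨h5, h6, h7⟩ := invWord_spec h2 h1 (hne q)
    have r := Equivalent.refl (h5.wellFormed (by simpa [invWord] using hne q))
    exact ⟨(h4.append r h3 h5).trans h6, (r.append h4 h5 h3).trans h7⟩

/-- If a smooth family `us` is equivalent at `p₀` to `w` followed by the value of a smooth family
`vs`, then it is near `p₀` equivalent to a family extending `w` followed by `vs`. -/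
theorem IsFamily.exists_quotient (hassoc : Γ.ThreeAssociative) (hinv : Γ.Inversional)
    (hreg : Γ.BiRegular) {u v w : List G} {us vs : List (P → G)} {y z x : P → M} (hv0 : v ≠ [])
    (hu : Γ.IsFamily I p₀ u us y x) (hv : Γ.IsFamily I p₀ v vs z x) (hw0 : w ≠ [])
    (hw : Γ.IsWord w (y p₀) (z p₀)) (e : Γ.Equivalent u (w ++ v)) :
    ∃ ws, Γ.IsFamily I p₀ w ws y z ∧
      ∀ᶠ q in 𝓝 p₀, Γ.Equivalent (evalWord us q) (evalWord ws q ++ evalWord vs q) := by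
  obtain ⟨v', vs', hv0', hv', e'⟩ := hv.exists_inverse hassoc hinv hreg hv0
  have h1 := hu.append hv'
  have hu1 := hu.isWord.self_of_nhds
  have hv1 := hv.isWord.self_of_nhds
  have hv1' := hv'.isWord.self_of_nhds
  rw [hu.eval_eq] at hu1
  rw [hv.eval_eq] at hv1
  rw [hv'.eval_eq] at hv1'
  -- With `vs'` a smooth inverse of `vs`, the family `us ++ vs'` is equivalent to `w` at `p₀`;
  -- transporting it along this equivalence gives `ws`.
  have h2 : Γ.Equivalent (u ++ v') w := by
    have h3 := e.append (.refl (hv1'.wellFormed hv0')) hu1 hv1'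
    have h4 := e'.self_of_nhds.1
    rw [hv.eval_eq, hv'.eval_eq] at h4
    have h5 := (Equivalent.refl (hw.wellFormed hw0)).append h4 hw (hv1.append hv1')
    rw [List.append_assoc] at h3
    exact (h3.trans h5).trans (Equivalent.concat_unit hw hw0)
  obtain ⟨ws, hws, e3⟩ := h1.exists_of_equivalent hassoc hreg h2
  refine ⟨ws, hws, ?_⟩
  filter_upwards [e3, e', hu.isWord, hv.isWord, hv'.isWord] with q h4 h5 h6 h7 h8
  rw [evalWord_append] at h4
  have hne : evalWord us q ≠ [] := by
    rw [Ne, evalWord_eq_nil]; exact hu.ne_nil e.1.1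
  have hnv : evalWord vs q ≠ [] := by
    rw [Ne, evalWord_eq_nil]; exact hv.ne_nil hv0
  have h9 := h4.append (.refl (h7.wellFormed hnv)) (h6.append h8) h7
  rw [List.append_assoc] at h9
  have h10 := (Equivalent.refl (h6.wellFormed hne)).append h5.2 h6 (h8.append h7)
  exact (Equivalent.concat_unit h6 hne).symm.trans (h10.symm.trans h9)

end LocalLieGroupoid

/-! ### Retraction onto words, and injectivity near the units -/

namespace LocalLieGroupoid

open Filter

variable {p n : ℕ} {M G : Type*}
  [TopologicalSpace M] [ChartedSpace (EuclideanSpace ℝ (Fin p)) M] [IsManifold (𝓡 p) ∞ M]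
  [T2Space M] [SecondCountableTopology M]
  [TopologicalSpace G] [ChartedSpace (EuclideanSpace ℝ (Fin n)) G] [IsManifold (𝓡 n) ∞ G]
  [SecondCountableTopology G]
  {Γ : LocalLieGroupoid p n M G}

section Families

variable {E : Type*} [NormedAddCommGroup E] [NormedSpace ℝ E] {H : Type*} [TopologicalSpace H]
  {I : ModelWithCorners ℝ E H} {P : Type*} [TopologicalSpace P] [ChartedSpace H P] {p₀ : P}
  {E' : Type*} [NormedAddCommGroup E'] [NormedSpace ℝ E'] {H' : Type*} [TopologicalSpace H']
  {J : ModelWithCorners ℝ E' H'} {Q : Type*} [TopologicalSpace Q] [ChartedSpace H' Q] {q₀ : Q}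

/-- A list of maps can be retracted to a smooth family of words with given source, without changing
the values that are words already. -/
theorem exists_retraction {gs : List (P → G)} (hgs : SmoothList n I p₀ gs) {x : P → M}
    (hx : SmoothNear I (𝓡 p) x p₀) {y₀ : M} (h : Γ.IsWord (evalWord gs p₀) y₀ (x p₀)) :
    ∃ (ws : List (P → G)) (θ : P → M), Γ.IsFamily I p₀ (evalWord gs p₀) ws θ x ∧
      SmoothNear I (𝓡 p) θ p₀ ∧ θ p₀ = y₀ ∧
      ∀ᶠ q in 𝓝 p₀, ∀ z, Γ.IsWord (evalWord gs q) z (x q) → evalWord ws q = evalWord gs q := by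
  induction gs generalizing y₀ with
  | nil =>
    exact ⟨[], x, ⟨by simp [SmoothList], rfl, by simp⟩, hx, h.symm, by simp⟩
  | cons g gs ih =>
    obtain ⟨ws, θ, hws, hθ, hθ0, hr⟩ := ih (fun f hf => hgs f (by simp [hf])) h.2
    have hg := hgs g (by simp)
    -- Letters are adjusted from right to left: `S` moves `g q` to an element with source `θ q`, the
    -- target of the corrected tail, and fixes it if its source is already right.
    obtain ⟨S, hS, hS1, hS2⟩ := Γ.exists_section (g p₀)
    have hgx : SmoothNear I ((𝓡 n).prod (𝓡 p)) (fun q => (g q, θ q)) p₀ := hg.prodMk hθ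
    have hgx0 : (g p₀, θ p₀) = (g p₀, Γ.src (g p₀)) := by rw [hθ0]
    have ha := hS.comp hgx hgx0
    have ha0 : S (g p₀, θ p₀) = g p₀ := by rw [hgx0, hS1.self_of_nhds]
    refine ⟨(fun q => S (g q, θ q)) :: ws, fun q => Γ.tgt (S (g q, θ q)),
      ⟨.cons ha hws.smooth, ?_, ?_⟩, (Γ.smoothNear_tgt _).comp ha rfl, ?_, ?_⟩
    · rw [evalWord_cons, hws.eval_eq, ha0, evalWord_cons]
    · filter_upwards [hws.isWord, (hgx.tendsto hgx0).eventually hS2] with q h1 h2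
      exact ⟨rfl, by rw [h2]; exact h1⟩
    · simp only [ha0]; exact h.1
    · filter_upwards [hr, hws.isWord, hg.continuousAt.eventually hS1] with q h1 h2 h3 z h4
      have h5 := h1 _ h4.2
      rw [evalWord_cons, evalWord_cons, h5]
      congr 1
      -- An empty tail does not determine its target, so in that case `θ q` is found from the source
      -- `x q`.
      by_cases hne : evalWord gs q = []
      · have h6 : Γ.IsWord (evalWord gs q) (Γ.src (g q)) (x q) := h4.2
        rw [h5] at h2
        rw [hne] at h2 h6
        rw [isWord_nil] at h2 h6
        rw [h2, ← h6, h3]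
      · rw [h5] at h2
        rw [h2.tgt_unique h4.2 hne, h3]

theorem IsFamily.comp {w : List G} {ws : List (P → G)} {y x : P → M}
    (h : Γ.IsFamily I p₀ w ws y x) {φ : Q → P} (hφ : SmoothNear J I φ q₀) (h0 : φ q₀ = p₀) :
    Γ.IsFamily J q₀ w (ws.map fun f q => f (φ q)) (fun q => y (φ q)) (fun q => x (φ q)) where
  smooth := by
    intro f hf
    obtain ⟨f', hf', rfl⟩ := List.mem_map.1 hf
    exact (h.smooth f' hf').comp hφ h0
  eval_eq := by
    rw [← h.eval_eq, ← h0]; simp [evalWord]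
  isWord := by
    filter_upwards [(hφ.tendsto h0).eventually h.isWord] with q hq
    simpa [evalWord, Function.comp_def] using hq

omit [IsManifold (𝓡 n) ∞ G] [SecondCountableTopology G] in
theorem SmoothList.eventually {ws : List (P → G)} (h : SmoothList n I p₀ ws) :
    ∀ᶠ q in 𝓝 p₀, SmoothList n I q ws :=
  (Filter.eventually_all_finite (List.finite_toSet ws)).2 fun f hf => (h f hf).eventually

theorem IsFamily.eventually {w : List G} {ws : List (P → G)} {y x : P → M}
    (h : Γ.IsFamily I p₀ w ws y x) :
    ∀ᶠ q in 𝓝 p₀, Γ.IsFamily I q (evalWord ws q) ws y x := by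
  filter_upwards [h.smooth.eventually, eventually_eventually_nhds.2 h.isWord] with q h1 h2
  exact ⟨h1, rfl, h2⟩

variable (Γ I p₀) in
/-- Near `p₀` the map `f` is the class of a smooth family of words. -/
def IsRepresentedAt (f : P → Γ.AC) : Prop :=
  ∃ (w : List G) (ws : List (P → G)) (y x : P → M), w ≠ [] ∧ Γ.IsFamily I p₀ w ws y x ∧
    ∀ᶠ q in 𝓝 p₀, ∃ h : Γ.WellFormed (evalWord ws q), f q = Γ.cls ⟨evalWord ws q, h⟩

end Families

theorem exists_isWord_of_mem_words {k : ℕ} {u : Fin (k + 1) → G} (hu : u ∈ Γ.words k) :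
    ∃ y, Γ.IsWord (List.ofFn u) y (Γ.src (u (Fin.last k))) := by
  have h := isWord_word ⟨List.ofFn u, hu⟩
  have hs : Γ.wordSrc ⟨List.ofFn u, hu⟩ = Γ.src (u (Fin.last k)) := by
    simp only [wordSrc, List.getLast_ofFn_succ]
  exact ⟨_, hs ▸ h⟩

variable (Γ) in
/-- The natural map to the associative completion is injective near the units. -/
def LocallyInjective : Prop := ∀ x, ∃ O ∈ 𝓝 (Γ.unit x), InjOn Γ.toAC O

/-- Elements `g`, `g'` near a unit with the same class have equal sources, so `g = d g'` with `d`
near the unit. Cancelling `g'` in the completion makes `d` equivalent to a unit. Thus `d` is an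
associator in `O`, hence a unit, and `g = g'`. -/
theorem AssocUniformlyDiscrete.locallyInjective (h : Γ.AssocUniformlyDiscrete)
    (hassoc : Γ.ThreeAssociative) (hinv : Γ.Inversional) (hreg : Γ.BiRegular)
    (haxes : Γ.ProductsConnectedToAxes) : Γ.LocallyInjective := by
  intro x
  obtain ⟨O, oO, hO, hOA⟩ := h
  obtain ⟨δ, hδ, hδ0, hδ1, -⟩ := (hreg (Γ.unit x)).2.exists_division
  have h1 : ∀ᶠ q in 𝓝 (Γ.unit x, Γ.unit x), δ q ∈ O :=
    (hδ.tendsto hδ0).eventually (oO.mem_nhds (hO ⟨_, rfl⟩))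
  rw [nhds_prod_eq] at hδ1 h1
  obtain ⟨U, hU, h2⟩ := (eventually_prod_self_iff' (r := fun q => _)).1 (hδ1.and h1)
  refine ⟨U, hU, fun g hg g' hg' e => ?_⟩
  have e1 := toAC_eq_iff.1 e
  have e2 : Γ.IsWord [g'] (Γ.tgt g) (Γ.src g) := e1.isWord ⟨rfl, rfl⟩
  obtain ⟨ht, hs⟩ := e2
  obtain ⟨h3, h4⟩ := h2 _ hg _ hg'
  obtain ⟨h5, h6⟩ := h3 hs.symm
  generalize δ (g, g') = d at *
  dsimp only at h5 h6
  have hd := Γ.dom_composable _ _ h5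
  have hdt : Γ.tgt d = Γ.tgt g := by rw [← h6, Γ.tgt_mul _ _ h5]
  have e3 : Γ.Equivalent ([d] ++ [g']) ([Γ.unit (Γ.tgt g')] ++ [g']) := by
    have e4 := Equivalent.contract (l := []) (r := []) h5 (by simp [WellFormed])
    have e5 := Equivalent.contract (l := []) (r := []) (Γ.mem_dom_left g') (by simp [WellFormed])
    rw [h6] at e4
    rw [Γ.unit_mul] at e5
    exact (e4.trans e1).trans e5.symm
  have e6 := hinv.cancel_right (z := Γ.tgt g') (x := Γ.src g') (w := [g']) ⟨rfl, rfl⟩ (by simp)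
    (y := Γ.tgt g') (u := [d]) ⟨hdt.trans ht.symm, hd⟩ (by simp)
    (u' := [Γ.unit (Γ.tgt g')]) ⟨Γ.tgt_unit _, Γ.src_unit _⟩ (by simp) e3
  have h7 := mem_assoc_of_toAC_eq hassoc hreg haxes (toAC_eq_iff.2 e6)
  obtain ⟨z, rfl⟩ := hOA.le ⟨h4, h7⟩
  rw [Γ.src_unit] at hd
  rw [← h6, hd, Γ.unit_mul]

end LocalLieGroupoid

namespace LocalLieGroupoid

open Filter

variable {p n : ℕ} {M G : Type*}
  [TopologicalSpace M] [ChartedSpace (EuclideanSpace ℝ (Fin p)) M] [IsManifold (𝓡 p) ∞ M]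
  [T2Space M] [SecondCountableTopology M]
  [TopologicalSpace G] [ChartedSpace (EuclideanSpace ℝ (Fin n)) G] [IsManifold (𝓡 n) ∞ G]
  [SecondCountableTopology G]

/-! ### Parametrisations of the associative completion -/

/-- An injective parametrisation `Φ` of a subset of the associative completion by an open subset `D`
of Euclidean space, smooth in the sense that it is given by smooth families of words and that
the words with classes in its image depend smoothly on the parameters. -/
structure IsPlot (Γ : LocalLieGroupoid p n M G) (Φ : EuclideanSpace ℝ (Fin n) → Γ.AC)
    (D : Set (EuclideanSpace ℝ (Fin n))) : Prop where
  isOpen : IsOpen D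
  injOn : InjOn Φ D
  isRepresentedAt : ∀ z ∈ D, Γ.IsRepresentedAt (𝓡 n) z Φ
  exists_lift : ∀ z ∈ D, ∀ (k : ℕ) (w : Γ.words k), Γ.wordClass k w = Φ z →
    ∃ T : (Fin (k + 1) → G) → EuclideanSpace ℝ (Fin n),
      SmoothNear (ModelWithCorners.pi fun _ : Fin (k + 1) => 𝓡 n) (𝓡 n) T w.1 ∧ T w.1 = z ∧
      ∀ᶠ u in 𝓝 w.1, ∀ hu : u ∈ Γ.words k, Φ (T u) = Γ.wordClass k ⟨u, hu⟩

variable {Γ : LocalLieGroupoid p n M G}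

/-- The parameters are the source `x`, read in the chart `κ`, and the fibre coordinate of an element
`a` near the unit at the target of `w₀`; the point is the class of `a ws(x)`, where `ws` is a family
through `w₀`. Equal classes have equal sources; cancelling `ws(x)` leaves equal classes of the
letters `a`, and local injectivity finishes. The source is a linear projection in these coordinates,
which later shows that it is a submersion. -/
theorem exists_plot (hassoc : Γ.ThreeAssociative) (hinv : Γ.Inversional) (hreg : Γ.BiRegular)
    (hLI : Γ.LocallyInjective) {F : Type*} [NormedAddCommGroup F] [NormedSpace ℝ F]
    (hsub : IsSubmersionOfComplement F (𝓡 n) (𝓡 p) ∞ Γ.src) (α : Γ.AC) :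
    ∃ (Φ : EuclideanSpace ℝ (Fin n) → Γ.AC) (D : Set (EuclideanSpace ℝ (Fin n)))
      (z₀ : EuclideanSpace ℝ (Fin n))
      (e : EuclideanSpace ℝ (Fin n) ≃L[ℝ] EuclideanSpace ℝ (Fin p) × F)
      (κ : OpenPartialHomeomorph M (EuclideanSpace ℝ (Fin p))),
      Γ.IsPlot Φ D ∧ z₀ ∈ D ∧ Φ z₀ = α ∧ κ ∈ IsManifold.maximalAtlas (𝓡 p) ∞ M ∧
        ∀ z ∈ D, Γ.acSrc (Φ z) ∈ κ.source ∧ κ (Γ.acSrc (Φ z)) = (e z).1 := by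
  obtain ⟨w₀, rfl⟩ : ∃ w, Γ.cls w = α := ⟨_, Γ.cls_out α⟩
  have hw₀ := isWord_word w₀
  set y₀ := Γ.wordTgt w₀
  set x₀ := Γ.wordSrc w₀
  let e := (hsub (Γ.unit y₀)).equiv
  obtain ⟨A, v, htriv⟩ := (hsub (Γ.unit y₀)).exists_isLocalTrivialisation
  have hsy := Γ.src_unit y₀
  let κ : OpenPartialHomeomorph M (EuclideanSpace ℝ (Fin p)) := chartAt _ x₀
  have hκ : κ ∈ IsManifold.maximalAtlas (𝓡 p) ∞ M := IsManifold.chart_mem_maximalAtlas x₀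
  have hx₀ : x₀ ∈ κ.source := mem_chart_source _ x₀
  have hκs : ∀ x ∈ κ.source, SmoothNear (𝓡 p) (𝓡 p) κ x := fun x hx =>
    .of_contMDiffOn (contMDiffOn_of_mem_maximalAtlas hκ) κ.open_source hx
  have hκs' : ∀ y ∈ κ.target, SmoothNear (𝓡 p) (𝓡 p) κ.symm y := fun y hy =>
    .of_contMDiffOn (contMDiffOn_symm_of_mem_maximalAtlas hκ) κ.open_target hy
  -- a smooth family of words through `w₀` with arbitrary sources
  obtain ⟨ws, θ, hws, hθ, hθ0, -⟩ := exists_retraction (Γ := Γ) (n := n) (I := 𝓡 p) (p₀ := x₀)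
    (gs := w₀.1.map fun g _ => g) (x := fun x => x) (fun f hf => by
      obtain ⟨g, -, rfl⟩ := List.mem_map.1 hf
      exact .const g _) (.id _) (y₀ := y₀) (by simpa [evalWord, Function.comp_def] using hw₀)
  have hgs : evalWord (w₀.1.map fun g (_ : M) => g) x₀ = w₀.1 := by
    simp [evalWord, Function.comp_def]
  rw [hgs] at hws
  have hne : ws ≠ [] := hws.ne_nil w₀.2.1
  let ψ : EuclideanSpace ℝ (Fin n) → M := fun z => κ.symm (e z).1
  let a : EuclideanSpace ℝ (Fin n) → G := fun z => A (θ (ψ z), (e z).2)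
  let z₀ : EuclideanSpace ℝ (Fin n) := e.symm (κ x₀, v (Γ.unit y₀))
  have hez : e z₀ = (κ x₀, v (Γ.unit y₀)) := e.apply_symm_apply _
  have h1 : ∀ z, SmoothNear (𝓡 n) (𝓡 p) (fun z => (e z).1) z := fun z =>
    .vec (contDiff_fst.comp e.contDiff) z
  have h2 : ∀ z, SmoothNear (𝓡 n) 𝓘(ℝ, F) (fun z => (e z).2) z := fun z =>
    .vec (contDiff_snd.comp e.contDiff) z
  have hψ : SmoothNear (𝓡 n) (𝓡 p) ψ z₀ :=
    (hκs' _ (κ.map_source hx₀)).comp (h1 z₀) (by rw [hez])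
  have hψ0 : ψ z₀ = x₀ := by simp only [ψ, hez, κ.left_inv hx₀]
  have hpair : SmoothNear (𝓡 n) ((𝓡 p).prod 𝓘(ℝ, F)) (fun z => (θ (ψ z), (e z).2)) z₀ :=
    (hθ.comp hψ hψ0).prodMk (h2 z₀)
  have hpair0 : (θ (ψ z₀), (e z₀).2) = (Γ.src (Γ.unit y₀), v (Γ.unit y₀)) := by
    rw [hψ0, hθ0, hez, hsy]
  have ha : SmoothNear (𝓡 n) (𝓡 n) a z₀ := htriv.smooth_inv.comp hpair hpair0
  have ha0 : a z₀ = Γ.unit y₀ := by simp only [a, hpair0, htriv.apply_self]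
  let ws' : List (EuclideanSpace ℝ (Fin n) → G) := ws.map fun f z => f (ψ z)
  have hws' : Γ.IsFamily (𝓡 n) z₀ w₀.1 ws' _ _ := hws.comp hψ hψ0
  have hfam : Γ.IsFamily (𝓡 n) z₀ (a z₀ :: w₀.1) (a :: ws') (fun z => Γ.tgt (a z)) ψ := by
    refine ⟨.cons ha hws'.smooth, by rw [evalWord_cons, hws'.eval_eq], ?_⟩
    filter_upwards [hws'.isWord, (hpair.tendsto hpair0).eventually htriv.right_inv] with z h3 h4
    exact ⟨rfl, by rw [h4.1]; exact h3⟩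
  classical
  -- The default value `Γ.cls w₀` is never taken through the second branch on `D`, where the lists
  -- are words.
  let Φ : EuclideanSpace ℝ (Fin n) → Γ.AC := fun z =>
    if h : Γ.WellFormed (evalWord (a :: ws') z) then Γ.cls ⟨_, h⟩ else Γ.cls w₀
  have hΦ : ∀ z x, Γ.IsWord (evalWord (a :: ws') z) (Γ.tgt (a z)) x → ∃ h, Φ z = Γ.cls
      ⟨evalWord (a :: ws') z, h⟩ := fun z x h => by
    have h' := h.wellFormed (by simp)
    exact ⟨h', dif_pos h'⟩
  obtain ⟨O, hO, hinj⟩ := hLI y₀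
  have hgood : ∀ᶠ z in 𝓝 z₀, Γ.IsFamily (𝓡 n) z (evalWord (a :: ws') z) (a :: ws')
        (fun z => Γ.tgt (a z)) ψ ∧
      Γ.IsFamily (𝓡 p) (ψ z) (evalWord ws (ψ z)) ws θ (fun x => x) ∧
      SmoothNear (𝓡 p) (𝓡 p) θ (ψ z) ∧
      (Γ.src (a z) = θ (ψ z) ∧ v (a z) = (e z).2) ∧ a z ∈ O ∧ (e z).1 ∈ κ.target ∧
      (∀ᶠ g in 𝓝 (a z), A (Γ.src g, v g) = g) ∧ SmoothNear (𝓡 n) 𝓘(ℝ, F) v (a z) := by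
    have hat := ha.tendsto ha0
    refine hfam.eventually.and (((hψ.tendsto hψ0).eventually hws.eventually).and
      (((hψ.tendsto hψ0).eventually hθ.eventually).and
      (((hpair.tendsto hpair0).eventually htriv.right_inv).and ((hat.eventually hO).and
      (((h1 z₀).continuousAt.eventually (κ.open_target.mem_nhds ?_)).and
      ((hat.eventually (eventually_eventually_nhds.2 htriv.left_inv)).and
      (hat.eventually htriv.smooth_snd.eventually)))))))
    change (e z₀).1 ∈ κ.target
    rw [hez]; exact κ.map_source hx₀
  obtain ⟨D, hD, oD, hzD⟩ := eventually_nhds_iff.1 hgood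
  have hsrc : ∀ z ∈ D, Γ.acSrc (Φ z) = ψ z := fun z hz => by
    have h3 := (hD z hz).1.isWord.self_of_nhds
    obtain ⟨h4, h5⟩ := hΦ z _ h3
    rw [h5]
    exact (isWord_word ⟨_, h4⟩).src_unique
      (by rwa [← h3.tgt_unique (isWord_word ⟨_, h4⟩) (by simp)])
  have hev : ∀ z, evalWord (a :: ws') z = [a z] ++ evalWord ws (ψ z) := fun z => by
    rw [evalWord_cons, evalWord_map, List.singleton_append]
  refine ⟨Φ, D, z₀, e, κ, ⟨oD, ?_, ?_, ?_⟩, hzD, ?_, hκ, ?_⟩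
  · intro z hz z' hz' hzz
    obtain ⟨f1, f2, -, f3, f4, f5, f6, -⟩ := hD z hz
    obtain ⟨f1', f2', -, f3', f4', f5', f6', -⟩ := hD z' hz'
    have hψz : ψ z = ψ z' := by rw [← hsrc z hz, ← hsrc z' hz', hzz]
    have h3 : (e z).1 = (e z').1 := κ.symm.injOn f5 f5' hψz
    obtain ⟨h4, h5⟩ := hΦ z _ f1.isWord.self_of_nhds
    obtain ⟨h4', h5'⟩ := hΦ z' _ f1'.isWord.self_of_nhds
    rw [h5, h5'] at hzz
    have h6 := Equivalent.of_cls_eq hzz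
    dsimp only at h6
    have h7 := h6.isWord f1.isWord.self_of_nhds
    rw [hev z, hev z', ← hψz] at h6
    have h8 : Γ.tgt (a z') = Γ.tgt (a z) := h7.1
    have h9 := hinv.cancel_right (f2.isWord.self_of_nhds) (by simpa using hne)
      (u := [a z]) (u' := [a z']) (y := Γ.tgt (a z)) ⟨rfl, f3.1⟩ (by simp)
      ⟨h8, by rw [hψz]; exact f3'.1⟩ (by simp) h6
    have h10 := hinj f4 f4' (toAC_eq_iff.2 h9)
    exact e.injective (Prod.ext h3 (by rw [← f3.2, ← f3'.2, h10]))
  · intro z hz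
    obtain ⟨f1, -⟩ := hD z hz
    refine ⟨_, _, _, _, by simp, f1, ?_⟩
    filter_upwards [f1.isWord] with z' h3 using hΦ z' _ h3
  · intro z hz k w hw
    obtain ⟨f1, f2, f7, f3, f4, f5, f6, f8⟩ := hD z hz
    obtain ⟨h4, h5⟩ := hΦ z _ f1.isWord.self_of_nhds
    rw [h5] at hw
    have e1 : Γ.Equivalent (List.ofFn w.1) ([a z] ++ evalWord ws (ψ z)) := by
      have := Equivalent.of_cls_eq hw
      rwa [← hev]
    let x : (Fin (k + 1) → G) → M := fun u => Γ.src (u (Fin.last k))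
    have hx : SmoothNear (ModelWithCorners.pi fun _ : Fin (k + 1) => 𝓡 n) (𝓡 p) x w.1 :=
      (Γ.smoothNear_src _).comp (.apply _ _) rfl
    let gs : List ((Fin (k + 1) → G) → G) := List.ofFn fun i u => u i
    have hgs : ∀ u, evalWord gs u = List.ofFn u := fun u => by
      simp [gs, evalWord, List.map_ofFn, Function.comp_def]
    obtain ⟨y, hy⟩ := exists_isWord_of_mem_words w.2
    obtain ⟨us, θ', hus, -, hθ0', hr⟩ := exists_retraction (Γ := Γ) (n := n) (p₀ := w.1)
      (I := ModelWithCorners.pi fun _ : Fin (k + 1) => 𝓡 n) (gs := gs) (x := x)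
      (fun f hf => by
        obtain ⟨i, rfl⟩ := (List.mem_ofFn' _ _).1 hf
        exact .apply _ _) hx (y₀ := y) (by rwa [hgs])
    rw [hgs] at hus
    have h6 := e1.isWord hy
    rw [← hev] at h6
    have h7 : Γ.tgt (a z) = y := h6.1
    have hxw : x w.1 = ψ z := by
      have h8 := f1.isWord.self_of_nhds
      rw [h7] at h8
      exact h6.src_unique h8
    -- A nearby word `u` is divided on the right by `ws(x u)`. The quotient family extends the
    -- one-letter word `a z`, so it is a single letter `b`, and the coordinates of `b` together with
    -- the source of `u` are the parameters of its class.
    obtain ⟨bs, hbs, h8⟩ := hus.exists_quotient hassoc hinv hreg (v := evalWord ws (ψ z))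
      (w := [a z]) (by simpa using hne) (f2.comp hx hxw) (by simp)
      ⟨by rw [hθ0', h7], show Γ.src (a z) = θ (x w.1) by rw [hxw]; exact f3.1⟩ e1
    obtain ⟨b, rfl⟩ : ∃ b, bs = [b] := by
      have := congrArg List.length hbs.eval_eq
      exact List.length_eq_one_iff.1 (by simpa [evalWord] using this)
    have hb := hbs.smooth b (by simp)
    have hb0 : b w.1 = a z := by simpa using hbs.eval_eq
    have hψκ : ψ z ∈ κ.source := κ.map_target f5
    have hκψ : κ (ψ z) = (e z).1 := κ.right_inv f5
    refine ⟨fun u => e.symm (κ (x u), v (b u)), ?_, ?_, ?_⟩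
    · have h9 := ((hκs _ hψκ).comp hx hxw).prodMk (f8.comp hb hb0)
      have h10 : SmoothNear ((𝓡 p).prod 𝓘(ℝ, F)) (𝓡 n) e.symm (κ (x w.1), v (b w.1)) :=
        .of_contMDiff (by
          rw [← modelWithCornersSelf_prod, chartedSpaceSelf_prod]
          exact e.symm.contDiff.contMDiff) _
      exact h10.comp h9 rfl
    · simp only [hxw, hb0, hκψ, f3.2, Prod.mk.eta, e.symm_apply_apply]
    · filter_upwards [hr, h8, hbs.isWord, (hb.tendsto hb0).eventually f6,
        (hx.tendsto hxw).eventually (κ.open_source.mem_nhds hψκ)] with u g1 g2 g3 g4 g5 hu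
      obtain ⟨y', hy'⟩ := exists_isWord_of_mem_words hu
      have g6 : evalWord us u = List.ofFn u := by
        rw [← hgs]; exact g1 y' (by rwa [hgs])
      have g7 : ψ (e.symm (κ (x u), v (b u))) = x u := by
        simp only [ψ, e.apply_symm_apply, κ.left_inv g5]
      have g8 : a (e.symm (κ (x u), v (b u))) = b u := by
        have g9 : Γ.src (b u) = θ (x u) := g3.2
        simp only [a, g7, e.apply_symm_apply]
        rw [← g9, g4]
      rw [evalWord_map, g6] at g2
      have g10 : evalWord (a :: ws') (e.symm (κ (x u), v (b u))) = evalWord [b] u ++ evalWord ws (x u) := by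
        rw [hev, g7, g8]; rfl
      rw [← g10] at g2
      have g11 : Φ (e.symm (κ (x u), v (b u))) = Γ.cls ⟨_, g2.2.1⟩ := dif_pos g2.2.1
      rw [g11]
      exact g2.cls_eq.symm
  · have h3 := hfam.isWord.self_of_nhds
    obtain ⟨h4, h5⟩ := hΦ z₀ _ h3
    rw [h5]
    have h6 := Equivalent.unit_cons hw₀ w₀.2.1
    have h7 : evalWord (a :: ws') z₀ = Γ.unit y₀ :: w₀.1 := by
      rw [hfam.eval_eq, ha0]
    simp only [h7]
    exact h6.cls_eq
  · intro z hz
    rw [hsrc z hz]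
    have f5 := (hD z hz).2.2.2.2.2.1
    exact ⟨κ.map_target f5, κ.right_inv f5⟩

end LocalLieGroupoid

/-! ### Lifting represented maps to words and to plots -/

namespace LocalLieGroupoid

open Filter

variable {p n : ℕ} {M G : Type*}
  [TopologicalSpace M] [ChartedSpace (EuclideanSpace ℝ (Fin p)) M] [IsManifold (𝓡 p) ∞ M]
  [T2Space M] [SecondCountableTopology M]
  [TopologicalSpace G] [ChartedSpace (EuclideanSpace ℝ (Fin n)) G] [IsManifold (𝓡 n) ∞ G]
  [SecondCountableTopology G]
  {Γ : LocalLieGroupoid p n M G}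

theorem exists_wordClass (α : Γ.AC) : ∃ (k : ℕ) (w : Γ.words k), Γ.wordClass k w = α := by
  obtain ⟨⟨w, hw⟩, rfl⟩ : ∃ w, Γ.cls w = α := ⟨_, Γ.cls_out α⟩
  have hl : w.length = w.length - 1 + 1 :=
    (Nat.succ_pred_eq_of_pos (List.length_pos_iff.2 hw.1)).symm
  have h : List.ofFn (fun i : Fin (w.length - 1 + 1) => w.get (i.cast hl.symm)) = w := by
    refine List.ext_get (by simp [← hl, -List.ofFn_succ]) fun i h1 h2 => ?_
    simp [-List.ofFn_succ]
  exact ⟨_, ⟨_, show Γ.WellFormed _ from h.symm ▸ hw⟩, congrArg Γ.cls (Subtype.ext h)⟩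

section Represented

variable {E : Type*} [NormedAddCommGroup E] [NormedSpace ℝ E] {H : Type*} [TopologicalSpace H]
  {I : ModelWithCorners ℝ E H} {P : Type*} [TopologicalSpace P] [ChartedSpace H P] {p₀ : P}

omit [IsManifold (𝓡 n) ∞ G] [SecondCountableTopology G] in
theorem SmoothList.exists_tuple {k : ℕ} {ws : List (P → G)} (h : SmoothList n I p₀ ws)
    (hl : ws.length = k + 1) :
    ∃ u : P → Fin (k + 1) → G,
      SmoothNear I (ModelWithCorners.pi fun _ : Fin (k + 1) => 𝓡 n) u p₀ ∧
      ∀ q, List.ofFn (u q) = evalWord ws q := by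
  refine ⟨fun q i => ws.get (i.cast hl.symm) q, .pi fun i => h _ (List.get_mem _ _), fun q => ?_⟩
  refine List.ext_get (by simp [evalWord, hl, -List.ofFn_succ]) fun i h1 h2 => ?_
  simp [evalWord, -List.ofFn_succ]

/-- A represented map is represented by a smooth family through any given word. -/
theorem IsRepresentedAt.exists_tuple (hassoc : Γ.ThreeAssociative) (hreg : Γ.BiRegular)
    {f : P → Γ.AC} (h : Γ.IsRepresentedAt I p₀ f) {k : ℕ} {w : Γ.words k}
    (hw : Γ.wordClass k w = f p₀) :
    ∃ u : P → Fin (k + 1) → G,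
      SmoothNear I (ModelWithCorners.pi fun _ : Fin (k + 1) => 𝓡 n) u p₀ ∧ u p₀ = w.1 ∧
      ∀ᶠ q in 𝓝 p₀, ∃ h : u q ∈ Γ.words k, f q = Γ.wordClass k ⟨u q, h⟩ := by
  obtain ⟨v, vs, y, x, hv, hvs, hf⟩ := h
  obtain ⟨h1, h2⟩ := hf.self_of_nhds
  have e : Γ.Equivalent v (List.ofFn w.1) := by
    rw [← hw] at h2
    have := (Equivalent.of_cls_eq h2).symm
    dsimp only at this
    rwa [hvs.eval_eq] at this
  obtain ⟨ws, hws, e'⟩ := hvs.exists_of_equivalent hassoc hreg e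
  obtain ⟨u, hu, hue⟩ := hws.smooth.exists_tuple (k := k) (by
    simpa [evalWord] using congrArg List.length hws.eval_eq)
  refine ⟨u, hu, List.ofFn_injective ((hue p₀).trans hws.eval_eq), ?_⟩
  filter_upwards [hf, e'] with q ⟨h3, h4⟩ h5
  rw [← hue] at h5
  refine ⟨h5.2.1, ?_⟩
  rw [h4]
  exact h5.cls_eq

/-- The map is first lifted to words of one fixed length, where the plot provides a smooth lift `T`.
-/
theorem IsPlot.exists_lift_of_isRepresentedAt (hassoc : Γ.ThreeAssociative) (hreg : Γ.BiRegular)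
    {Φ : EuclideanSpace ℝ (Fin n) → Γ.AC} {D : Set (EuclideanSpace ℝ (Fin n))} (hΦ : Γ.IsPlot Φ D)
    {z : EuclideanSpace ℝ (Fin n)} (hz : z ∈ D) {f : P → Γ.AC} (hf : Γ.IsRepresentedAt I p₀ f)
    (h : f p₀ = Φ z) :
    ∃ τ : P → EuclideanSpace ℝ (Fin n), SmoothNear I (𝓡 n) τ p₀ ∧ τ p₀ = z ∧
      ∀ᶠ q in 𝓝 p₀, Φ (τ q) = f q := by
  obtain ⟨k, w, hw⟩ := exists_wordClass (f p₀)
  obtain ⟨u, hu, hu0, hue⟩ := hf.exists_tuple hassoc hreg hw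
  obtain ⟨T, hT, hTw, hTΦ⟩ := hΦ.exists_lift z hz k w (hw.trans h)
  refine ⟨fun q => T (u q), hT.comp hu hu0, by simp only [hu0, hTw], ?_⟩
  filter_upwards [hue, (hu.tendsto hu0).eventually hTΦ] with q ⟨h1, h2⟩ h3
  rw [h2, h3 h1]

end Represented

/-! ### The smooth structure on the associative completion -/

variable (Γ) in
/-- A chart of the associative completion is the inverse of a plot. -/
def IsPlotChart (c : PartialEquiv Γ.AC (EuclideanSpace ℝ (Fin n))) : Prop :=
  Γ.IsPlot c.symm c.target

theorem IsPlot.exists_chart {Φ : EuclideanSpace ℝ (Fin n) → Γ.AC}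
    {D : Set (EuclideanSpace ℝ (Fin n))} (hΦ : Γ.IsPlot Φ D) :
    ∃ c, Γ.IsPlotChart c ∧ c.source = Φ '' D :=
  ⟨(BijOn.toPartialEquiv Φ D (Φ '' D) hΦ.injOn.bijOn_image).symm, hΦ, rfl⟩

/-- The inverse of one chart is represented by words, hence lifts smoothly through the plot of the
other. The lift yields both smoothness of the transition and openness of its domain. -/
theorem IsPlotChart.exists_transition (hassoc : Γ.ThreeAssociative) (hreg : Γ.BiRegular)
    {c c' : PartialEquiv Γ.AC (EuclideanSpace ℝ (Fin n))} (hc : Γ.IsPlotChart c)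
    (hc' : Γ.IsPlotChart c') {z : EuclideanSpace ℝ (Fin n)} (hz : z ∈ (c.symm.trans c').source) :
    ∃ τ : EuclideanSpace ℝ (Fin n) → EuclideanSpace ℝ (Fin n), SmoothNear (𝓡 n) (𝓡 n) τ z ∧
      ∀ᶠ z' in 𝓝 z, z' ∈ (c.symm.trans c').source ∧ (c.symm.trans c') z' = τ z' := by
  rw [PartialEquiv.trans_source] at hz
  obtain ⟨h1, h2⟩ := hz
  have h1 : z ∈ c.target := h1
  have h2 : c.symm z ∈ c'.source := h2
  have h3 := c'.map_source h2
  obtain ⟨τ, hτ, hτz, hτc⟩ := hc'.exists_lift_of_isRepresentedAt hassoc hreg h3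
    (hc.isRepresentedAt z h1) (c'.left_inv h2).symm
  refine ⟨τ, hτ, ?_⟩
  filter_upwards [hτc, hc.isOpen.mem_nhds h1, (hτ.tendsto hτz).eventually (hc'.isOpen.mem_nhds h3)]
    with z' h4 h5 h6
  refine ⟨?_, ?_⟩
  · rw [PartialEquiv.trans_source]
    refine ⟨h5, ?_⟩
    change c.symm z' ∈ c'.source
    rw [← h4]
    exact c'.map_target h6
  · change c' (c.symm z') = τ z'
    rw [← h4]
    exact c'.right_inv h6

/-- The smooth structure on the associative completion, as a charted space core. -/
noncomputable def plotCore (hassoc : Γ.ThreeAssociative) (hreg : Γ.BiRegular)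
    (hcov : ∀ α, ∃ c, Γ.IsPlotChart c ∧ α ∈ c.source) :
    ChartedSpaceCore (EuclideanSpace ℝ (Fin n)) Γ.AC where
  atlas := {c | Γ.IsPlotChart c}
  chartAt α := (hcov α).choose
  mem_chart_source α := (hcov α).choose_spec.2
  chart_mem_atlas α := (hcov α).choose_spec.1
  open_source c c' hc hc' := by
    rw [isOpen_iff_mem_nhds]
    intro z hz
    obtain ⟨τ, -, h⟩ := IsPlotChart.exists_transition hassoc hreg hc hc' hz
    exact h.mono fun _ h => h.1
  continuousOn_toFun c c' hc hc' := by
    intro z hz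
    obtain ⟨τ, hτ, h⟩ := IsPlotChart.exists_transition hassoc hreg hc hc' hz
    exact (hτ.continuousAt.congr (h.mono fun _ h => h.2.symm)).continuousWithinAt

/-- Chart domains pull back to neighbourhoods in the spaces of words of each length. These spaces
are Lindelöf, and there are countably many lengths. No topology on the completion is needed. -/
theorem exists_countable_cover {c : Γ.AC → PartialEquiv Γ.AC (EuclideanSpace ℝ (Fin n))}
    (hc : ∀ α, Γ.IsPlotChart (c α)) (hα : ∀ α, α ∈ (c α).source) :
    ∃ S : Set Γ.AC, S.Countable ∧ ⋃ α ∈ S, (c α).source = univ := by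
  have h : ∀ k, ∃ t : Set (Γ.words k), t.Countable ∧
      ⋃ w ∈ t, {u | Γ.wordClass k u ∈ (c (Γ.wordClass k w)).source} = univ := by
    intro k
    refine LindelofSpace.elim_nhds_subcover _ fun w => ?_
    have h1 := (c _).map_source (hα (Γ.wordClass k w))
    obtain ⟨T, hT, hTw, h2⟩ := (hc (Γ.wordClass k w)).exists_lift _ h1 k w
      ((c _).left_inv (hα (Γ.wordClass k w))).symm
    have h3 : Tendsto Subtype.val (𝓝 w) (𝓝 w.1) := continuous_subtype_val.continuousAt
    filter_upwards [h3.eventually h2, h3.eventually ((hT.tendsto hTw).eventually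
      ((hc (Γ.wordClass k w)).isOpen.mem_nhds h1))] with u h4 h5
    rw [← h4 u.2]
    exact (c _).map_target h5
  choose t ht ht' using h
  refine ⟨⋃ k, Γ.wordClass k '' t k, countable_iUnion fun k => (ht k).image _,
    eq_univ_of_forall fun α => ?_⟩
  obtain ⟨k, u, rfl⟩ := exists_wordClass α
  obtain ⟨w, hw, hu⟩ := mem_iUnion₂.1 ((ht' k).ge (mem_univ u))
  exact mem_iUnion₂.2 ⟨_, mem_iUnion.2 ⟨k, w, hw, rfl⟩, hu⟩

theorem acIsSmooth_of_exists_chart (hassoc : Γ.ThreeAssociative) (hreg : Γ.BiRegular)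
    (hcov : ∀ α, ∃ c, Γ.IsPlotChart c ∧ α ∈ c.source) : Γ.ACIsSmooth := by
  let C := plotCore hassoc hreg hcov
  let : TopologicalSpace Γ.AC := C.toTopologicalSpace
  let : ChartedSpace (EuclideanSpace ℝ (Fin n)) Γ.AC := C.toChartedSpace
  have hC : ∀ α, Γ.IsPlotChart (C.chartAt α) := fun α => C.chart_mem_atlas α
  have hman : IsManifold (𝓡 n) ∞ Γ.AC := by
    refine isManifold_of_contDiffOn _ _ _ fun c c' hc hc' => ?_
    obtain ⟨c, hc1, rfl⟩ := mem_iUnion₂.1 hc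
    obtain ⟨c', hc1', rfl⟩ := mem_iUnion₂.1 hc'
    intro z hz
    obtain ⟨τ, hτ, h⟩ := IsPlotChart.exists_transition hassoc hreg hc1 hc1' hz.1
    have h1 := (smoothNear_iff_contDiffAt.1 hτ).self_of_nhds
    exact (h1.congr_of_eventuallyEq (h.mono fun _ h => h.2)).contDiffWithinAt
  have hsm : ∀ α, SmoothNear (𝓡 n) (𝓡 n) (C.chartAt α).symm (C.chartAt α α) := fun α =>
    SmoothNear.extChartAt_symm (I := 𝓡 n) α
  have hsm' : ∀ α, SmoothNear (𝓡 n) (𝓡 n) (C.chartAt α) α := fun α =>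
    SmoothNear.extChartAt (I := 𝓡 n) α
  refine ⟨n, inferInstance, inferInstance, hman, ?_, fun k => ?_⟩
  · obtain ⟨S, hS, hS'⟩ := exists_countable_cover hC C.mem_chart_source
    exact ChartedSpace.secondCountable_of_countable_cover (EuclideanSpace ℝ (Fin n)) hS' hS
  -- The lift `T` followed by the plot extends the quotient map smoothly off the words; a family
  -- through `w` representing the plot, composed with the chart, is a local section.
  · refine isSubmersionOnSubset_of_sections fun w => ?_
    have hα := C.mem_chart_source (Γ.wordClass k w)
    have h0 := (C.chartAt (Γ.wordClass k w)).left_inv hα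
    have h1 := (C.chartAt (Γ.wordClass k w)).map_source hα
    obtain ⟨T, hT, hTw, hTΦ⟩ := (hC (Γ.wordClass k w)).exists_lift _ h1 k w h0.symm
    obtain ⟨u, hu, hu0, hue⟩ := ((hC (Γ.wordClass k w)).isRepresentedAt _ h1).exists_tuple hassoc
      hreg (w := w) h0.symm
    refine ⟨_, (hsm _).comp hT hTw, hTΦ, _, hu.comp (hsm' _) rfl, hu0, ?_⟩
    filter_upwards [((hsm' _).tendsto rfl).eventually hue,
      (C.open_source' (C.chart_mem_atlas (Γ.wordClass k w))).mem_nhds hα] with α ⟨h2, h3⟩ h4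
    exact ⟨h2, by rw [← h3]; exact (C.chartAt _).left_inv h4⟩

theorem AssocUniformlyDiscrete.acIsSmooth (h : Γ.AssocUniformlyDiscrete)
    (hassoc : Γ.ThreeAssociative) (hinv : Γ.Inversional) (hreg : Γ.BiRegular)
    (haxes : Γ.ProductsConnectedToAxes) : Γ.ACIsSmooth := by
  refine acIsSmooth_of_exists_chart hassoc hreg fun α => ?_
  obtain ⟨F, _, _, hsub⟩ := Γ.src_submersion
  obtain ⟨Φ, D, z, e, κ, hΦ, hz, rfl, -⟩ :=
    exists_plot hassoc hinv hreg (h.locallyInjective hassoc hinv hreg haxes) hsub α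
  obtain ⟨c, hc, hcs⟩ := hΦ.exists_chart
  exact ⟨c, hc, hcs ▸ ⟨z, hz, rfl⟩⟩

end LocalLieGroupoid

/-! ### Countability of the fibres of `G → AC(G)` -/

namespace LocalLieGroupoid

open Filter

/-- Bracketed words with letters indexed by natural numbers. -/
inductive Bracketing : Type
  | leaf (i : ℕ) : Bracketing
  | node (l r : Bracketing) : Bracketing

namespace Bracketing

/-- An injective encoding of bracketed words by natural numbers. -/
def encode : Bracketing → ℕ
  | leaf i => 2 * i
  | node l r => 2 * Nat.pair l.encode r.encode + 1

theorem encode_injective : Function.Injective encode := by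
  intro t
  induction t with
  | leaf i =>
    intro t' h
    cases t' with
    | leaf j => simp only [encode] at h; congr 1; omega
    | node l r => simp only [encode] at h; omega
  | node l r ihl ihr =>
    intro t' h
    cases t' with
    | leaf j => simp only [encode] at h; omega
    | node l' r' =>
      simp only [encode] at h
      obtain ⟨h1, h2⟩ := Nat.pair_eq_pair.1 (show Nat.pair l.encode r.encode =
        Nat.pair l'.encode r'.encode by omega)
      rw [ihl h1, ihr h2]

instance : Countable Bracketing := encode_injective.countable

/-- The underlying word. -/
def leaves : Bracketing → List ℕ
  | leaf i => [i]
  | node l r => l.leaves ++ r.leaves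

end Bracketing

variable {p n : ℕ} {M G : Type*}
  [TopologicalSpace M] [ChartedSpace (EuclideanSpace ℝ (Fin p)) M] [IsManifold (𝓡 p) ∞ M]
  [T2Space M] [SecondCountableTopology M]
  [TopologicalSpace G] [ChartedSpace (EuclideanSpace ℝ (Fin n)) G] [IsManifold (𝓡 n) ∞ G]
  [SecondCountableTopology G]
  (Γ : LocalLieGroupoid p n M G)

/-- The value of a bracketed word. -/
def bracketVal : Bracketing → (ℕ → G) → G
  | .leaf i, ν => ν i
  | .node l r, ν => Γ.mul (bracketVal l ν, bracketVal r ν)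

/-- All products in a bracketed word are defined. -/
def BracketValid : Bracketing → (ℕ → G) → Prop
  | .leaf _, _ => True
  | .node l r, ν => BracketValid l ν ∧ BracketValid r ν ∧
      (Γ.bracketVal l ν, Γ.bracketVal r ν) ∈ Γ.dom

variable {Γ}

theorem BracketValid.evaluatesTo {t : Bracketing} {ν : ℕ → G} (h : Γ.BracketValid t ν) :
    Γ.EvaluatesTo (t.leaves.map ν) (Γ.bracketVal t ν) := by
  induction t with
  | leaf i => exact .single _
  | node l r ihl ihr =>
    rw [Bracketing.leaves, List.map_append]
    exact .mul (ihl h.1) (ihr h.2.1) h.2.2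

theorem EvaluatesTo.exists_bracketing {w : List G} {g : G} (h : Γ.EvaluatesTo w g) {L : List ℕ}
    {ν : ℕ → G} (hL : L.map ν = w) :
    ∃ t : Bracketing, t.leaves = L ∧ Γ.BracketValid t ν ∧ Γ.bracketVal t ν = g := by
  induction h generalizing L with
  | single g =>
    obtain ⟨i, rfl, rfl⟩ : ∃ i, L = [i] ∧ ν i = g := by
      obtain ⟨i, L', rfl, h1, h2⟩ := List.map_eq_cons_iff.1 hL
      exact ⟨i, by rw [List.map_eq_nil_iff.1 h2], h1⟩
    exact ⟨.leaf i, rfl, trivial, rfl⟩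
  | mul _ _ hd ih ih' =>
    obtain ⟨L₁, L₂, rfl, h1, h2⟩ := List.map_eq_append_iff.1 hL
    obtain ⟨t, ht, hv, rfl⟩ := ih h1
    obtain ⟨t', ht', hv', rfl⟩ := ih' h2
    exact ⟨.node t t', by rw [Bracketing.leaves, ht, ht'], ⟨hv, hv', hd⟩, rfl⟩

theorem tendsto_bracketVal {t : Bracketing} {ν₀ : ℕ → G} {l : Filter (ℕ → G)} (hl : l ≤ 𝓝 ν₀)
    (h : ∀ᶠ ν in l, Γ.BracketValid t ν) (h₀ : Γ.BracketValid t ν₀) :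
    Tendsto (Γ.bracketVal t) l (𝓝 (Γ.bracketVal t ν₀)) := by
  induction t with
  | leaf i => exact ((continuous_apply i).tendsto ν₀).mono_left hl
  | node t t' ih ih' =>
    exact tendsto_mul h₀.2.2 (ih (h.mono fun _ h => h.1) h₀.1) (ih' (h.mono fun _ h => h.2.1) h₀.2.1)
      (h.mono fun _ h => Γ.dom_composable _ _ h.2.2)

/-- The elements connecting the letters of two words, obtained successively by right division. -/
def connect (Γ : LocalLieGroupoid p n M G) (δ : ℕ → G × G → G) (ν₀ : ℕ → G) :
    List ℕ → ((ℕ → G) → G) → (ℕ → G) → G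
  | [], c => c
  | i :: L, c => fun ν => δ i (Γ.mul (ν i, connect Γ δ ν₀ L c ν), ν₀ i)

theorem connect_append (δ : ℕ → G × G → G) (ν₀ : ℕ → G) (L L' : List ℕ) (c : (ℕ → G) → G) :
    Γ.connect δ ν₀ (L ++ L') c = Γ.connect δ ν₀ L (Γ.connect δ ν₀ L' c) := by
  induction L with
  | nil => rfl
  | cons i L ih => simp only [List.cons_append, connect, ih]

/-- Division at one letter gives `d ν₀ᵢ = νᵢ d'`, where `d'` is the element already obtained from
the letters to its right. Pushing the connecting elements through the whole word gives `d t(ν₀) =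
t(ν) c`. The point is that `d` depends on the letters only, so different bracketings of the same
word share it. -/
theorem connect_spec (hassoc : Γ.ThreeAssociative) {δ : ℕ → G × G → G} {ν₀ : ℕ → G}
    (hδ : ∀ i, Tendsto (δ i) (𝓝 (ν₀ i, ν₀ i)) (𝓝 (Γ.unit (Γ.tgt (ν₀ i)))) ∧
      ∀ᶠ q in 𝓝 (ν₀ i, ν₀ i), Γ.src q.1 = Γ.src q.2 → (δ i q, q.2) ∈ Γ.dom ∧ Γ.mul (δ i q, q.2) = q.1)
    {l : Filter (ℕ → G)} (hl : l ≤ 𝓝 ν₀) {t : Bracketing} (h : ∀ᶠ ν in l, Γ.BracketValid t ν)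
    (h₀ : Γ.BracketValid t ν₀) {c : (ℕ → G) → G}
    (hc : Tendsto c l (𝓝 (Γ.unit (Γ.src (Γ.bracketVal t ν₀)))))
    (hcs : ∀ᶠ ν in l, Γ.src (c ν) = Γ.src (Γ.bracketVal t ν₀))
    (hct : ∀ᶠ ν in l, Γ.src (Γ.bracketVal t ν) = Γ.tgt (c ν)) :
    Tendsto (Γ.connect δ ν₀ t.leaves c) l (𝓝 (Γ.unit (Γ.tgt (Γ.bracketVal t ν₀)))) ∧
      ∀ᶠ ν in l, (Γ.connect δ ν₀ t.leaves c ν, Γ.bracketVal t ν₀) ∈ Γ.dom ∧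
        (Γ.bracketVal t ν, c ν) ∈ Γ.dom ∧
        Γ.mul (Γ.connect δ ν₀ t.leaves c ν, Γ.bracketVal t ν₀) = Γ.mul (Γ.bracketVal t ν, c ν) := by
  have hval := tendsto_bracketVal hl h h₀
  have hvc := eventually_dom (Γ.mem_dom_right _) hval hc hct
  have hm := tendsto_mul (Γ.mem_dom_right _) hval hc hct
  rw [Γ.mul_unit] at hm
  induction t generalizing c with
  | leaf i =>
    have h1 := hm.prodMk_nhds (tendsto_const_nhds (x := ν₀ i))
    refine ⟨(hδ i).1.comp h1, ?_⟩
    filter_upwards [h1.eventually (hδ i).2, hvc, hcs] with ν h2 h3 h4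
    obtain ⟨h5, h6⟩ := h2 (by rw [Γ.src_mul _ _ h3, h4]; rfl)
    exact ⟨h5, h3, h6⟩
  | node t t' ih ih' =>
    obtain ⟨v1, v2, v3⟩ := h₀
    have h1 := h.mono fun _ h => h.1
    have h2 := h.mono fun _ h => h.2.1
    have h3 := h.mono fun _ h => h.2.2
    have hs0 : Γ.src (Γ.bracketVal (.node t t') ν₀) = Γ.src (Γ.bracketVal t' ν₀) := Γ.src_mul _ _ v3
    have ht0 : Γ.tgt (Γ.bracketVal (.node t t') ν₀) = Γ.tgt (Γ.bracketVal t ν₀) := Γ.tgt_mul _ _ v3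
    have hsr : ∀ᶠ ν in l, Γ.src (Γ.bracketVal (.node t t') ν) = Γ.src (Γ.bracketVal t' ν) :=
      h3.mono fun _ h => Γ.src_mul _ _ h
    rw [hs0] at hc hcs
    have hval1 := tendsto_bracketVal hl h1 v1
    have hval2 := tendsto_bracketVal hl h2 v2
    have hct' : ∀ᶠ ν in l, Γ.src (Γ.bracketVal t' ν) = Γ.tgt (c ν) := by
      filter_upwards [hsr, hct] with ν e1 e2 using e1.symm.trans e2
    have hm2 := tendsto_mul (Γ.mem_dom_right _) hval2 hc hct'
    rw [Γ.mul_unit] at hm2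
    obtain ⟨hd', hr⟩ := ih' h2 v2 hc hcs hct' hval2
      (eventually_dom (Γ.mem_dom_right _) hval2 hc hct') hm2
    rw [Bracketing.leaves, connect_append]
    generalize Γ.connect δ ν₀ t'.leaves c = d' at *
    rw [← Γ.dom_composable _ _ v3] at hd'
    have hct1 : ∀ᶠ ν in l, Γ.src (Γ.bracketVal t ν) = Γ.tgt (d' ν) := by
      filter_upwards [hr, h3] with ν e1 e2
      rw [Γ.dom_composable _ _ e2, ← Γ.tgt_mul _ _ e1.1, e1.2.2, Γ.tgt_mul _ _ e1.2.1]
    have hcs1 : ∀ᶠ ν in l, Γ.src (d' ν) = Γ.src (Γ.bracketVal t ν₀) := by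
      filter_upwards [hr] with ν e1
      rw [Γ.dom_composable _ _ e1.1, Γ.dom_composable _ _ v3]
    have hm1 := tendsto_mul (Γ.mem_dom_right _) hval1 hd' hct1
    rw [Γ.mul_unit] at hm1
    obtain ⟨hd, hq⟩ := ih h1 v1 hd' hcs1 hct1 hval1
      (eventually_dom (Γ.mem_dom_right _) hval1 hd' hct1) hm1
    generalize Γ.connect δ ν₀ t.leaves d' = d at *
    rw [ht0]
    refine ⟨hd, ?_⟩
    have k1 : ∀ᶠ ν in l, (d ν, Γ.bracketVal (.node t t') ν₀) ∈ Γ.dom := by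
      refine eventually_dom (Γ.mem_dom_left _) (by rwa [ht0]) tendsto_const_nhds ?_
      filter_upwards [hq] with ν e1
      rw [ht0, Γ.dom_composable _ _ e1.1]
    have k2 : ∀ᶠ ν in l, (Γ.mul (Γ.bracketVal t ν, d' ν), Γ.bracketVal t' ν₀) ∈ Γ.dom := by
      refine eventually_dom v3 hm1 tendsto_const_nhds ?_
      filter_upwards [hq, hr] with ν e1 e2
      rw [Γ.src_mul _ _ e1.2.1, Γ.dom_composable _ _ e2.1]
    have k3 : ∀ᶠ ν in l, (Γ.bracketVal t ν, Γ.mul (Γ.bracketVal t' ν, c ν)) ∈ Γ.dom := by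
      refine eventually_dom v3 hval1 hm2 ?_
      filter_upwards [h3, hr] with ν e1 e2
      rw [Γ.tgt_mul _ _ e2.2.1, Γ.dom_composable _ _ e1]
    filter_upwards [hq, hr, h3, hvc, k1, k2, k3] with ν e1 e2 e3 e4 e5 e6 e7
    refine ⟨e5, e4, ?_⟩
    -- Writing `t₀`, `t₀'` for the values at `ν₀`: `(t t')c = t(t'c) = t(d' t₀') = (t d')t₀' = (d
    -- t₀)t₀' = d(t₀ t₀')`.
    change Γ.mul (_, Γ.mul (_, _)) = Γ.mul (Γ.mul (_, _), _)
    rw [hassoc _ _ _ e3 e2.2.1 e4 e7, ← e2.2.2, ← hassoc _ _ _ e1.1 v3 (e1.2.2 ▸ e6) e5, e1.2.2]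
    exact hassoc _ _ _ e1.2.1 e2.1 e6 (by rw [e2.2.2]; exact e7)

/-- Both bracketings share the connecting element `d` that starts from `c = 1`. For `t` the relation
reads `d g₀ = g₀`, and uniqueness of division near the unit makes `d` a unit. For `t'` it then says
that the value at `ν` is the value at `ν₀`. -/
theorem eventually_bracketVal_eq (hassoc : Γ.ThreeAssociative) (hreg : Γ.BiRegular)
    {t t' : Bracketing} (htt' : t.leaves = t'.leaves) {g₀ : G} {ν₀ : ℕ → G}
    (h₀ : Γ.BracketValid t ν₀ ∧ Γ.BracketValid t' ν₀ ∧ Γ.bracketVal t ν₀ = g₀) :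
    ∀ᶠ ν in 𝓝[{ν | Γ.BracketValid t ν ∧ Γ.BracketValid t' ν ∧ Γ.bracketVal t ν = g₀}] ν₀,
      Γ.bracketVal t' ν = Γ.bracketVal t' ν₀ := by
  obtain ⟨v1, v2, v3⟩ := h₀
  have hδ := fun i => (hreg (ν₀ i)).2.exists_division
  choose δ hδ1 hδ2 hδ3 _ using hδ
  have hδ' : ∀ i, Tendsto (δ i) (𝓝 (ν₀ i, ν₀ i)) (𝓝 (Γ.unit (Γ.tgt (ν₀ i)))) ∧
      ∀ᶠ q in 𝓝 (ν₀ i, ν₀ i), Γ.src q.1 = Γ.src q.2 →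
        (δ i q, q.2) ∈ Γ.dom ∧ Γ.mul (δ i q, q.2) = q.1 :=
    fun i => ⟨(hδ1 i).tendsto (hδ2 i), hδ3 i⟩
  obtain ⟨δ₀, -, h01, -, h02⟩ := (hreg g₀).2.exists_division
  set Z := {ν | Γ.BracketValid t ν ∧ Γ.BracketValid t' ν ∧ Γ.bracketVal t ν = g₀}
  have hl : 𝓝[Z] ν₀ ≤ 𝓝 ν₀ := nhdsWithin_le_nhds
  have hZ : ∀ᶠ ν in 𝓝[Z] ν₀, ν ∈ Z := self_mem_nhdsWithin
  have hst : ∀ ν, Γ.BracketValid t ν → Γ.BracketValid t' ν →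
      Γ.tgt (Γ.bracketVal t ν) = Γ.tgt (Γ.bracketVal t' ν) ∧
      Γ.src (Γ.bracketVal t ν) = Γ.src (Γ.bracketVal t' ν) := by
    intro ν h1 h2
    have h3 := h1.evaluatesTo.equivalent.symm.trans (by rw [htt']; exact h2.evaluatesTo.equivalent)
    have h4 := h3.isWord (y := Γ.tgt (Γ.bracketVal t ν)) (x := Γ.src (Γ.bracketVal t ν)) ⟨rfl, rfl⟩
    exact ⟨h4.1.symm, h4.2.symm⟩
  obtain ⟨e1, e2⟩ := connect_spec hassoc hδ' hl (t := t) (c := fun _ => Γ.unit (Γ.src g₀))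
    (hZ.mono fun _ h => h.1) v1 (by rw [v3]; exact tendsto_const_nhds)
    (by simp [v3, Γ.src_unit]) (hZ.mono fun _ h => by rw [h.2.2, Γ.tgt_unit])
  have hs' := (hst ν₀ v1 v2).2
  have ht' := (hst ν₀ v1 v2).1
  rw [v3] at hs' ht'
  obtain ⟨f1, f2⟩ := connect_spec hassoc hδ' hl (t := t') (c := fun _ => Γ.unit (Γ.src g₀))
    (hZ.mono fun _ h => h.2.1) v2 (by rw [hs']; exact tendsto_const_nhds)
    (by simp [hs', Γ.src_unit]) (hZ.mono fun ν h => by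
      rw [← (hst ν h.1 h.2.1).2, h.2.2, Γ.tgt_unit])
  rw [← htt'] at f2
  generalize Γ.connect δ ν₀ t.leaves (fun _ => Γ.unit (Γ.src g₀)) = d at *
  rw [v3] at e1
  filter_upwards [hZ, e2, f2, (e1.prodMk_nhds (tendsto_const_nhds (x := g₀))).eventually h02]
    with ν k1 k2 k3 k4
  rw [v3] at k2
  have k5 := k4 k2.1
  rw [k2.2.2, k1.2.2, Γ.mul_unit, h01, ht'] at k5
  have k6 := k3.2.2
  rw [← k5, Γ.unit_mul, ← k1.2.2, (hst ν k1.1 k1.2.1).2, Γ.mul_unit] at k6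
  exact k6.symm

/-- The fibres of the natural map to the associative completion are countable. -/
theorem countable_toAC_fibre (hassoc : Γ.ThreeAssociative) (hreg : Γ.BiRegular)
    (haxes : Γ.ProductsConnectedToAxes) (g₀ : G) : {g | Γ.toAC g = Γ.toAC g₀}.Countable := by
  let Z : Bracketing → Bracketing → Set (ℕ → G) := fun t t' =>
    {ν | Γ.BracketValid t ν ∧ Γ.BracketValid t' ν ∧ Γ.bracketVal t ν = g₀}
  -- A locally constant function on a Lindelöf space takes countably many values.
  have hZ : ∀ t t' : Bracketing, t.leaves = t'.leaves → (Γ.bracketVal t' '' Z t t').Countable := by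
    intro t t' htt'
    obtain ⟨S, hS, hS'⟩ := LindelofSpace.elim_nhds_subcover
      (fun ν₀ : Z t t' => {ν : Z t t' | Γ.bracketVal t' ν = Γ.bracketVal t' ν₀}) fun ν₀ => by
        have := eventually_bracketVal_eq hassoc hreg htt' ν₀.2
        rw [nhdsWithin_eq_map_subtype_coe ν₀.2] at this
        exact this
    refine (hS.image fun ν : Z t t' => Γ.bracketVal t' ν.1).mono ?_
    rintro _ ⟨ν, hν, rfl⟩
    obtain ⟨ν₀, h1, h2⟩ := mem_iUnion₂.1 (hS'.ge (mem_univ ⟨ν, hν⟩))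
    exact ⟨ν₀, h1, Eq.symm h2⟩
  refine (countable_iUnion fun t => countable_iUnion fun t' => countable_iUnion (hZ t t')).mono ?_
  intro g hg
  obtain ⟨w, h1, h2⟩ := exists_evaluatesTo_of_toAC_eq hassoc hreg haxes hg
  -- The word is extended to a sequence by the filler `g₀`; only its first `w.length` entries are
  -- read.
  have hw : (List.range w.length).map (fun i => w.getD i g₀) = w := by
    refine List.ext_get (by simp) fun i h3 h4 => ?_
    simp only [List.length_map, List.length_range] at h3
    simp [h3]
  obtain ⟨t, ht, hv, hg₀⟩ := h2.exists_bracketing hw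
  obtain ⟨t', ht', hv', hg'⟩ := h1.exists_bracketing hw
  exact mem_iUnion.2 ⟨t, mem_iUnion.2 ⟨t', mem_iUnion.2 ⟨ht.trans ht'.symm, _, ⟨hv, hv', hg₀⟩, hg'⟩⟩⟩

end LocalLieGroupoid

/-! ### Consequences of a smooth structure on the completion -/

namespace LocalLieGroupoid

open Filter

variable {p n : ℕ} {M G : Type*}
  [TopologicalSpace M] [ChartedSpace (EuclideanSpace ℝ (Fin p)) M] [IsManifold (𝓡 p) ∞ M]
  [T2Space M] [SecondCountableTopology M]
  [TopologicalSpace G] [ChartedSpace (EuclideanSpace ℝ (Fin n)) G] [IsManifold (𝓡 n) ∞ G]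
  [SecondCountableTopology G]
  {Γ : LocalLieGroupoid p n M G}

theorem unit_mem_assoc (x : M) : Γ.unit x ∈ Γ.Assoc :=
  ⟨x, Γ.src_unit x, Γ.tgt_unit x, _, .single _, .single _⟩

/-- An associator has the class of the unit at its source, and near a unit both lie in one
neighbourhood of injectivity. -/
theorem LocallyInjective.assocUniformlyDiscrete (h : Γ.LocallyInjective) :
    Γ.AssocUniformlyDiscrete := by
  have h1 : ∀ x, ∃ O : Set G, IsOpen O ∧ Γ.unit x ∈ O ∧
      ∀ g ∈ O, Γ.toAC g = Γ.toAC (Γ.unit (Γ.src g)) → g = Γ.unit (Γ.src g) := by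
    intro x
    obtain ⟨O, hO, hinj⟩ := h x
    have h2 : Tendsto (fun g => Γ.unit (Γ.src g)) (𝓝 (Γ.unit x)) (𝓝 (Γ.unit x)) := by
      have h3 := (Γ.continuous_unit.comp Γ.continuous_src).tendsto (Γ.unit x)
      simp only [Function.comp_apply, Γ.src_unit] at h3
      exact h3
    obtain ⟨U, hU, oU, xU⟩ := eventually_nhds_iff.1 ((h2.eventually hO).and hO)
    exact ⟨U, oU, xU, fun g hg e => hinj (hU g hg).2 (hU g hg).1 e⟩
  choose O oO xO hO using h1
  refine ⟨⋃ x, O x, isOpen_iUnion oO, ?_, ?_⟩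
  · rintro _ ⟨x, rfl⟩
    exact mem_iUnion.2 ⟨x, xO x⟩
  · ext g
    constructor
    · rintro ⟨h2, h3⟩
      obtain ⟨x, h4⟩ := mem_iUnion.1 h2
      exact ⟨_, (hO x g h4 (toAC_eq_unit_of_mem_assoc h3)).symm⟩
    · rintro ⟨x, rfl⟩
      exact ⟨mem_iUnion.2 ⟨x, xO x⟩, unit_mem_assoc x⟩

section Smooth

variable {E : Type*} [NormedAddCommGroup E] [NormedSpace ℝ E] {H : Type*} [TopologicalSpace H]
  {I : ModelWithCorners ℝ E H} {P : Type*} [TopologicalSpace P] [ChartedSpace H P] {p₀ : P}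
  {E' : Type*} [NormedAddCommGroup E'] [NormedSpace ℝ E'] {H' : Type*} [TopologicalSpace H']
  {J : ModelWithCorners ℝ E' H'} {Q : Type*} [TopologicalSpace Q] [ChartedSpace H' Q] {q₀ : Q}

theorem IsRepresentedAt.comp {f : P → Γ.AC} (h : Γ.IsRepresentedAt I p₀ f) {φ : Q → P}
    (hφ : SmoothNear J I φ q₀) (h0 : φ q₀ = p₀) : Γ.IsRepresentedAt J q₀ fun q => f (φ q) := by
  obtain ⟨w, ws, y, x, hw, hws, hf⟩ := h
  refine ⟨w, _, _, _, hw, hws.comp hφ h0, ?_⟩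
  filter_upwards [(hφ.tendsto h0).eventually hf] with q hq
  simp only [evalWord_map]
  exact hq

theorem IsRepresentedAt.congr {f g : P → Γ.AC} (h : Γ.IsRepresentedAt I p₀ f)
    (hg : ∀ᶠ q in 𝓝 p₀, g q = f q) : Γ.IsRepresentedAt I p₀ g := by
  obtain ⟨w, ws, y, x, hw, hws, hf⟩ := h
  refine ⟨w, ws, y, x, hw, hws, ?_⟩
  filter_upwards [hf, hg] with q h1 h2
  rwa [h2]

theorem isRepresentedAt_toAC (g : G) : Γ.IsRepresentedAt (𝓡 n) g Γ.toAC := by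
  refine ⟨[g], [fun g => g], Γ.tgt, Γ.src, by simp, ⟨?_, rfl, ?_⟩, ?_⟩
  · intro f hf
    rw [List.mem_singleton.1 hf]
    exact .id g
  · exact Eventually.of_forall fun g => ⟨rfl, rfl⟩
  · exact Eventually.of_forall fun g => ⟨⟨by simp, by simp⟩, rfl⟩

namespace IsSmoothQuotient

variable {d : ℕ} [TopologicalSpace Γ.AC] [ChartedSpace (EuclideanSpace ℝ (Fin d)) Γ.AC]
  (hN : Γ.IsSmoothQuotient d)
include hN

/-- The class of a list of smooth maps extends to a smooth map. -/
theorem exists_extension {ws : List (P → G)} (hws : SmoothList n I p₀ ws)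
    (hw : Γ.WellFormed (evalWord ws p₀)) :
    ∃ f : P → Γ.AC, SmoothNear I (𝓡 d) f p₀ ∧
      ∀ᶠ q in 𝓝 p₀, ∀ h : Γ.WellFormed (evalWord ws q), f q = Γ.cls ⟨evalWord ws q, h⟩ := by
  obtain ⟨k, hk⟩ : ∃ k, ws.length = k + 1 := by
    refine Nat.exists_eq_succ_of_ne_zero fun h => hw.1 ?_
    rw [List.length_eq_zero_iff.1 h, evalWord_nil]
  obtain ⟨u, hu, hue⟩ := hws.exists_tuple hk
  have hw' : u p₀ ∈ Γ.words k := by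
    change Γ.WellFormed _
    rwa [hue]
  obtain ⟨O, F, oO, hO, hF, hFw, -⟩ := hN.submersion k ⟨u p₀, hw'⟩
  refine ⟨fun q => F (u q), (SmoothNear.of_contMDiffOn hF oO hO).comp hu rfl, ?_⟩
  filter_upwards [hu.continuousAt.eventually (oO.mem_nhds hO)] with q hq h
  have h1 : u q ∈ Γ.words k := by
    change Γ.WellFormed _
    rwa [hue]
  rw [hFw ⟨u q, h1⟩ hq]
  exact congrArg Γ.cls (Subtype.ext (hue q))

theorem smoothNear {f : P → Γ.AC} (h : Γ.IsRepresentedAt I p₀ f) :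
    SmoothNear I (𝓡 d) f p₀ := by
  obtain ⟨w, ws, y, x, hw, hws, hf⟩ := h
  obtain ⟨F, hF, hFw⟩ := hN.exists_extension hws.smooth hf.self_of_nhds.1
  refine hF.congr ?_
  filter_upwards [hf, hFw] with q ⟨h1, h2⟩ h3
  rw [h2, h3 h1]

/-- This frees the submersion property from the chosen local extension: any `f` that gives the
classes of the words on the curve has velocity `η`. -/
theorem exists_curve {k : ℕ} (w : Γ.words k) (η : TangentBundle (𝓡 d) Γ.AC)
    (hη : η.proj = Γ.wordClass k w) :
    ∃ c : ℝ → Fin (k + 1) → G, c 0 = w.1 ∧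
      MDifferentiableAt 𝓘(ℝ, ℝ) (ModelWithCorners.pi fun _ : Fin (k + 1) => 𝓡 n) c 0 ∧
      ∀ f : ℝ → Γ.AC, (∀ᶠ r in 𝓝 0, ∀ h : c r ∈ Γ.words k, f r = Γ.wordClass k ⟨c r, h⟩) →
        tangentMap 𝓘(ℝ, ℝ) (𝓡 d) f ⟨0, (1 : ℝ)⟩ = η := by
  obtain ⟨O, F, oO, hO, hF, hFw, hc⟩ := hN.submersion k w
  obtain ⟨c, hc0, hc, hcw, hcη⟩ := hc η hη
  refine ⟨c, hc0, hc.mdifferentiableAt (by simp), fun f hf => ?_⟩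
  have h1 : f =ᶠ[𝓝 0] F ∘ c := by
    have h2 : Tendsto c (𝓝 0) (𝓝 w.1) := hc0 ▸ hc.continuousAt
    filter_upwards [hf, hcw, h2.eventually (oO.mem_nhds hO)] with r h3 h4 h5
    rw [h3 h4, Function.comp_apply, hFw ⟨c r, h4⟩ h5]
  have h2 : mfderiv 𝓘(ℝ, ℝ) (𝓡 d) f 0 = mfderiv 𝓘(ℝ, ℝ) (𝓡 d) (F ∘ c) 0 := h1.mfderiv_eq
  rw [← hcη]
  simp only [tangentMap]
  rw [h2]
  exact tangentBundle_mk_congr h1.self_of_nhds _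

/-- One-letter words make `Γ.toAC` a submersion, and countable fibres leave no room for a kernel of
its differential. -/
theorem hasSmoothLocalInverseAt_toAC (hassoc : Γ.ThreeAssociative) (hreg : Γ.BiRegular)
    (haxes : Γ.ProductsConnectedToAxes) (g : G) :
    HasSmoothLocalInverseAt (𝓡 n) (𝓡 d) Γ.toAC g := by
  have := hN.isManifold
  have h1 := hN.smoothNear (isRepresentedAt_toAC g)
  refine h1.hasSmoothLocalInverseAt (h1.bijective_mfderiv_of_countable_fibre ?_ univ_mem
    ((countable_toAC_fibre hassoc hreg haxes g).mono fun g' h => h.2))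
  refine surjective_mfderiv_of_curves rfl h1 fun η hη => ?_
  have hw : (fun _ => g : Fin (0 + 1) → G) ∈ Γ.words 0 := by simp [words, WellFormed]
  obtain ⟨c, hc0, hc, hcη⟩ := hN.exists_curve ⟨_, hw⟩ η (by rw [hη]; exact congrArg Γ.cls (by simp))
  refine ⟨fun r => c r 0, by simp only [hc0], ?_, hcη _ ?_⟩
  · exact ((SmoothNear.apply (I := 𝓡 n) (c 0) 0).mdifferentiableAt).comp 0 hc
  · exact Eventually.of_forall fun r h => congrArg Γ.cls (by simp)

theorem isLocalDiffeomorph_toAC (hassoc : Γ.ThreeAssociative) (hreg : Γ.BiRegular)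
    (haxes : Γ.ProductsConnectedToAxes) : IsLocalDiffeomorph (𝓡 n) (𝓡 d) ∞ Γ.toAC := fun g =>
  (hN.hasSmoothLocalInverseAt_toAC hassoc hreg haxes g).isLocalDiffeomorphAt
    (hN.smoothNear (isRepresentedAt_toAC g))

theorem locallyInjective (hassoc : Γ.ThreeAssociative) (hreg : Γ.BiRegular)
    (haxes : Γ.ProductsConnectedToAxes) : Γ.LocallyInjective := by
  intro x
  obtain ⟨h, -, -, h1, -⟩ := hN.hasSmoothLocalInverseAt_toAC hassoc hreg haxes (Γ.unit x)
  exact ⟨_, h1, fun g hg g' hg' e => (Eq.symm hg).trans ((congrArg h e).trans hg')⟩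

/-- Curves of words lift to curves of parameters through `T`, so `Φ` has surjective differential;
injectivity of `Φ` on `D` then excludes a kernel. -/
theorem hasSmoothLocalInverseAt_plot {Φ : EuclideanSpace ℝ (Fin n) → Γ.AC}
    {D : Set (EuclideanSpace ℝ (Fin n))} (hΦ : Γ.IsPlot Φ D) {z : EuclideanSpace ℝ (Fin n)}
    (hz : z ∈ D) : HasSmoothLocalInverseAt (𝓡 n) (𝓡 d) Φ z := by
  have := hN.isManifold
  have h1 := hN.smoothNear (hΦ.isRepresentedAt z hz)
  refine h1.hasSmoothLocalInverseAt (h1.bijective_mfderiv_of_countable_fibre ?_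
    (hΦ.isOpen.mem_nhds hz) ((countable_singleton z).mono fun z' h => hΦ.injOn h.1 hz h.2))
  refine surjective_mfderiv_of_curves rfl h1 fun η hη => ?_
  obtain ⟨k, w, hw⟩ := exists_wordClass (Φ z)
  obtain ⟨T, hT, hTw, hTΦ⟩ := hΦ.exists_lift z hz k w hw
  obtain ⟨c, hc0, hc, hcη⟩ := hN.exists_curve w η (hη.trans hw.symm)
  refine ⟨fun r => T (c r), by simp only [hc0, hTw], ?_, hcη _ ?_⟩
  · rw [← hc0] at hT
    exact hT.mdifferentiableAt.comp 0 hc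
  · have h2 : Tendsto c (𝓝 0) (𝓝 w.1) := hc0 ▸ hc.continuousAt
    exact h2.eventually hTΦ

/-- The element `g` is essential: if `G` is empty, so is the completion, and its dimension is
arbitrary. -/
theorem eq_dim (g : G) (hassoc : Γ.ThreeAssociative) (hreg : Γ.BiRegular)
    (haxes : Γ.ProductsConnectedToAxes) : d = n := by
  have e := (hN.isLocalDiffeomorph_toAC hassoc hreg haxes g).mfderivToContinuousLinearEquiv
    (by simp)
  have e' : EuclideanSpace ℝ (Fin n) ≃L[ℝ] EuclideanSpace ℝ (Fin d) := e
  simpa using e'.toLinearEquiv.finrank_eq.symm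

/-- Near every point, the identity of the associative completion is represented by a smooth family
of words. -/
theorem isRepresentedAt_id (hassoc : Γ.ThreeAssociative) (hinv : Γ.Inversional)
    (hreg : Γ.BiRegular) (haxes : Γ.ProductsConnectedToAxes) (α : Γ.AC) :
    Γ.IsRepresentedAt (𝓡 d) α fun β => β := by
  obtain ⟨F, _, _, hsub⟩ := Γ.src_submersion
  obtain ⟨Φ, D, z, -, -, hΦ, hz, rfl, -⟩ :=
    exists_plot hassoc hinv hreg (hN.locallyInjective hassoc hreg haxes) hsub α
  obtain ⟨h, h1, h2, -, h3⟩ := hN.hasSmoothLocalInverseAt_plot hΦ hz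
  exact ((hΦ.isRepresentedAt z hz).comp h1 h2).congr (h3.mono fun _ h => h.symm)

end IsSmoothQuotient

end Smooth

end LocalLieGroupoid

namespace LocalLieGroupoid

open Filter

variable {p n : ℕ} {M G : Type*}
  [TopologicalSpace M] [ChartedSpace (EuclideanSpace ℝ (Fin p)) M] [IsManifold (𝓡 p) ∞ M]
  [T2Space M] [SecondCountableTopology M]
  [TopologicalSpace G] [ChartedSpace (EuclideanSpace ℝ (Fin n)) G] [IsManifold (𝓡 n) ∞ G]
  [SecondCountableTopology G]
  {Γ : LocalLieGroupoid p n M G}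

/-! ### The groupoid structure of the associative completion -/

theorem IsWord.acSrc_cls {u : List G} {y x : M} (h : Γ.IsWord u y x) (hu : Γ.WellFormed u) :
    Γ.acSrc (Γ.cls ⟨u, hu⟩) = x := by
  have h1 := isWord_word ⟨u, hu⟩
  obtain rfl := h.tgt_unique h1 hu.1
  exact (h.src_unique h1).symm

theorem IsWord.acTgt_cls {u : List G} {y x : M} (h : Γ.IsWord u y x) (hu : Γ.WellFormed u) :
    Γ.acTgt (Γ.cls ⟨u, hu⟩) = y :=
  (h.tgt_unique (isWord_word ⟨u, hu⟩) hu.1).symm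

theorem exists_isWord_cls (α : Γ.AC) :
    ∃ (u : List G) (h : Γ.WellFormed u), Γ.IsWord u (Γ.acTgt α) (Γ.acSrc α) ∧ Γ.cls ⟨u, h⟩ = α := by
  obtain ⟨w, rfl⟩ : ∃ w, Γ.cls w = α := ⟨_, Γ.cls_out α⟩
  exact ⟨w.1, w.2, isWord_word w, rfl⟩

open Classical in
/-- The composition of the associative completion as a total function. -/
noncomputable def acMul (Γ : LocalLieGroupoid p n M G) (α β : Γ.AC) : Γ.AC :=
  if h : Γ.acSrc α = Γ.acTgt β then Γ.acComp ⟨(α, β), h⟩ else α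

theorem acComp_eq_acMul (α β : Γ.AC) (h : Γ.acSrc α = Γ.acTgt β) :
    Γ.acComp ⟨(α, β), h⟩ = Γ.acMul α β := by
  rw [acMul, dif_pos h]

theorem acMul_cls {u v : List G} {y z x : M} (hu : Γ.IsWord u y z) (hv : Γ.IsWord v z x)
    (hu' : Γ.WellFormed u) (hv' : Γ.WellFormed v) :
    ∃ h, Γ.acMul (Γ.cls ⟨u, hu'⟩) (Γ.cls ⟨v, hv'⟩) = Γ.cls ⟨u ++ v, h⟩ := by
  have h1 : Γ.acSrc (Γ.cls ⟨u, hu'⟩) = Γ.acTgt (Γ.cls ⟨v, hv'⟩) := by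
    rw [hu.acSrc_cls, hv.acTgt_cls]
  refine ⟨(Γ.append ⟨u, hu'⟩ ⟨v, hv'⟩ h1).2, ?_⟩
  rw [← acComp_eq_acMul _ _ h1]
  exact Γ.acComp_cls _ _ h1

theorem acSrc_acMul {α β : Γ.AC} (h : Γ.acSrc α = Γ.acTgt β) :
    Γ.acSrc (Γ.acMul α β) = Γ.acSrc β := by
  obtain ⟨u, hu, hu', rfl⟩ := exists_isWord_cls α
  obtain ⟨v, hv, hv', rfl⟩ := exists_isWord_cls β
  rw [h] at hu'
  obtain ⟨h1, h2⟩ := acMul_cls hu' hv' hu hv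
  rw [h2, (hu'.append hv').acSrc_cls]

theorem acTgt_acMul {α β : Γ.AC} (h : Γ.acSrc α = Γ.acTgt β) :
    Γ.acTgt (Γ.acMul α β) = Γ.acTgt α := by
  obtain ⟨u, hu, hu', rfl⟩ := exists_isWord_cls α
  obtain ⟨v, hv, hv', rfl⟩ := exists_isWord_cls β
  rw [h] at hu'
  obtain ⟨h1, h2⟩ := acMul_cls hu' hv' hu hv
  rw [h2, (hu'.append hv').acTgt_cls]

theorem acMul_assoc {α β γ : Γ.AC} (h : Γ.acSrc α = Γ.acTgt β) (h' : Γ.acSrc β = Γ.acTgt γ) :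
    Γ.acMul (Γ.acMul α β) γ = Γ.acMul α (Γ.acMul β γ) := by
  obtain ⟨u, hu, hu', rfl⟩ := exists_isWord_cls α
  obtain ⟨v, hv, hv', rfl⟩ := exists_isWord_cls β
  obtain ⟨w, hw, hw', rfl⟩ := exists_isWord_cls γ
  rw [h] at hu'
  rw [h'] at hv'
  obtain ⟨h1, h2⟩ := acMul_cls hu' hv' hu hv
  obtain ⟨h3, h4⟩ := acMul_cls hv' hw' hv hw
  obtain ⟨h5, h6⟩ := acMul_cls (hu'.append hv') hw' h1 hw
  obtain ⟨h7, h8⟩ := acMul_cls hu' (hv'.append hw') hu h3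
  rw [h2, h4, h6, h8]
  exact congrArg Γ.cls (Subtype.ext (List.append_assoc _ _ _))

theorem acSrc_acUnit (x : M) : Γ.acSrc (Γ.acUnit x) = x := Γ.src_unit x

theorem acTgt_acUnit (x : M) : Γ.acTgt (Γ.acUnit x) = x := Γ.tgt_unit x

theorem isWord_unit (x : M) : Γ.IsWord [Γ.unit x] x x := ⟨Γ.tgt_unit x, Γ.src_unit x⟩

theorem acMul_acUnit (α : Γ.AC) : Γ.acMul α (Γ.acUnit (Γ.acSrc α)) = α := by
  obtain ⟨u, hu, hu', h⟩ := exists_isWord_cls α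
  obtain ⟨h1, h2⟩ := acMul_cls hu' (isWord_unit _) hu ((isWord_unit _).wellFormed (by simp))
  rw [h] at h2
  exact h2.trans ((Equivalent.concat_unit hu' hu.1).cls_eq.trans h)

theorem acUnit_acMul (α : Γ.AC) : Γ.acMul (Γ.acUnit (Γ.acTgt α)) α = α := by
  obtain ⟨u, hu, hu', h⟩ := exists_isWord_cls α
  obtain ⟨h1, h2⟩ := acMul_cls (isWord_unit _) hu' ((isWord_unit _).wellFormed (by simp)) hu
  rw [h] at h2
  exact h2.trans ((Equivalent.unit_cons hu' hu.1).cls_eq.trans h)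

theorem Inversional.exists_acInv (hinv : Γ.Inversional) (α : Γ.AC) :
    ∃ β, Γ.acSrc β = Γ.acTgt α ∧ Γ.acTgt β = Γ.acSrc α ∧
      Γ.acMul α β = Γ.acUnit (Γ.acTgt α) ∧ Γ.acMul β α = Γ.acUnit (Γ.acSrc α) := by
  obtain ⟨u, hu, hu', h⟩ := exists_isWord_cls α
  obtain ⟨v, hv, hv', h1, h2⟩ := hinv.exists_inverse hu' hu.1
  have hw := hv'.wellFormed hv
  obtain ⟨h3, h4⟩ := acMul_cls hu' hv' hu hw
  obtain ⟨h5, h6⟩ := acMul_cls hv' hu' hw hu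
  rw [h] at h4 h6
  exact ⟨Γ.cls ⟨v, hw⟩, hv'.acSrc_cls _, hv'.acTgt_cls _, h4.trans h1.cls_eq, h6.trans h2.cls_eq⟩

/-- The inversion of the associative completion. -/
noncomputable def acInv (hinv : Γ.Inversional) (α : Γ.AC) : Γ.AC := (hinv.exists_acInv α).choose

section Inverse

variable (hinv : Γ.Inversional) (α : Γ.AC)

theorem acSrc_acInv : Γ.acSrc (acInv hinv α) = Γ.acTgt α := (hinv.exists_acInv α).choose_spec.1

theorem acTgt_acInv : Γ.acTgt (acInv hinv α) = Γ.acSrc α := (hinv.exists_acInv α).choose_spec.2.1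

theorem acMul_acInv : Γ.acMul α (acInv hinv α) = Γ.acUnit (Γ.acTgt α) :=
  (hinv.exists_acInv α).choose_spec.2.2.1

theorem acInv_acMul : Γ.acMul (acInv hinv α) α = Γ.acUnit (Γ.acSrc α) :=
  (hinv.exists_acInv α).choose_spec.2.2.2

variable {α}

theorem eq_acInv {β : Γ.AC} (h : Γ.acSrc β = Γ.acTgt α) (h' : Γ.acMul β α = Γ.acUnit (Γ.acSrc α)) :
    β = acInv hinv α := by
  have h1 := acMul_assoc h (acTgt_acInv hinv α).symm
  rw [acMul_acInv, ← h, acMul_acUnit, h', ← acTgt_acInv hinv, acUnit_acMul] at h1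
  exact h1.symm

theorem acInv_acInv : acInv hinv (acInv hinv α) = α :=
  (eq_acInv hinv (acTgt_acInv hinv α).symm (by rw [acMul_acInv, acSrc_acInv])).symm

end Inverse

namespace IsSmoothQuotient

variable {d : ℕ} [TopologicalSpace Γ.AC] [ChartedSpace (EuclideanSpace ℝ (Fin d)) Γ.AC]
  (hN : Γ.IsSmoothQuotient d) (hassoc : Γ.ThreeAssociative) (hinv : Γ.Inversional)
  (hreg : Γ.BiRegular) (haxes : Γ.ProductsConnectedToAxes)
include hN hassoc hinv hreg haxes

theorem smoothNear_acSrc (α : Γ.AC) : SmoothNear (𝓡 d) (𝓡 p) Γ.acSrc α := by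
  obtain ⟨w, ws, y, x, hw, hws, hf⟩ := hN.isRepresentedAt_id hassoc hinv hreg haxes α
  obtain ⟨ws', f, rfl⟩ := (List.eq_nil_or_concat' ws).resolve_left (hws.ne_nil hw)
  refine ((Γ.smoothNear_src _).comp (hws.smooth f (by simp)) rfl).congr ?_
  filter_upwards [hf, hws.isWord] with β ⟨h1, h2⟩ h3
  rw [congrArg Γ.acSrc h2, h3.acSrc_cls h1]
  rw [evalWord_append] at h3
  obtain ⟨z, -, h4, h5⟩ := isWord_append.1 h3
  exact Eq.symm h5

theorem smoothNear_acTgt (α : Γ.AC) : SmoothNear (𝓡 d) (𝓡 p) Γ.acTgt α := by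
  obtain ⟨w, ws, y, x, hw, hws, hf⟩ := hN.isRepresentedAt_id hassoc hinv hreg haxes α
  obtain ⟨f, ws', rfl⟩ := List.exists_cons_of_ne_nil (hws.ne_nil hw)
  refine ((Γ.smoothNear_tgt _).comp (hws.smooth f (by simp)) rfl).congr ?_
  filter_upwards [hf, hws.isWord] with β ⟨h1, h2⟩ h3
  rw [congrArg Γ.acTgt h2, h3.acTgt_cls h1]
  exact h3.1.symm

theorem smoothNear_acInv (α : Γ.AC) : SmoothNear (𝓡 d) (𝓡 d) (acInv hinv) α := by
  obtain ⟨w, ws, y, x, hw, hws, hf⟩ := hN.isRepresentedAt_id hassoc hinv hreg haxes α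
  obtain ⟨w', ws', hw', hws', h⟩ := hws.exists_inverse hassoc hinv hreg hw
  refine hN.smoothNear ⟨w', ws', x, y, hw', hws', ?_⟩
  filter_upwards [hf, hws.isWord, hws'.isWord, h] with β ⟨h1, h2⟩ h3 h4 h5
  have h6 : Γ.WellFormed (evalWord ws' β) := h4.wellFormed (by
    rw [Ne, evalWord_eq_nil]; exact hws'.ne_nil hw')
  refine ⟨h6, (eq_acInv hinv ?_ ?_).symm⟩
  · rw [h4.acSrc_cls, congrArg Γ.acTgt h2, h3.acTgt_cls]
  · obtain ⟨h7, h8⟩ := acMul_cls h4 h3 h6 h1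
    rw [← h2] at h8
    rw [h8, h5.2.cls_eq, congrArg Γ.acSrc h2, h3.acSrc_cls]
    rfl

/-- Families representing the two factors are juxtaposed. The resulting lists are words only for
composable pairs, but the quotient map has smooth extensions to neighbouring lists. -/
theorem exists_acMul_extension {α β : Γ.AC} (h : Γ.acSrc α = Γ.acTgt β) :
    ∃ F : Γ.AC × Γ.AC → Γ.AC, SmoothNear ((𝓡 d).prod (𝓡 d)) (𝓡 d) F (α, β) ∧
      ∀ᶠ q in 𝓝 (α, β), Γ.acSrc q.1 = Γ.acTgt q.2 → F q = Γ.acMul q.1 q.2 := by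
  obtain ⟨w, ws, y, x, hw, hws, hf⟩ := hN.isRepresentedAt_id hassoc hinv hreg haxes α
  obtain ⟨w', ws', y', x', hw', hws', hf'⟩ := hN.isRepresentedAt_id hassoc hinv hreg haxes β
  have key : ∀ᶠ q : Γ.AC × Γ.AC in 𝓝 (α, β), Γ.acSrc q.1 = Γ.acTgt q.2 →
      ∃ h : Γ.WellFormed (evalWord ws q.1 ++ evalWord ws' q.2),
        Γ.acMul q.1 q.2 = Γ.cls ⟨_, h⟩ := by
    have t1 : Tendsto Prod.fst (𝓝 (α, β)) (𝓝 α) := continuous_fst.continuousAt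
    have t2 : Tendsto Prod.snd (𝓝 (α, β)) (𝓝 β) := continuous_snd.continuousAt
    filter_upwards [t1.eventually (hf.and hws.isWord), t2.eventually (hf'.and hws'.isWord)]
      with q ⟨⟨h1, h2⟩, h3⟩ ⟨⟨h1', h2'⟩, h3'⟩ h4
    have h5 : y' q.2 = x q.1 := by
      rw [← h3'.acTgt_cls h1', ← h3.acSrc_cls h1, ← h2, ← h2', h4]
    rw [h5] at h3'
    obtain ⟨h6, h7⟩ := acMul_cls h3 h3' h1 h1'
    rw [← h2, ← h2'] at h7
    exact ⟨h6, h7⟩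
  let L : List (Γ.AC × Γ.AC → G) := ws.map (fun f q => f q.1) ++ ws'.map (fun f q => f q.2)
  have hL : ∀ q, evalWord L q = evalWord ws q.1 ++ evalWord ws' q.2 := fun q => by
    rw [evalWord_append, evalWord_map, evalWord_map]
  have hLs : SmoothList n ((𝓡 d).prod (𝓡 d)) (α, β) L := by
    intro f hf
    rcases List.mem_append.1 hf with hf | hf
    · obtain ⟨f', hf', rfl⟩ := List.mem_map.1 hf
      exact (hws.smooth f' hf').comp (.fst _) rfl
    · obtain ⟨f', hf', rfl⟩ := List.mem_map.1 hf
      exact (hws'.smooth f' hf').comp (.snd _) rfl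
  obtain ⟨F, hF, hFL⟩ := hN.exists_extension hLs (by
    rw [hL]; exact (key.self_of_nhds h).1)
  refine ⟨F, hF, ?_⟩
  filter_upwards [key, hFL] with q h1 h2 h3
  obtain ⟨h4, h5⟩ := h1 h3
  rw [h2 (by rwa [hL]), h5]
  exact congrArg Γ.cls (Subtype.ext (hL q))

theorem tendsto_acMul {ι : Type*} {l : Filter ι} {a b : ι → Γ.AC} {α β : Γ.AC}
    (h : Γ.acSrc α = Γ.acTgt β) (ha : Tendsto a l (𝓝 α)) (hb : Tendsto b l (𝓝 β))
    (hab : ∀ i, Γ.acSrc (a i) = Γ.acTgt (b i)) :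
    Tendsto (fun i => Γ.acMul (a i) (b i)) l (𝓝 (Γ.acMul α β)) := by
  obtain ⟨F, hF, hFm⟩ := hN.exists_acMul_extension hassoc hinv hreg haxes h
  have h1 := ha.prodMk_nhds hb
  refine (hF.tendsto (hFm.self_of_nhds h)).comp h1 |>.congr' ?_
  filter_upwards [h1.eventually hFm] with i hi using hi (hab i)

omit hinv in
-- The local inverse of `Γ.toAC` carries the specialisation to a source fibre of `G`, which is
-- Hausdorff.
theorem eq_acUnit_of_specializes {ρ : Γ.AC} {y : M} (h : Γ.acSrc ρ = y)
    (hρ : ρ ⤳ Γ.acUnit y) : ρ = Γ.acUnit y := by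
  obtain ⟨f, hf, hf0, -, hff⟩ := hN.hasSmoothLocalInverseAt_toAC hassoc hreg haxes (Γ.unit y)
  rw [specializes_iff_pure] at hρ
  have h1 : Γ.toAC (f ρ) = ρ :=
    (Filter.eventually_pure (p := fun β => Γ.toAC (f β) = β)).1 (hff.filter_mono hρ)
  have h2 : Γ.src (f ρ) = y := by
    rw [← h]; exact congrArg Γ.acSrc h1
  have h3 : f ρ ⤳ Γ.unit y := specializes_iff_pure.2 fun O hO => hρ ((hf.tendsto hf0) hO)
  have := Γ.t2_src y
  have h4 : (⟨f ρ, h2⟩ : Γ.src ⁻¹' {y}) = ⟨Γ.unit y, Γ.src_unit y⟩ :=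
    ((subtype_specializes_iff _ _).2 h3).eq
  rw [← h1, show f ρ = Γ.unit y from congrArg Subtype.val h4]
  rfl

/-- Suppose `γ` tends to both `α` and `β`. Their targets agree because `M` is Hausdorff, and both
`βγ⁻¹` and `γα⁻¹` tend to the unit there. Their product is constantly `βα⁻¹`, which therefore
specialises to the unit and equals it. -/
theorem t2Space_acSrc_fibre (x : M) : T2Space (Γ.acSrc ⁻¹' {x}) := by
  rw [t2_iff_nhds]
  rintro ⟨α, hα⟩ ⟨β, hβ⟩ hne
  have hα : Γ.acSrc α = x := hα
  have hβ : Γ.acSrc β = x := hβ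
  rw [Subtype.mk.injEq]
  set l := 𝓝 (⟨α, hα⟩ : Γ.acSrc ⁻¹' {x}) ⊓ 𝓝 ⟨β, hβ⟩
  have h1 : Tendsto (fun γ : Γ.acSrc ⁻¹' {x} => γ.1) l (𝓝 α) :=
    (continuous_subtype_val.tendsto _).mono_left inf_le_left
  have h2 : Tendsto (fun γ : Γ.acSrc ⁻¹' {x} => γ.1) l (𝓝 β) :=
    (continuous_subtype_val.tendsto _).mono_left inf_le_right
  have ht : Γ.acTgt α = Γ.acTgt β := tendsto_nhds_unique
    ((hN.smoothNear_acTgt hassoc hinv hreg haxes α).continuousAt.tendsto.comp h1)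
    ((hN.smoothNear_acTgt hassoc hinv hreg haxes β).continuousAt.tendsto.comp h2)
  have hsγ : ∀ γ : Γ.acSrc ⁻¹' {x}, Γ.acSrc γ.1 = x := fun γ => γ.2
  have hαβ : Γ.acSrc β = Γ.acTgt (acInv hinv α) := by rw [acTgt_acInv, hα, hβ]
  have hc1 : ∀ γ : Γ.acSrc ⁻¹' {x}, Γ.acSrc γ.1 = Γ.acTgt (acInv hinv α) := fun γ => by
    rw [acTgt_acInv, hα, hsγ]
  have hc2 : ∀ γ : Γ.acSrc ⁻¹' {x}, Γ.acSrc β = Γ.acTgt (acInv hinv γ.1) := fun γ => by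
    rw [acTgt_acInv, hβ, hsγ]
  have h3 : Tendsto (fun γ : Γ.acSrc ⁻¹' {x} => Γ.acMul γ.1 (acInv hinv α)) l
      (𝓝 (Γ.acMul α (acInv hinv α))) :=
    hN.tendsto_acMul hassoc hinv hreg haxes (acTgt_acInv hinv α).symm h1 tendsto_const_nhds hc1
  have h4 : Tendsto (fun γ : Γ.acSrc ⁻¹' {x} => Γ.acMul β (acInv hinv γ.1)) l
      (𝓝 (Γ.acMul β (acInv hinv β))) :=
    hN.tendsto_acMul hassoc hinv hreg haxes (acTgt_acInv hinv β).symm tendsto_const_nhds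
      ((hN.smoothNear_acInv hassoc hinv hreg haxes β).continuousAt.tendsto.comp h2) hc2
  rw [acMul_acInv] at h3 h4
  have hcomp : ∀ γ : Γ.acSrc ⁻¹' {x}, Γ.acSrc (Γ.acMul β (acInv hinv γ.1)) =
      Γ.acTgt (Γ.acMul γ.1 (acInv hinv α)) := fun γ => by
    rw [acSrc_acMul (hc2 γ), acTgt_acMul (hc1 γ), acSrc_acInv]
  have h5 := hN.tendsto_acMul hassoc hinv hreg haxes (by rw [acSrc_acUnit, acTgt_acUnit, ht]) h4 h3
    hcomp
  have h6 : ∀ γ : Γ.acSrc ⁻¹' {x}, Γ.acMul (Γ.acMul β (acInv hinv γ.1))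
      (Γ.acMul γ.1 (acInv hinv α)) = Γ.acMul β (acInv hinv α) := fun γ => by
    have e1 : Γ.acSrc (acInv hinv γ.1) = Γ.acTgt γ.1 := acSrc_acInv hinv _
    rw [← acMul_assoc (by rw [acSrc_acMul (hc2 γ), e1]) (hc1 γ), acMul_assoc (hc2 γ) e1,
      acInv_acMul, hsγ, ← hβ, acMul_acUnit]
  simp only [h6] at h5
  have h7 : Γ.acMul (Γ.acUnit (Γ.acTgt β)) (Γ.acUnit (Γ.acTgt α)) = Γ.acUnit (Γ.acTgt β) := by
    have h8 := acMul_acUnit (Γ.acUnit (Γ.acTgt β))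
    rw [acSrc_acUnit] at h8
    rwa [ht]
  rw [h7] at h5
  have h8 : Γ.acMul β (acInv hinv α) = Γ.acUnit (Γ.acTgt β) :=
    hN.eq_acUnit_of_specializes hassoc hreg haxes (by rw [acSrc_acMul hαβ, acSrc_acInv, ht])
      (specializes_iff_pure.2 fun O hO => by
        obtain ⟨γ, hγ⟩ := (h5.eventually hO).exists
        exact hγ)
  have h9 := acMul_assoc hαβ (acSrc_acInv hinv α)
  rw [h8, acInv_acMul, hα, ← hβ, acMul_acUnit, ← ht, acUnit_acMul] at h9
  exact h9

theorem t2Space_acTgt_fibre (x : M) : T2Space (Γ.acTgt ⁻¹' {x}) := by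
  have := hN.t2Space_acSrc_fibre hassoc hinv hreg haxes x
  have hc : Continuous (acInv hinv) := continuous_iff_continuousAt.2 fun α =>
    (hN.smoothNear_acInv hassoc hinv hreg haxes α).continuousAt
  have hm : MapsTo (acInv hinv) (Γ.acTgt ⁻¹' {x}) (Γ.acSrc ⁻¹' {x}) := fun α hα =>
    (acSrc_acInv hinv α).trans hα
  refine T2Space.of_injective_continuous (f := hm.restrict) ?_ (hc.restrict hm)
  exact (hm.restrict_inj).2 fun α _ β _ h => by
    rw [← acInv_acInv hinv (α := α), h, acInv_acInv]

/-- In a plot the source is a linear projection by construction, and the target is the source after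
inversion, so a plot followed by inversion serves for it. -/
theorem isSubmersionAtOfComplement (hd : d = n) {F : Type*} [NormedAddCommGroup F]
    [NormedSpace ℝ F] (hsub : IsSubmersionOfComplement F (𝓡 n) (𝓡 p) ∞ Γ.src) (α : Γ.AC) :
    IsSubmersionAtOfComplement F (𝓡 d) (𝓡 p) ∞ Γ.acSrc α ∧
      IsSubmersionAtOfComplement F (𝓡 d) (𝓡 p) ∞ Γ.acTgt α := by
  subst hd
  have := hN.isManifold
  have hLI := hN.locallyInjective hassoc hreg haxes
  constructor
  · obtain ⟨Φ, D, z, e, κ, hΦ, hz, rfl, hκ, hsrc⟩ := exists_plot hassoc hinv hreg hLI hsub α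
    exact (hN.hasSmoothLocalInverseAt_plot hΦ hz).isSubmersionAtOfComplement
      (hN.smoothNear (hΦ.isRepresentedAt z hz)) e κ hκ
      (hN.smoothNear_acSrc hassoc hinv hreg haxes _).continuousAt (hsrc z hz).1
      (by filter_upwards [hΦ.isOpen.mem_nhds hz] with z' hz' using (hsrc z' hz').2)
  · obtain ⟨Φ, D, z, e, κ, hΦ, hz, hα, hκ, hsrc⟩ :=
      exists_plot hassoc hinv hreg hLI hsub (acInv hinv α)
    obtain rfl : α = acInv hinv (Φ z) := by rw [hα, acInv_acInv]
    have hs := hN.smoothNear_acInv hassoc hinv hreg haxes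
    have hΦs := hN.smoothNear (hΦ.isRepresentedAt z hz)
    obtain ⟨f, f1, f2, f3, f4⟩ := hN.hasSmoothLocalInverseAt_plot hΦ hz
    have hinv0 : acInv hinv (acInv hinv (Φ z)) = Φ z := acInv_acInv hinv
    have h : HasSmoothLocalInverseAt (𝓡 d) (𝓡 d) (fun z => acInv hinv (Φ z)) z := by
      refine ⟨fun β => f (acInv hinv β), f1.comp (hs _) hinv0, ?_, ?_, ?_⟩
      · simp only [hinv0, f2]
      · filter_upwards [f3] with z' hz'
        rw [acInv_acInv, hz']
      · filter_upwards [((hs (acInv hinv (Φ z))).tendsto hinv0).eventually f4] with β hβ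
        rw [hβ, acInv_acInv]
    refine h.isSubmersionAtOfComplement ((hs _).comp hΦs rfl) e κ hκ
      (hN.smoothNear_acTgt hassoc hinv hreg haxes _).continuousAt ?_ ?_
    · rw [acTgt_acInv]; exact (hsrc z hz).1
    · filter_upwards [hΦ.isOpen.mem_nhds hz] with z' hz'
      rw [acTgt_acInv]; exact (hsrc z' hz').2

theorem isLieGroupoid :
    IsLieGroupoid p d Γ.acSrc Γ.acTgt Γ.acUnit Γ.acComp (acInv hinv) := by
  have := hN.isManifold
  have hd : Γ.AC → d = n := fun α => by
    obtain ⟨u, hu, -⟩ := exists_isWord_cls α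
    exact hN.eq_dim (u.head hu.1) hassoc hreg haxes
  obtain ⟨F, _, _, hsub⟩ := Γ.src_submersion
  exact
  { isManifold := hN.isManifold
    secondCountable := hN.secondCountable
    t2_src := hN.t2Space_acSrc_fibre hassoc hinv hreg haxes
    t2_tgt := hN.t2Space_acTgt_fibre hassoc hinv hreg haxes
    src_submersion := ⟨F, _, _, fun α =>
      (hN.isSubmersionAtOfComplement hassoc hinv hreg haxes (hd α) hsub α).1⟩
    tgt_submersion := ⟨F, _, _, fun α =>
      (hN.isSubmersionAtOfComplement hassoc hinv hreg haxes (hd α) hsub α).2⟩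
    unit_smooth := fun x =>
      ((hN.smoothNear (isRepresentedAt_toAC _)).comp (Γ.smoothNear_unit x) rfl).contMDiffAt
    comp_smooth := by
      rintro ⟨⟨α, β⟩, h⟩
      obtain ⟨f, hf, hfm⟩ := hN.exists_acMul_extension hassoc hinv hreg haxes h
      obtain ⟨O, hO, oO, mO⟩ := eventually_nhds_iff.1 (hf.and hfm)
      refine ⟨O, f, oO, mO, fun q hq => (hO q hq).1.contMDiffWithinAt, ?_⟩
      rintro ⟨⟨α', β'⟩, h'⟩ hq
      exact ((hO _ hq).2 h').trans (acComp_eq_acMul α' β' h').symm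
    inv_smooth := fun α => (hN.smoothNear_acInv hassoc hinv hreg haxes α).contMDiffAt
    src_unit := acSrc_acUnit
    tgt_unit := acTgt_acUnit
    src_comp := fun α β h => by rw [acComp_eq_acMul, acSrc_acMul h]
    tgt_comp := fun α β h => by rw [acComp_eq_acMul, acTgt_acMul h]
    assoc := fun α β γ h h' h₁ h₂ => by
      simp only [acComp_eq_acMul]
      exact acMul_assoc h h'
    comp_unit := fun α h => by rw [acComp_eq_acMul, acMul_acUnit]
    unit_comp := fun α h => by rw [acComp_eq_acMul, acUnit_acMul]
    src_inv := acSrc_acInv hinv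
    tgt_inv := acTgt_acInv hinv
    inv_comp := fun α h => by rw [acComp_eq_acMul, acInv_acMul]
    comp_inv := fun α h => by rw [acComp_eq_acMul, acMul_acInv] }

end IsSmoothQuotient

end LocalLieGroupoid

theorem mainTheorem1 {p n : ℕ} {M G : Type*}
    [TopologicalSpace M] [ChartedSpace (EuclideanSpace ℝ (Fin p)) M] [IsManifold (𝓡 p) ∞ M]
    [T2Space M] [SecondCountableTopology M]
    [TopologicalSpace G] [ChartedSpace (EuclideanSpace ℝ (Fin n)) G] [IsManifold (𝓡 n) ∞ G]
    [SecondCountableTopology G]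
    (Γ : LocalLieGroupoid p n M G) (hassoc : Γ.ThreeAssociative) (hinv : Γ.Inversional)
    (hreg : Γ.BiRegular) (haxes : Γ.ProductsConnectedToAxes) :
    (Γ.ACIsSmooth ↔ Γ.AssocUniformlyDiscrete) ∧
    ∀ (d : ℕ) [TopologicalSpace Γ.AC] [ChartedSpace (EuclideanSpace ℝ (Fin d)) Γ.AC],
      Γ.IsSmoothQuotient d →
        (∃ inv : Γ.AC → Γ.AC, IsLieGroupoid p d Γ.acSrc Γ.acTgt Γ.acUnit Γ.acComp inv) ∧
        IsLocalDiffeomorph (𝓡 n) (𝓡 d) ∞ Γ.toAC := by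
  refine ⟨⟨?_, fun h => h.acIsSmooth hassoc hinv hreg haxes⟩, fun d _ _ hN =>
    ⟨⟨_, hN.isLieGroupoid hassoc hinv hreg haxes⟩, hN.isLocalDiffeomorph_toAC hassoc hreg haxes⟩⟩
  rintro ⟨d, _, _, hN⟩
  exact (hN.locallyInjective hassoc hreg haxes).assocUniformlyDiscrete
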